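/- Let $d\ge 1$ and $G=\mathrm{SO}^\circ(d+1,1)$, acting on $\mathbb R\oplus\mathbb R^{d+1}$ with the form $-x_0^2+x_1^2+\dots+x_{d+1}^2$. Let $K=\mathrm{SO}(d+1)$, let $a_t$ be the boost by $t$ in the $(x_0,x_1)$-plane, $M=\mathrm{SO}(d)$ the centralizer of $\{a_t\}$ in $K$, $N=\{n_x\}$ and $\overline N=\{\overline n_x\}$ ($x\in\mathbb R^d$) the horospherical groups with $a_tn_xa_{-t}=n_{e^tx}$ and $a_t\overline n_xa_{-t}=\overline n_{e^{-t}x}$. Write the Iwasawa decomposition $G=KAN$ as $g=\kappa(g)\,a_{H(g)}\,n_g$. Let $dk$, $dm$ be the Haar probability measures of $K$, $M$, and let $d\overline n$ be the Haar measure of $\overline N$ with $\int_{\overline N}e^{-dH(\overline n)}\,d\overline n=1$. For irreducible representations $\tau$ of $K$ (or $M$) put $\chi_\tau=\dim(\tau)\,\mathrm{tr}\,\tau$. Let $\langle\cdot,\cdot\rangle_K$ and $\|\cdot\|_K$ be the inner product and norm of $L^2(K)$ (and $\|\cdot\|_K$ also the operator norm), and let $$[U^s(g)v](k)=e^{-sH(g^{-1}k)}\,v(\kappa(g^{-1}k)),\qquad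 g\in G,\ v\in L^2(K),\ k\in K.$$ For $\upsilon\in\hat M$ let $L^2(K:\upsilon)$ be the space of $v\in L^2(K)$ with $\int_M\overline{\chi_\upsilon(m)}\,v(\cdot\, m)\,dm=v$. For $d/2<s<d$, a complementary series representation $\mathcal U(\upsilon,s)$ is an irreducible unitarizable (closed) subrepresentation of $(U^s,L^2(K:\upsilon))$. For $\tau\in\hat K$ let $\mathcal U(\upsilon,s)_\tau$ be the space of $v\in\mathcal U(\upsilon,s)$ with $\int_K\overline{\chi_\tau(k)}\,U^s(k)v\,dk=v$; it is finite-dimensional and consists of continuous functions. Let $$\boldsymbol\chi_\tau=\sum_i\overline{v_i(e)}\,v_i\quad\text{for an orthonormal basis } (v_i)\text{ of }\mathcal U(\upsilon,s)_\tau,$$ $$T_{\tau_1}^{\tau_2}:\mathcal U(\upsilon,s)_{\tau_1}\to\mathcal U(\upsilon,s)_{\tau_2},\quad T_{\tau_1}^{\tau_2}v=\int_M v(m)\,U^s(m)\boldsymbol\chi_{\tau_2}\,dm,\qquad C_+(s)=\int_{\overline N}e^{-sH(\overline n)}\,U^s(\kappa(\overline n)^{-1})\,d\overline n.$$ Fix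 a basis $(X_j)$ of $\mathfrak k=\mathfrak{so}(d+1)$, put $\|v\|_{\mathcal S^1(K)}^2=\|v\|_K^2+\sum_j\|dU^s(X_j)v\|_K^2$ and $\eta_s=\min\{2s-d,1\}$. Theorem. There is a function $s\mapsto C_s$, depending only on $d$ and $(X_j)$ and bounded above on every compact subset of $(\frac d2,d)$, such that for every complementary series representation $\mathcal U(\upsilon,s)$, all $\tau_1,\tau_2\in\hat K$, all $u\in\mathcal U(\upsilon,s)_{\tau_1}$, $v\in\mathcal U(\upsilon,s)_{\tau_2}$ and all $t\ge0$, $$\Bigl|\langle U^s(a_t)u,v\rangle_K-e^{(s-d)t}\langle T_{\tau_1}^{\tau_2}C_+(s)u,v\rangle_K\Bigr|\le C_s\,e^{(s-d-\eta_s)t}\,\|T_{\tau_1}^{\tau_2}\|_K\,\|u\|_K\,\|v\|_{\mathcal S^1(K)} .$$ -/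

import Mathlib

open MeasureTheory Set
open scoped ComplexConjugate Matrix ENNReal

noncomputable section

namespace HypRep

/-! ### The group `G = SO°(d+1,1)` and its subgroups `K`, `M`, `A`, `N`, `N̄`

`G` acts on `ℝ ⊕ ℝ^(d+1)`; the first coordinate is time, the others are space. -/

/-- Square matrices acting on `ℝ ⊕ ℝ^(d+1)`. -/
abbrev Mat (d : ℕ) : Type := Matrix (Unit ⊕ Fin (d + 1)) (Unit ⊕ Fin (d + 1)) ℝ

/-- The Gram matrix of the Lorentz form `-x₀² + x₁² + ⋯ + x_{d+1}²`. -/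
def lorentzForm (d : ℕ) : Mat d := Matrix.fromBlocks (-1) 0 0 1

/-- `SO°(d+1,1)`: the matrices of determinant one that preserve the Lorentz form and the direction
of time. -/
def G (d : ℕ) : Set (Mat d) :=
  {g | gᵀ * lorentzForm d * g = lorentzForm d ∧ g.det = 1 ∧ 0 < g (Sum.inl ()) (Sum.inl ())}

/-- The maximal compact subgroup `K = SO(d+1)`. -/
abbrev K (d : ℕ) : Type := Matrix.specialOrthogonalGroup (Fin (d + 1)) ℝ

/-- The inclusion of `K` into `G`. -/
def embK {d : ℕ} (k : K d) : Mat d := Matrix.fromBlocks 1 0 0 k.1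

/-- The unit vector (first spatial direction) that spans the direction of translation of `A`. -/
def e₁ (d : ℕ) : Fin (d + 1) → ℝ := Pi.single 0 1

/-- `a_t`, the boost of size `t` in the plane spanned by time and `e₁`. -/
def a (d : ℕ) (t : ℝ) : Mat d :=
  Matrix.fromBlocks (fun _ _ => Real.cosh t)
    (Matrix.replicateRow Unit (Real.sinh t • e₁ d))
    (Matrix.replicateCol Unit (Real.sinh t • e₁ d))
    (1 + (Real.cosh t - 1) • Matrix.vecMulVec (e₁ d) (e₁ d))

/-- The element of the Lie algebra of `G` with `Ad(a_t) Y = e^{ε t} Y` that is attached to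
`x ∈ ℝ^d`, for `ε = 1` or `ε = -1`. It sends `e₀ + ε e₁` to `0`, the time vector `e₀` to
`x ∈ ℝ^d = e₁^⊥`, and `w ∈ ℝ^d` to `⟨x, w⟩ (e₀ + ε e₁)`. -/
def horoLie {d : ℕ} (ε : ℝ) (x : EuclideanSpace ℝ (Fin d)) : Mat d :=
  let v : Fin (d + 1) → ℝ := Fin.cons 0 x
  Matrix.fromBlocks 0 (Matrix.replicateRow Unit v) (Matrix.replicateCol Unit v)
    (ε • (Matrix.vecMulVec (e₁ d) v - Matrix.vecMulVec v (e₁ d)))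

/-- `n_x = exp (Y)`, where `Y = horoLie 1 x` (and `Y³ = 0`). These elements form the horospherical
group `N`, with `a_t n_x a_{-t} = n_{e^t x}`. -/
def n {d : ℕ} (x : EuclideanSpace ℝ (Fin d)) : Mat d :=
  1 + horoLie 1 x + (1 / 2 : ℝ) • (horoLie 1 x * horoLie 1 x)

/-- `n̄_x = exp (Y)`, where `Y = horoLie (-1) x` (and `Y³ = 0`). These elements form the opposite
horospherical group `N̄`, with `a_t n̄_x a_{-t} = n̄_{e^{-t} x}`. -/
def nbar {d : ℕ} (x : EuclideanSpace ℝ (Fin d)) : Mat d :=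
  1 + horoLie (-1) x + (1 / 2 : ℝ) • (horoLie (-1) x * horoLie (-1) x)

/-- The `K`-component `κ(g)` of the Iwasawa decomposition `g = κ(g) a_{H(g)} n_g`, which exists and
is unique for `g ∈ G`. -/
def kappa {d : ℕ} (g : Mat d) : K d :=
  Classical.epsilon fun k => ∃ (t : ℝ) (x : EuclideanSpace ℝ (Fin d)), g = embK k * a d t * n x

/-- The number `H(g)` (with `H(a_t) = t`) of the Iwasawa decomposition `g = κ(g) a_{H(g)} n_g`. -/
def height {d : ℕ} (g : Mat d) : ℝ :=
  Classical.epsilon fun t => ∃ (k : K d) (x : EuclideanSpace ℝ (Fin d)), g = embK k * a d t * n x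

/-- `M = SO(d)`: the subgroup of `K` that fixes `e₁`, i.e. the centralizer of `A` in `K`. -/
def M (d : ℕ) : Subgroup (K d) where
  carrier := {k | k.1 *ᵥ e₁ d = e₁ d}
  one_mem' := by simp
  mul_mem' := by
    intro k l hk hl
    simp only [mem_ofPred_eq] at hk hl ⊢
    rw [Submonoid.coe_mul, ← Matrix.mulVec_mulVec, hl, hk]
  inv_mem' := by
    intro k hk
    simp only [mem_ofPred_eq] at hk ⊢
    have h : (k⁻¹ * k).1 *ᵥ e₁ d = e₁ d := by simp
    rw [Submonoid.coe_mul, ← Matrix.mulVec_mulVec, hk] at h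
    exact h

/-! ### Haar probability measures on `K` and `M` -/

instance (d : ℕ) : IsTopologicalGroup (K d) where
  continuous_inv := by
    refine Continuous.subtype_mk ?_ _
    exact continuous_subtype_val.matrix_conjTranspose

instance (d : ℕ) : CompactSpace (K d) := by
  have hcl : IsClosed {A : Matrix (Fin (d + 1)) (Fin (d + 1)) ℝ |
      A ∈ Matrix.specialOrthogonalGroup (Fin (d + 1)) ℝ} := by
    have : {A : Matrix (Fin (d + 1)) (Fin (d + 1)) ℝ |
        A ∈ Matrix.specialOrthogonalGroup (Fin (d + 1)) ℝ} =
        {A | A * Aᵀ = 1} ∩ {A | A.det = 1} := by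
      ext A
      simp [Matrix.mem_specialOrthogonalGroup_iff, Matrix.mem_orthogonalGroup_iff]
    rw [this]
    exact (isClosed_eq (by fun_prop) continuous_const).inter
      (isClosed_eq (by fun_prop) continuous_const)
  have hsub : {A : Matrix (Fin (d + 1)) (Fin (d + 1)) ℝ |
      A ∈ Matrix.specialOrthogonalGroup (Fin (d + 1)) ℝ} ⊆
      Set.pi univ fun _ => Set.pi univ fun _ => Icc (-1 : ℝ) 1 := by
    intro A hA i _ j _
    have := entry_norm_bound_of_unitary (𝕜 := ℝ)
      (Matrix.mem_specialOrthogonalGroup_iff.1 hA).1 i j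
    exact abs_le.1 this
  exact isCompact_iff_compactSpace.1 ((isCompact_univ_pi fun _ =>
    isCompact_univ_pi fun _ => isCompact_Icc).of_isClosed_subset hcl hsub)

instance (d : ℕ) : MeasurableSpace (K d) := borel _

instance (d : ℕ) : BorelSpace (K d) := ⟨rfl⟩

instance (d : ℕ) : CompactSpace (M d) := by
  refine isCompact_iff_compactSpace.1 (IsClosed.isCompact ?_)
  exact isClosed_eq (continuous_subtype_val.matrix_mulVec continuous_const) continuous_const

/-- The Haar probability measure of a compact group. -/
def haarProb (H : Type) [Group H] [TopologicalSpace H] [IsTopologicalGroup H] [CompactSpace H]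
    [MeasurableSpace H] [BorelSpace H] : Measure H :=
  Measure.haarMeasure ⊤

instance (d : ℕ) : IsProbabilityMeasure (haarProb (K d)) :=
  ⟨Measure.haarMeasure_self⟩

/-! ### Irreducible representations of compact groups -/

/-- An irreducible continuous representation of a compact group `H`, in coordinates (such a
representation has finite dimension and is equivalent to a unitary one). -/
structure IrredRep (H : Type) [Group H] [TopologicalSpace H] where
  dim : ℕ
  rep : Representation ℂ H (Fin dim → ℂ)
  continuous_rep : ∀ w, Continuous fun h => rep h w
  irreducible : rep.IsIrreducible

/-- The normalized character `χ_τ = dim(τ) tr τ`. -/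
def IrredRep.chi {H : Type} [Group H] [TopologicalSpace H] (τ : IrredRep H) (h : H) : ℂ :=
  τ.dim * LinearMap.trace ℂ (Fin τ.dim → ℂ) (τ.rep h)

/-! ### `L²(K)` and the operators on it -/

/-- The Hilbert space `L²(K)`. -/
abbrev L2K (d : ℕ) : Type := Lp ℂ 2 (haarProb (K d))

/-- The inner product `⟨u, v⟩_K`, linear in `u` and conjugate linear in `v`. -/
def innerK {d : ℕ} (u v : L2K d) : ℂ := ∫ k, u k * conj (v k) ∂haarProb (K d)

/-- The operator on `L²(K)` that is given by an operation on functions which respects almost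
everywhere equality and square integrability. -/
def onL2 {d : ℕ} (F : (K d → ℂ) → K d → ℂ) (v : L2K d) : L2K d :=
  open Classical in if h : MemLp (F v) 2 (haarProb (K d)) then h.toLp else 0

/-- The left regular representation, `(λ(k) v)(x) = v(k⁻¹ x)`. -/
def leftReg {d : ℕ} (k : K d) : L2K d → L2K d := onL2 fun f x => f (k⁻¹ * x)

/-- The right regular representation, `(ρ(k) v)(x) = v(x k)`. -/
def rightReg {d : ℕ} (k : K d) : L2K d → L2K d := onL2 fun f x => f (x * k)

/-- The standard representation: `(U^s(g) v)(k) = e^{-s H(g⁻¹ k)} v(κ(g⁻¹ k))` for `g ∈ G`. -/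
def U {d : ℕ} (s : ℝ) (g : Mat d) : L2K d → L2K d :=
  onL2 fun f k => (Real.exp (-s * height (g⁻¹ * embK k)) : ℂ) * f (kappa (g⁻¹ * embK k))

/-- The value at `k` of the continuous representative of `v` (used only for vectors `v` that have
one, which is then unique). -/
def evalAt {d : ℕ} (v : L2K d) (k : K d) : ℂ :=
  Function.invFun (fun f : C(K d, ℂ) => ContinuousMap.toLp 2 (haarProb (K d)) ℂ f) v k

/-- The projection `P_τ = ∫_K conj(χ_τ(k)) λ(k) dk` onto the `τ`-isotypic part of `(λ, L²(K))`. -/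
def projK {d : ℕ} (τ : IrredRep (K d)) (v : L2K d) : L2K d :=
  ∫ k, conj (τ.chi k) • leftReg k v ∂haarProb (K d)

/-- `L²(K : υ)`, the set of all `v` with `∫_M conj(χ_υ(m)) ρ(m) v dm = v`. -/
def L2υ {d : ℕ} (υ : IrredRep (M d)) : Set (L2K d) :=
  {v | ∫ m, conj (υ.chi m) • rightReg (m : K d) v ∂haarProb (M d) = v}

/-! ### Complementary series -/

/-- `V` is invariant under all `U^s(g)`. -/
def Invariant {d : ℕ} (s : ℝ) (V : Submodule ℂ (L2K d)) : Prop :=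
  ∀ g ∈ G d, ∀ v ∈ V, U s g v ∈ V

/-- `V` is a complementary series representation `𝒰(υ, s)`: here `d/2 < s < d`, and `V` is an
irreducible unitarizable subrepresentation of `(U^s, L²(K : υ))`. The (bounded) form `B` restricts
to the inner product of `V` for which `U^s` is unitary. -/
structure IsComplementarySeries {d : ℕ} (υ : IrredRep (M d)) (s : ℝ)
    (V : Submodule ℂ (L2K d)) : Prop where
  lt_s : (d : ℝ) / 2 < s
  s_lt : s < d
  subset_L2υ : (V : Set (L2K d)) ⊆ L2υ υ
  isClosed : IsClosed (V : Set (L2K d))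
  invariant : Invariant s V
  ne_bot : V ≠ ⊥
  irreducible : ∀ W : Submodule ℂ (L2K d), W ≤ V → IsClosed (W : Set (L2K d)) → Invariant s W →
    W = ⊥ ∨ W = V
  unitarizable : ∃ B : L2K d →L⋆[ℂ] L2K d →L[ℂ] ℂ,
    (∀ u ∈ V, ∀ v ∈ V, B u v = conj (B v u)) ∧
    (∀ v ∈ V, v ≠ 0 → 0 < (B v v).re) ∧
    ∀ g ∈ G d, ∀ u ∈ V, ∀ v ∈ V, B (U s g u) (U s g v) = B u v

/-- The `K`-type `V_τ = {v ∈ V : P_τ v = v}` (as the span of that set, which is a subspace). -/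
def kType {d : ℕ} (V : Submodule ℂ (L2K d)) (τ : IrredRep (K d)) : Submodule ℂ (L2K d) :=
  Submodule.span ℂ {v | v ∈ V ∧ projK τ v = v}

/-- The vector `χ_τ = ∑ᵢ conj(vᵢ(e)) vᵢ` of `V_τ`, where `(vᵢ)` is an orthonormal basis of the
space `V_τ`, which always has finite dimension. -/
def chiVec {d : ℕ} (V : Submodule ℂ (L2K d)) (τ : IrredRep (K d)) : L2K d :=
  open Classical in
  if h : FiniteDimensional ℂ (kType V τ) then
    haveI := h
    ∑ i, conj (evalAt (stdOrthonormalBasis ℂ (kType V τ) i : L2K d) 1) •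
      (stdOrthonormalBasis ℂ (kType V τ) i : L2K d)
  else 0

/-- `T_{τ₁}^{τ₂} v = ∫_M v(m) U^s(m) χ_{τ₂} dm`, for `v ∈ V_{τ₁}`. -/
def T {d : ℕ} (s : ℝ) (V : Submodule ℂ (L2K d)) (τ₂ : IrredRep (K d)) (v : L2K d) : L2K d :=
  ∫ m : M d, evalAt v m • U s (embK (m : K d)) (chiVec V τ₂) ∂haarProb (M d)

/-- The operator norm of `T_{τ₁}^{τ₂} : V_{τ₁} → V_{τ₂}` for the norm of `L²(K)`. -/
def normT {d : ℕ} (s : ℝ) (V : Submodule ℂ (L2K d)) (τ₁ τ₂ : IrredRep (K d)) : ℝ :=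
  sInf {c | 0 ≤ c ∧ ∀ v ∈ kType V τ₁, ‖T s V τ₂ v‖ ≤ c * ‖v‖}

/-- The Harish-Chandra `c`-function `C₊(s) v = ∫_N̄ e^{-s H(n̄)} U^s(κ(n̄)⁻¹) v dn̄`. The Haar measure
of `N̄ ≅ ℝ^d` has the usual normalization `∫_N̄ e^{-d H(n̄)} dn̄ = 1`. -/
def Cplus {d : ℕ} (s : ℝ) (v : L2K d) : L2K d :=
  (∫ x : EuclideanSpace ℝ (Fin d), Real.exp (-d * height (nbar x)))⁻¹ •
    ∫ x : EuclideanSpace ℝ (Fin d),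
      Real.exp (-s * height (nbar x)) • U s (embK (kappa (nbar x))⁻¹) v

/-! ### The Sobolev norm of order one -/

/-- The Lie algebra `𝔨 = so(d+1)` of `K`: the skew-symmetric matrices. -/
abbrev LieK (d : ℕ) : Submodule ℝ (Matrix (Fin (d + 1)) (Fin (d + 1)) ℝ) :=
  skewAdjointMatricesSubmodule 1

theorem exp_mem {d : ℕ} (X : LieK d) :
    NormedSpace.exp X.1 ∈ Matrix.specialOrthogonalGroup (Fin (d + 1)) ℝ := by
  have horth : ∀ Y : Matrix (Fin (d + 1)) (Fin (d + 1)) ℝ, Yᵀ = -Y →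
      NormedSpace.exp Y * (NormedSpace.exp Y)ᵀ = 1 := by
    intro Y hY
    rw [← Matrix.exp_transpose, hY, ← Matrix.exp_add_of_commute _ _ (Commute.refl Y).neg_right]
    simp
  have hX : X.1ᵀ = -X.1 := by
    simpa [Matrix.IsSkewAdjoint, Matrix.IsAdjointPair] using
      (mem_skewAdjointMatricesSubmodule _ _).1 X.2
  rw [Matrix.mem_specialOrthogonalGroup_iff, Matrix.mem_orthogonalGroup_iff]
  refine ⟨by simpa [Matrix.star_eq_conjTranspose] using horth _ hX, ?_⟩
  have h2 : ((1 / 2 : ℝ) • X.1)ᵀ = -((1 / 2 : ℝ) • X.1) := by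
    rw [Matrix.transpose_smul, hX, smul_neg]
  have hs : NormedSpace.exp X.1 =
      NormedSpace.exp ((1 / 2 : ℝ) • X.1) * NormedSpace.exp ((1 / 2 : ℝ) • X.1) := by
    rw [← Matrix.exp_add_of_commute _ _ (Commute.refl _), ← add_smul]
    norm_num
  have hd := congrArg Matrix.det (horth _ h2)
  rw [Matrix.det_mul, Matrix.det_transpose, Matrix.det_one] at hd
  rw [hs, Matrix.det_mul, hd]

/-- The exponential map `𝔨 → K`. -/
def expK {d : ℕ} (X : LieK d) : K d := ⟨NormedSpace.exp X.1, exp_mem X⟩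

/-- `dλ(X) v`, the derivative of `λ(exp(tX)) v` at `t = 0` (used only for vectors `v` in a `K`-type,
for which it exists). -/
def dLeft {d : ℕ} (X : LieK d) (v : L2K d) : L2K d :=
  deriv (fun t : ℝ => leftReg (expK (t • X)) v) 0

/-- The Sobolev norm `‖v‖_{S¹(K)}`, with `‖v‖_{S¹(K)}² = ‖v‖² + ∑_j ‖dλ(X_j) v‖²`, of a basis
`(X_j)` of `𝔨`. -/
def sobolev {d : ℕ} {ι : Type*} [Fintype ι] (X : Module.Basis ι ℝ (LieK d)) (v : L2K d) : ℝ :=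
  √(‖v‖ ^ 2 + ∑ j, ‖dLeft (X j) v‖ ^ 2)

/-- `η_s = min {2s - d, 1}`. -/
def eta (d : ℕ) (s : ℝ) : ℝ := min (2 * s - d) 1

end HypRep

end

noncomputable section

namespace HypRep

/-! ### Matrices of rank at most three plus the identity -/

/-! The points `kap x * m` with `x ∈ ℝ^d` and `m ∈ M` fill `K` up to a null set. On this big cell
Haar measure is `c (1+‖x‖²)^(-d) dx dm` (`haarProb_eq_map`), and `a_{-t}` acts by `x ↦ e^t x`
(`a_neg_mul_kap`). Since `χ_τ` reproduces the value at `e`, one has `∫_M w(m) conj(v(m)) dm = ⟨T w,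
v⟩` on the `K`-types (`inner_TOp`). With `y = e^t x` and `ε = e^{-t}` this turns the matrix
coefficient into (`innerK_U_a`) `e^{(s-d)t} c ∫ (1+‖y‖²)^(-s) ⟨T λ(kap y)⁻¹ u, ψ(εy)⟩ dy`, where
`ψ(z) = (1+‖z‖²)^(s-d) λ(kap z)⁻¹ v`. Putting `ψ(0) = v` in place of `ψ(εy)` yields exactly the main
term (`innerK_T_Cplus`). It remains to bound the difference by `ε^η`, with `η = min {2s-d, 1}`.

Let `L ≥ 1` bound the operators `dλ(rot θ)`, `‖θ‖ = 1`, on the `τ₂`-isotypic part. Then `ψ(z) = v -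
2 dλ(rot z) v` up to `O((L‖z‖)²) ‖v‖` for `‖z‖ ≤ 1/L`, and `ψ(z) - v = O(‖v‖)` beyond
(`norm_smul_lam_kap_sub_le`). The remainder integrates to `O((Lε)^η)`, because the radial density
`r^(d-1) (1+r²)^(-s)` is at most `r^(-1-η)` (`integral_radial_le`).

The linear term is `ε` times an integral over `‖y‖ ≤ R = (Lε)⁻¹`. Absolute values would bound it by
`∫ r^(-η) dr`, with a constant that degenerates as `2s - d → 1`. Instead `y` and `-y` are paired. On
a ray, `kap (rθ)` is the rotation by `2 arctan r` in a one-parameter group of period `2π`, so the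
odd part diagonalizes with integer frequencies `n` (`norm_integral_oddRot_le`). What is needed is
then a bound, uniform in `n`, of `∫₀^R r^d (1+r²)^(-s) sin(2n arctan r) dr` by a multiple of `max(1,
R^(1-η)) / η` (`abs_oscillatory_le`). For `r ≤ n` this is integration by parts; for `r ≥ n` the
angle is close to `π`, where the sine of an integer multiple is small.

The order one Sobolev norm enters through the Casimir operator: it is scalar on an isotypic part, so
`L² = 1 + c_τ₂` works for all vectors there at once, while `L ‖v‖` is controlled by the first
derivatives of `v` alone (`exists_casimirConst_le`). As `η ≤ 1`, only the first power of `L` is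
lost. Differentiability of `λ` on a `K`-type comes from convolving matrix coefficients with a smooth
bump (`hasDerivAt_conjMat`). -/

/-- The vector of `ℝ^(d+1)` that is orthogonal to `e₁` and given by `x ∈ ℝ^d`. -/
def lift {d : ℕ} (x : EuclideanSpace ℝ (Fin d)) : Fin (d + 1) → ℝ := Fin.cons 0 x

/-- The matrix with columns `e₀`, `e₁`, `x`. -/
def frame {d : ℕ} (x : EuclideanSpace ℝ (Fin d)) : Matrix (Unit ⊕ Fin (d + 1)) (Fin 3) ℝ :=
  Matrix.of fun i j => ![Sum.elim (fun _ => 1) (fun _ => 0) i,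
    Sum.elim (fun _ => 0) (e₁ d) i, Sum.elim (fun _ => 0) (lift x) i] j

theorem sum_lift_sq {d : ℕ} (x : EuclideanSpace ℝ (Fin d)) :
    ∑ i, lift x i * lift x i = ‖x‖ ^ 2 := by
  rw [Fin.sum_univ_succ, EuclideanSpace.real_norm_sq_eq]
  simp [lift, sq]

theorem sum_e₁_lift {d : ℕ} (x : EuclideanSpace ℝ (Fin d)) :
    ∑ i, e₁ d i * lift x i = 0 := by
  rw [Fin.sum_univ_succ]
  simp [lift, e₁]

theorem sum_e₁_e₁ (d : ℕ) : ∑ i, e₁ d i * e₁ d i = 1 := by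
  rw [Fin.sum_univ_succ]
  simp [e₁]

theorem frame_gram {d : ℕ} (x : EuclideanSpace ℝ (Fin d)) :
    (frame x)ᵀ * frame x = !![1, 0, 0; 0, 1, 0; 0, 0, ‖x‖ ^ 2] := by
  have h1 := sum_lift_sq x
  have h2 := sum_e₁_lift x
  have h3 := sum_e₁_e₁ d
  have h4 : ∑ i, lift x i * e₁ d i = 0 := by simpa only [mul_comm] using h2
  ext i j
  fin_cases i <;> fin_cases j <;>
    simp [frame, Matrix.mul_apply, h1, h2, h3, h4]

/-- The matrix `1 + J P Jᵀ` where `J` has the columns `e₀`, `e₁`, `x`. -/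
def framed {d : ℕ} (x : EuclideanSpace ℝ (Fin d)) (P : Matrix (Fin 3) (Fin 3) ℝ) : Mat d :=
  1 + frame x * P * (frame x)ᵀ

/-- A product of two such matrices sees `J` only through its Gram matrix. All identities between
`a`, `n`, `n̄` and `kap` thereby become identities of 3×3 matrices; `J` need not be injective, so `x
= 0` is no exception. -/
theorem framed_mul {d : ℕ} (x : EuclideanSpace ℝ (Fin d)) (P Q : Matrix (Fin 3) (Fin 3) ℝ) :
    framed x P * framed x Q =
      framed x (P + Q + P * !![1, 0, 0; 0, 1, 0; 0, 0, ‖x‖ ^ 2] * Q) := by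
  rw [← frame_gram x]
  simp only [framed, Matrix.mul_add, Matrix.add_mul, Matrix.mul_one, Matrix.one_mul,
    Matrix.mul_assoc]
  abel

theorem framed_zero {d : ℕ} (x : EuclideanSpace ℝ (Fin d)) : framed x 0 = 1 := by
  simp [framed]

theorem frame_mul_apply {d : ℕ} (x : EuclideanSpace ℝ (Fin d)) (P : Matrix (Fin 3) (Fin 3) ℝ)
    (i j : Unit ⊕ Fin (d + 1)) :
    (frame x * P * (frame x)ᵀ) i j = ∑ k, ∑ l, frame x i k * P k l * frame x j l := by
  simp only [Matrix.mul_apply, Matrix.transpose_apply, Finset.sum_mul]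
  exact Finset.sum_comm

/-! ### The elements of `A`, `N`, `N̄` -/

theorem a_log {d : ℕ} (x : EuclideanSpace ℝ (Fin d)) {w : ℝ} (hw : 0 < w) :
    a d (Real.log w) = framed x !![(w + w⁻¹) / 2 - 1, (w - w⁻¹) / 2, 0;
      (w - w⁻¹) / 2, (w + w⁻¹) / 2 - 1, 0; 0, 0, 0] := by
  have hc : Real.cosh (Real.log w) = (w + w⁻¹) / 2 := by
    rw [Real.cosh_eq, Real.exp_neg, Real.exp_log hw]
  have hs : Real.sinh (Real.log w) = (w - w⁻¹) / 2 := by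
    rw [Real.sinh_eq, Real.exp_neg, Real.exp_log hw]
  ext i j
  rw [framed, Matrix.add_apply, frame_mul_apply]
  rcases i with i | i <;> rcases j with j | j <;>
    simp [a, Matrix.fromBlocks, hc, hs, Fin.sum_univ_three, frame, Matrix.vecMulVec_apply,
      Matrix.one_apply] <;>
    ring

theorem a_exp {d : ℕ} (x : EuclideanSpace ℝ (Fin d)) (t : ℝ) :
    a d t = framed x !![(Real.exp t + (Real.exp t)⁻¹) / 2 - 1,
      (Real.exp t - (Real.exp t)⁻¹) / 2, 0;
      (Real.exp t - (Real.exp t)⁻¹) / 2, (Real.exp t + (Real.exp t)⁻¹) / 2 - 1, 0;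
      0, 0, 0] := by
  rw [← a_log x (Real.exp_pos t), Real.log_exp]

theorem horoLie_eq {d : ℕ} (ε c : ℝ) (x : EuclideanSpace ℝ (Fin d)) :
    horoLie ε (c • x) = frame x * !![0, 0, c; 0, 0, ε * c; c, -(ε * c), 0] * (frame x)ᵀ := by
  have h : (Fin.cons 0 (c • x).ofLp : Fin (d + 1) → ℝ) = c • lift x := by
    ext i
    refine Fin.cases ?_ (fun i => ?_) i <;> simp [lift]
  ext i j
  rw [frame_mul_apply]
  simp only [horoLie, h]
  rcases i with i | i <;> rcases j with j | j <;>
    simp [Fin.sum_univ_three, frame, Matrix.vecMulVec_apply] <;> ring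

theorem one_add_horoLie_sq {d : ℕ} {ε : ℝ} (hε : ε ^ 2 = 1) (c : ℝ)
    (x : EuclideanSpace ℝ (Fin d)) :
    1 + horoLie ε (c • x) + (1 / 2 : ℝ) • (horoLie ε (c • x) * horoLie ε (c • x)) =
      framed x !![c ^ 2 * ‖x‖ ^ 2 / 2, -(ε * c ^ 2 * ‖x‖ ^ 2 / 2), c;
        ε * c ^ 2 * ‖x‖ ^ 2 / 2, -(c ^ 2 * ‖x‖ ^ 2 / 2), ε * c; c, -(ε * c), 0] := by
  set P : Matrix (Fin 3) (Fin 3) ℝ := !![0, 0, c; 0, 0, ε * c; c, -(ε * c), 0] with hP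
  have h : horoLie ε (c • x) * horoLie ε (c • x) =
      frame x * (P * !![1, 0, 0; 0, 1, 0; 0, 0, ‖x‖ ^ 2] * P) * (frame x)ᵀ := by
    rw [horoLie_eq, ← frame_gram x]
    simp only [Matrix.mul_assoc, hP]
  rw [h, horoLie_eq, framed, add_assoc, ← Matrix.smul_mul, ← Matrix.mul_smul, ← Matrix.add_mul,
    ← Matrix.mul_add]
  congr 4
  have h2 : ε * c * (ε * c) = c * c := by linear_combination c * c * hε
  ext i j
  fin_cases i <;> fin_cases j <;> simp [hP, h2] <;>
    first
    | ring1
    | linear_combination (-(1 : ℝ) / 2 * ‖x‖ ^ 2) * h2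
    | linear_combination ((1 : ℝ) / 2 * ‖x‖ ^ 2) * h2

theorem n_smul {d : ℕ} (c : ℝ) (x : EuclideanSpace ℝ (Fin d)) :
    n (c • x) = framed x !![c ^ 2 * ‖x‖ ^ 2 / 2, -(c ^ 2 * ‖x‖ ^ 2 / 2), c;
        c ^ 2 * ‖x‖ ^ 2 / 2, -(c ^ 2 * ‖x‖ ^ 2 / 2), c; c, -c, 0] := by
  rw [n, one_add_horoLie_sq (by norm_num)]
  simp

theorem nbar_eq {d : ℕ} (x : EuclideanSpace ℝ (Fin d)) :
    nbar x = framed x !![‖x‖ ^ 2 / 2, ‖x‖ ^ 2 / 2, 1;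
        -(‖x‖ ^ 2 / 2), -(‖x‖ ^ 2 / 2), -1; 1, 1, 0] := by
  have := one_add_horoLie_sq (ε := -1) (by norm_num) 1 x
  rw [one_smul] at this
  rw [nbar, this]
  simp [neg_div]

/-! ### Rotations in planes that contain `e₁` -/

/-- The infinitesimal rotation in the plane of `e₁` and `x`. -/
def rotMat {d : ℕ} (x : EuclideanSpace ℝ (Fin d)) : Matrix (Fin (d + 1)) (Fin (d + 1)) ℝ :=
  Matrix.vecMulVec (lift x) (e₁ d) - Matrix.vecMulVec (e₁ d) (lift x)

theorem rotMat_mem {d : ℕ} (x : EuclideanSpace ℝ (Fin d)) : rotMat x ∈ LieK d := by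
  rw [mem_skewAdjointMatricesSubmodule]
  simp [Matrix.IsSkewAdjoint, Matrix.IsAdjointPair, rotMat, Matrix.transpose_vecMulVec]

/-- The infinitesimal rotation in the plane of `e₁` and `x`, as an element of `so(d+1)`. -/
def rot {d : ℕ} : EuclideanSpace ℝ (Fin d) →ₗ[ℝ] LieK d where
  toFun x := ⟨rotMat x, rotMat_mem x⟩
  map_add' x y := by
    have h : lift (x + y) = lift x + lift y := by
      ext i
      refine Fin.cases ?_ (fun i => ?_) i <;> simp [lift]
    ext i j
    simp [rotMat, Matrix.vecMulVec_apply, h]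
    ring
  map_smul' c x := by
    have h : lift (c • x) = c • lift x := by
      ext i
      refine Fin.cases ?_ (fun i => ?_) i <;> simp [lift]
    ext i j
    simp [rotMat, Matrix.vecMulVec_apply, h]
    ring

theorem rotMat_sq {d : ℕ} (x : EuclideanSpace ℝ (Fin d)) :
    rotMat x * rotMat x = -Matrix.vecMulVec (lift x) (lift x) -
      ‖x‖ ^ 2 • Matrix.vecMulVec (e₁ d) (e₁ d) := by
  have h1 : lift x ⬝ᵥ lift x = ‖x‖ ^ 2 := sum_lift_sq x
  have h2 : e₁ d ⬝ᵥ lift x = 0 := sum_e₁_lift x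
  have h3 : e₁ d ⬝ᵥ e₁ d = 1 := sum_e₁_e₁ d
  have h4 : lift x ⬝ᵥ e₁ d = 0 := by rw [dotProduct_comm, h2]
  simp only [rotMat, Matrix.sub_mul, Matrix.mul_sub, Matrix.vecMulVec_mul_vecMulVec, h1, h2, h3, h4]
  ext i j
  simp [Matrix.vecMulVec_apply]
  ring

theorem rotMat_cube {d : ℕ} (x : EuclideanSpace ℝ (Fin d)) :
    rotMat x * (rotMat x * rotMat x) = -‖x‖ ^ 2 • rotMat x := by
  have h1 : lift x ⬝ᵥ lift x = ‖x‖ ^ 2 := sum_lift_sq x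
  have h2 : e₁ d ⬝ᵥ lift x = 0 := sum_e₁_lift x
  have h3 : e₁ d ⬝ᵥ e₁ d = 1 := sum_e₁_e₁ d
  have h4 : lift x ⬝ᵥ e₁ d = 0 := by rw [dotProduct_comm, h2]
  rw [rotMat_sq]
  simp only [rotMat, Matrix.sub_mul, Matrix.mul_sub, Matrix.mul_smul, Matrix.mul_neg,
    Matrix.vecMulVec_mul_vecMulVec, h1, h2, h3, h4]
  ext i j
  simp [Matrix.vecMulVec_apply]
  ring

-- Rodrigues' formula. The right-hand side `R` solves `R' = E R`, so `exp(-uE) R(u)` has derivative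
-- zero.
open scoped Matrix.Norms.Operator in
theorem exp_smul_of_cube_eq_neg {m : Type*} [Fintype m] [DecidableEq m] (E : Matrix m m ℝ)
    (hE : E * (E * E) = -E) (r : ℝ) :
    NormedSpace.exp (r • E) = 1 + Real.sin r • E + (1 - Real.cos r) • (E * E) := by
  let R : ℝ → Matrix m m ℝ := fun r => 1 + Real.sin r • E + (1 - Real.cos r) • (E * E)
  have hR : ∀ r, HasDerivAt R (Real.cos r • E + Real.sin r • (E * E)) r := by
    intro r
    have h1 := (Real.hasDerivAt_sin r).smul_const E
    have h2 := ((Real.hasDerivAt_cos r).const_sub 1).smul_const (E * E)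
    exact ((h1.const_add 1).add h2).congr_deriv (by simp)
  have hexp : ∀ r : ℝ, HasDerivAt (fun u : ℝ => NormedSpace.exp (u • (-E)))
      (NormedSpace.exp (r • (-E)) * (-E)) r := fun r => hasDerivAt_exp_smul_const (-E) r
  have hprod : ∀ r, HasDerivAt (fun u : ℝ => NormedSpace.exp (u • (-E)) * R u) 0 r := by
    intro r
    refine ((hexp r).mul (hR r)).congr_deriv ?_
    have : E * R r = Real.cos r • E + Real.sin r • (E * E) := by
      simp only [R, Matrix.mul_add, Matrix.mul_one, Matrix.mul_smul, hE]
      module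
    rw [mul_assoc, neg_mul, this, mul_neg, neg_add_cancel]
  have hconst := is_const_of_deriv_eq_zero (fun r => (hprod r).differentiableAt)
    (fun r => (hprod r).deriv) r 0
  simp only [zero_smul, NormedSpace.exp_zero, one_mul] at hconst
  have h0 : R 0 = 1 := by simp [R]
  rw [h0] at hconst
  have hinv : NormedSpace.exp (r • E) * NormedSpace.exp (r • (-E)) = 1 := by
    rw [← Matrix.exp_add_of_commute]
    · simp
    · simp only [smul_neg]
      exact (Commute.refl _).neg_right
  calc NormedSpace.exp (r • E) = NormedSpace.exp (r • E) * (NormedSpace.exp (r • (-E)) * R r) := by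
        rw [hconst, mul_one]
    _ = R r := by rw [← Matrix.mul_assoc, hinv, one_mul]

/-- `κ(n̄_x)`: the rotation by the angle `2 arctan ‖x‖` in the plane of `e₁` and `x`. -/
def kap {d : ℕ} (x : EuclideanSpace ℝ (Fin d)) : K d :=
  expK (rot ((2 * Real.arctan ‖x‖ / ‖x‖) • x))

theorem expK_zero {d : ℕ} : expK (0 : LieK d) = 1 := by
  apply Subtype.ext
  simp [expK]

theorem coe_expK_smul_rot {d : ℕ} {x : EuclideanSpace ℝ (Fin d)} (hx : ‖x‖ = 1) (r : ℝ) :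
    (expK (r • rot x)).1 = 1 + Real.sin r • rotMat x + (1 - Real.cos r) • (rotMat x * rotMat x) :=
  exp_smul_of_cube_eq_neg (rotMat x) (by rw [rotMat_cube, hx]; simp) r

theorem sin_two_arctan (r : ℝ) : Real.sin (2 * Real.arctan r) = 2 * r / (1 + r ^ 2) := by
  have h : (0 : ℝ) < 1 + r ^ 2 := by positivity
  rw [Real.sin_two_mul, Real.sin_arctan, Real.cos_arctan]
  field_simp
  rw [Real.sq_sqrt h.le]

theorem cos_two_arctan (r : ℝ) : Real.cos (2 * Real.arctan r) = (1 - r ^ 2) / (1 + r ^ 2) := by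
  have h : (0 : ℝ) < 1 + r ^ 2 := by positivity
  rw [Real.cos_two_mul, Real.cos_arctan, div_pow, Real.sq_sqrt h.le]
  field_simp
  ring

/-- The arctangent is odd, so the formula covers negative `r` too: a line through the origin, not
just a ray, maps into one one-parameter group. At `r = 0` the quotient in `kap` takes the value `0`,
as it should. -/
theorem kap_smul {d : ℕ} {x : EuclideanSpace ℝ (Fin d)} (hx : ‖x‖ = 1) (r : ℝ) :
    kap (r • x) = expK ((2 * Real.arctan r) • rot x) := by
  rw [kap, norm_smul, hx, mul_one, smul_smul, map_smul]
  rcases lt_trichotomy r 0 with h | h | h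
  · rw [Real.norm_of_nonpos h.le, Real.arctan_neg]
    congr 2
    have := h.ne
    field_simp
  · simp [h]
  · rw [Real.norm_of_nonneg h.le]
    congr 2
    have := h.ne'
    field_simp

theorem coe_kap {d : ℕ} (x : EuclideanSpace ℝ (Fin d)) :
    (kap x).1 = 1 + (2 / (1 + ‖x‖ ^ 2)) • (rotMat x + rotMat x * rotMat x) := by
  rcases eq_or_ne x 0 with rfl | hx
  · have : lift (0 : EuclideanSpace ℝ (Fin d)) = 0 := by
      ext i
      refine Fin.cases ?_ (fun i => ?_) i <;> simp [lift]
    have h : rotMat (0 : EuclideanSpace ℝ (Fin d)) = 0 := by simp [rotMat, this]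
    simp [kap, h, expK_zero]
  have hx' : ‖x‖ ≠ 0 := norm_ne_zero_iff.2 hx
  set θ := ‖x‖⁻¹ • x with hθ
  have hn : ‖θ‖ = 1 := by simp [hθ, norm_smul, hx']
  have hxθ : x = ‖x‖ • θ := by simp [hθ, smul_smul, hx']
  have hr : rotMat x = ‖x‖ • rotMat θ := by
    have : rot x = ‖x‖ • rot θ := by rw [← map_smul, ← hxθ]
    exact congrArg Subtype.val this
  have hk : kap x = expK ((2 * Real.arctan ‖x‖) • rot θ) := by
    rw [← kap_smul hn, ← hxθ]
  rw [hk, coe_expK_smul_rot hn, sin_two_arctan, cos_two_arctan, hr, add_assoc, smul_add]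
  simp only [Matrix.smul_mul, Matrix.mul_smul, smul_smul]
  congr 3
  · ring
  · field_simp
    ring

theorem embK_kap {d : ℕ} (c : ℝ) (x : EuclideanSpace ℝ (Fin d)) :
    embK (kap (c • x)) = framed x ((2 / (1 + c ^ 2 * ‖x‖ ^ 2)) •
      !![0, 0, 0; 0, -(c ^ 2 * ‖x‖ ^ 2), -c; 0, c, -c ^ 2]) := by
  have hr : rotMat (c • x) = c • rotMat x := congrArg Subtype.val (map_smul rot c x)
  have hn : ‖c • x‖ ^ 2 = c ^ 2 * ‖x‖ ^ 2 := by rw [norm_smul, mul_pow, Real.norm_eq_abs, sq_abs]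
  ext i j
  rw [framed, Matrix.add_apply, frame_mul_apply, embK, coe_kap, hr, hn]
  simp only [Matrix.smul_mul, Matrix.mul_smul, smul_smul, rotMat_sq]
  rcases i with i | i <;> rcases j with j | j <;>
    simp [Fin.sum_univ_three, frame, Matrix.vecMulVec_apply, Matrix.one_apply, rotMat]
  ring

/-! ### The Iwasawa decomposition -/

theorem embK_mul {d : ℕ} (k l : K d) : embK (k * l) = embK k * embK l := by
  simp [embK, Matrix.fromBlocks_multiply]

theorem embK_one {d : ℕ} : embK (1 : K d) = 1 := by
  simp [embK]

theorem embK_inv {d : ℕ} (k : K d) : (embK k)⁻¹ = embK k⁻¹ := by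
  apply Matrix.inv_eq_right_inv
  rw [← embK_mul, mul_inv_cancel, embK_one]

theorem a_mul_a {d : ℕ} (s t : ℝ) : a d s * a d t = a d (s + t) := by
  rw [a_exp 0 s, a_exp 0 t, a_exp 0 (s + t), framed_mul, Real.exp_add]
  congr 1
  have h1 := Real.exp_pos s
  have h2 := Real.exp_pos t
  ext i j
  fin_cases i <;> fin_cases j <;> simp <;> field_simp <;>
    ring

theorem a_zero (d : ℕ) : a d 0 = 1 := by
  ext i j
  rcases i with i | i <;> rcases j with j | j <;>
    simp [a, Matrix.fromBlocks, Matrix.one_apply]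

theorem a_inv {d : ℕ} (t : ℝ) : (a d t)⁻¹ = a d (-t) := by
  apply Matrix.inv_eq_right_inv
  rw [a_mul_a, add_neg_cancel, a_zero]

theorem n_mul_n_neg {d : ℕ} (x : EuclideanSpace ℝ (Fin d)) : n x * n (-x) = 1 := by
  have h1 := n_smul 1 x
  have h2 := n_smul (-1) x
  rw [one_smul] at h1
  rw [neg_one_smul] at h2
  rw [h1, h2, framed_mul, ← framed_zero x]
  congr 1
  ext i j
  fin_cases i <;> fin_cases j <;> simp <;> ring

theorem nbar_eq_mul {d : ℕ} (x : EuclideanSpace ℝ (Fin d)) :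
    nbar x = embK (kap x) * a d (Real.log (1 + ‖x‖ ^ 2)) * n ((1 + ‖x‖ ^ 2)⁻¹ • x) := by
  have h : (0 : ℝ) < 1 + ‖x‖ ^ 2 := by positivity
  have hk := embK_kap 1 x
  rw [one_smul] at hk
  rw [nbar_eq, hk, a_log x h, n_smul, framed_mul, framed_mul]
  congr 1
  ext i j
  fin_cases i <;> fin_cases j <;> simp <;> field_simp <;>
    ring

/-- This is `a_{-t} n̄_x a_t = n̄_{e^t x}` read modulo `AN` on the right: `kap x` and `n̄_x` differ
by an element of `AN`. The `A`-part is `log(1+e^{2t}‖x‖²) - t - log(1+‖x‖²)`. -/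
theorem a_neg_mul_kap {d : ℕ} (t : ℝ) (x : EuclideanSpace ℝ (Fin d)) :
    ∃ z, a d (-t) * embK (kap x) = embK (kap (Real.exp t • x)) *
      a d (Real.log ((1 + Real.exp t ^ 2 * ‖x‖ ^ 2) / (Real.exp t * (1 + ‖x‖ ^ 2)))) * n z := by
  have ht := Real.exp_pos t
  set w := Real.exp t with hw
  have h : (0 : ℝ) < 1 + ‖x‖ ^ 2 := by positivity
  have h' : (0 : ℝ) < 1 + w ^ 2 * ‖x‖ ^ 2 := by positivity
  have hk := embK_kap 1 x
  rw [one_smul] at hk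
  refine ⟨((w ^ 2 - 1) / (1 + w ^ 2 * ‖x‖ ^ 2)) • x, ?_⟩
  rw [a_exp x, Real.exp_neg, ← hw, hk, embK_kap, a_log x (by positivity), n_smul, framed_mul,
    framed_mul, framed_mul]
  congr 1
  ext i j
  fin_cases i <;> fin_cases j <;> simp <;> field_simp <;>
    ring

theorem orthogonal_mul {d : ℕ} (k : K d) : k.1 * (k.1)ᵀ = 1 :=
  (Matrix.mem_orthogonalGroup_iff _ _).1 (Matrix.mem_specialOrthogonalGroup_iff.1 k.2).1

theorem orthogonal_mul' {d : ℕ} (k : K d) : (k.1)ᵀ * k.1 = 1 :=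
  (Matrix.mem_orthogonalGroup_iff' _ _).1 (Matrix.mem_specialOrthogonalGroup_iff.1 k.2).1

theorem M_mulVec {d : ℕ} {m : K d} (hm : m ∈ M d) : m.1 *ᵥ e₁ d = e₁ d := hm

theorem M_vecMul {d : ℕ} {m : K d} (hm : m ∈ M d) : e₁ d ᵥ* m.1 = e₁ d := by
  nth_rewrite 1 [← M_mulVec hm]
  rw [← Matrix.vecMul_transpose, Matrix.vecMul_vecMul, orthogonal_mul', Matrix.vecMul_one]

theorem a_mul_embK {d : ℕ} (t : ℝ) {m : K d} (hm : m ∈ M d) :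
    a d t * embK m = embK m * a d t := by
  have ha : a d t = Matrix.fromBlocks (Matrix.of fun _ _ => Real.cosh t)
    (Matrix.replicateRow Unit (Real.sinh t • e₁ d))
    (Matrix.replicateCol Unit (Real.sinh t • e₁ d))
    (1 + (Real.cosh t - 1) • Matrix.vecMulVec (e₁ d) (e₁ d)) := rfl
  rw [ha, embK, Matrix.fromBlocks_multiply, Matrix.fromBlocks_multiply]
  congr 1
  · simp
  · simp [← Matrix.replicateRow_vecMul, M_vecMul hm]
  · simp [← Matrix.replicateCol_mulVec, M_mulVec hm]
  · simp [Matrix.add_mul, Matrix.mul_add, Matrix.vecMulVec_mul, Matrix.mul_vecMulVec, M_vecMul hm,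
      M_mulVec hm]

theorem exists_lift {d : ℕ} {w : Fin (d + 1) → ℝ} (hw : w 0 = 0) :
    ∃ x : EuclideanSpace ℝ (Fin d), lift x = w := by
  refine ⟨WithLp.toLp 2 fun i => w i.succ, ?_⟩
  ext i
  refine Fin.cases ?_ (fun i => ?_) i <;> simp [lift, hw]

theorem dotProduct_e₁ {d : ℕ} (w : Fin (d + 1) → ℝ) : w ⬝ᵥ e₁ d = w 0 := by
  simp [e₁]

theorem n_mul_embK {d : ℕ} (x : EuclideanSpace ℝ (Fin d)) {m : K d} (hm : m ∈ M d) :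
    ∃ z, n x * embK m = embK m * n z := by
  obtain ⟨z, hz⟩ : ∃ z : EuclideanSpace ℝ (Fin d), lift z = lift x ᵥ* m.1 := by
    apply exists_lift
    refine (dotProduct_e₁ _).symm.trans ?_
    rw [← Matrix.dotProduct_mulVec, M_mulVec hm, dotProduct_e₁]
    simp [lift]
  have hz' : m.1 *ᵥ lift z = lift x := by
    rw [hz, ← Matrix.vecMul_transpose, Matrix.vecMul_vecMul, orthogonal_mul, Matrix.vecMul_one]
  have h : horoLie 1 x * embK m = embK m * horoLie 1 z := by
    change Matrix.fromBlocks 0 (Matrix.replicateRow Unit (lift x))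
      (Matrix.replicateCol Unit (lift x)) ((1 : ℝ) • (Matrix.vecMulVec (e₁ d) (lift x) -
        Matrix.vecMulVec (lift x) (e₁ d))) * _ = _ * Matrix.fromBlocks 0
      (Matrix.replicateRow Unit (lift z)) (Matrix.replicateCol Unit (lift z))
      ((1 : ℝ) • (Matrix.vecMulVec (e₁ d) (lift z) - Matrix.vecMulVec (lift z) (e₁ d)))
    rw [embK, Matrix.fromBlocks_multiply, Matrix.fromBlocks_multiply]
    congr 1
    · simp
    · simp [← Matrix.replicateRow_vecMul, hz]
    · simp [← Matrix.replicateCol_mulVec, hz']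
    · simp [Matrix.sub_mul, Matrix.mul_sub, Matrix.vecMulVec_mul, Matrix.mul_vecMulVec,
        M_vecMul hm, M_mulVec hm, ← hz, hz']
  refine ⟨z, ?_⟩
  simp only [n, Matrix.add_mul, Matrix.mul_add, Matrix.smul_mul, Matrix.mul_smul, h,
    Matrix.mul_assoc, Matrix.one_mul, Matrix.mul_one]
  rw [← Matrix.mul_assoc (horoLie 1 x) (embK m), h, Matrix.mul_assoc]

theorem embK_mul_inl {d : ℕ} (k : K d) (A : Mat d) (j : Unit ⊕ Fin (d + 1)) :
    (embK k * A) (Sum.inl ()) j = A (Sum.inl ()) j := by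
  simp [embK, Matrix.mul_apply]

theorem a_mul_n_inl {d : ℕ} (t : ℝ) (x : EuclideanSpace ℝ (Fin d)) :
    (a d t * n x) (Sum.inl ()) (Sum.inl ()) + (a d t * n x) (Sum.inl ()) (Sum.inr 0) = Real.exp t ∧
      ∀ i, (a d t * n x) (Sum.inl ()) (Sum.inr (Fin.succ i)) = Real.exp t * x i := by
  have h := n_smul 1 x
  rw [one_smul] at h
  have ht := Real.exp_pos t
  rw [a_exp x, h, framed_mul]
  simp only [framed, Matrix.add_apply, frame_mul_apply]
  simp [Fin.sum_univ_three, frame, lift, e₁]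
  constructor
  · field_simp
    ring
  · intro i
    left
    field_simp
    ring

theorem embK_injective {d : ℕ} : Function.Injective (embK (d := d)) := by
  intro k l h
  have := (Matrix.fromBlocks_inj.1 h).2.2.2
  exact Subtype.ext this

/-- Left multiplication by `K` leaves the time row unchanged, and the time row of `a_t n_x`
determines `e^t` and then `e^t x`. -/
theorem iwasawa_unique {d : ℕ} {k k' : K d} {t t' : ℝ} {x x' : EuclideanSpace ℝ (Fin d)}
    (h : embK k * a d t * n x = embK k' * a d t' * n x') : k = k' ∧ t = t' := by
  rw [Matrix.mul_assoc, Matrix.mul_assoc] at h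
  have h0 : ∀ j, (a d t * n x) (Sum.inl ()) j = (a d t' * n x') (Sum.inl ()) j := fun j =>
    (embK_mul_inl k _ j).symm.trans ((congrFun (congrFun h _) j).trans (embK_mul_inl k' _ j))
  have ht : t = t' := by
    apply Real.exp_injective
    rw [← (a_mul_n_inl t x).1, h0, h0, (a_mul_n_inl t' x').1]
  subst ht
  have hx : x = x' := by
    ext i
    have := h0 (Sum.inr (Fin.succ i))
    rw [(a_mul_n_inl t x).2, (a_mul_n_inl t x').2] at this
    exact mul_left_cancel₀ (Real.exp_pos t).ne' this
  subst hx
  have hinv : (a d t * n x) * (n (-x) * a d (-t)) = 1 := by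
    rw [Matrix.mul_assoc, ← Matrix.mul_assoc (n x), n_mul_n_neg, Matrix.one_mul, a_mul_a,
      add_neg_cancel, a_zero]
  have := congrArg (· * (n (-x) * a d (-t))) h
  simp only [Matrix.mul_assoc (embK _), hinv, Matrix.mul_one] at this
  exact ⟨embK_injective this, rfl⟩

/-- By uniqueness, any exhibited decomposition identifies the component chosen by
`Classical.epsilon`; existence for general `g` is never needed. -/
theorem kappa_eq {d : ℕ} {g : Mat d} {k : K d} {t : ℝ} {x : EuclideanSpace ℝ (Fin d)}
    (h : g = embK k * a d t * n x) : kappa g = k := by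
  have h1 : ∃ (t : ℝ) (x : EuclideanSpace ℝ (Fin d)), g = embK (kappa g) * a d t * n x :=
    Classical.epsilon_spec (p := fun k => ∃ (t : ℝ) (x : EuclideanSpace ℝ (Fin d)),
      g = embK k * a d t * n x) ⟨k, t, x, h⟩
  obtain ⟨t', x', h'⟩ := h1
  exact (iwasawa_unique (h'.symm.trans h)).1

theorem height_eq {d : ℕ} {g : Mat d} {k : K d} {t : ℝ} {x : EuclideanSpace ℝ (Fin d)}
    (h : g = embK k * a d t * n x) : height g = t := by
  have h1 : ∃ (k : K d) (x : EuclideanSpace ℝ (Fin d)), g = embK k * a d (height g) * n x :=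
    Classical.epsilon_spec (p := fun t => ∃ (k : K d) (x : EuclideanSpace ℝ (Fin d)),
      g = embK k * a d t * n x) ⟨t, k, x, h⟩
  obtain ⟨k', x', h'⟩ := h1
  exact (iwasawa_unique (h'.symm.trans h)).2

theorem n_zero {d : ℕ} : n (0 : EuclideanSpace ℝ (Fin d)) = 1 := by
  have := n_smul 0 (0 : EuclideanSpace ℝ (Fin d))
  rw [zero_smul] at this
  rw [this, ← framed_zero 0]
  congr 1
  ext i j
  fin_cases i <;> fin_cases j <;> simp

theorem embK_eq {d : ℕ} (k : K d) : embK k = embK k * a d 0 * n 0 := by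
  rw [a_zero, n_zero, mul_one, mul_one]

theorem kappa_embK {d : ℕ} (k : K d) : kappa (embK k) = k := kappa_eq (embK_eq k)

theorem height_embK {d : ℕ} (k : K d) : height (embK k) = 0 := height_eq (embK_eq k)

theorem kappa_nbar {d : ℕ} (x : EuclideanSpace ℝ (Fin d)) : kappa (nbar x) = kap x :=
  kappa_eq (nbar_eq_mul x)

theorem height_nbar {d : ℕ} (x : EuclideanSpace ℝ (Fin d)) :
    height (nbar x) = Real.log (1 + ‖x‖ ^ 2) :=
  height_eq (nbar_eq_mul x)

theorem a_inv_mul_embK {d : ℕ} (t : ℝ) (x : EuclideanSpace ℝ (Fin d)) {m : K d} (hm : m ∈ M d) :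
    ∃ z, (a d t)⁻¹ * embK (kap x * m) = embK (kap (Real.exp t • x) * m) *
      a d (Real.log ((1 + Real.exp t ^ 2 * ‖x‖ ^ 2) / (Real.exp t * (1 + ‖x‖ ^ 2)))) * n z := by
  obtain ⟨z, hz⟩ := a_neg_mul_kap t x
  obtain ⟨z', hz'⟩ := n_mul_embK z hm
  refine ⟨z', ?_⟩
  rw [a_inv, embK_mul, ← Matrix.mul_assoc, hz, Matrix.mul_assoc, hz', embK_mul,
    Matrix.mul_assoc, ← Matrix.mul_assoc (a d _), a_mul_embK _ hm]
  simp only [Matrix.mul_assoc]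

theorem kappa_a_inv {d : ℕ} (t : ℝ) (x : EuclideanSpace ℝ (Fin d)) {m : K d} (hm : m ∈ M d) :
    kappa ((a d t)⁻¹ * embK (kap x * m)) = kap (Real.exp t • x) * m := by
  obtain ⟨z, hz⟩ := a_inv_mul_embK t x hm
  exact kappa_eq hz

theorem height_a_inv {d : ℕ} (t : ℝ) (x : EuclideanSpace ℝ (Fin d)) {m : K d} (hm : m ∈ M d) :
    height ((a d t)⁻¹ * embK (kap x * m)) =
      Real.log ((1 + Real.exp t ^ 2 * ‖x‖ ^ 2) / (Real.exp t * (1 + ‖x‖ ^ 2))) := by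
  obtain ⟨z, hz⟩ := a_inv_mul_embK t x hm
  exact height_eq hz

theorem embK_mem {d : ℕ} (k : K d) : embK k ∈ G d := by
  refine ⟨?_, ?_, ?_⟩
  · simp [embK, lorentzForm, Matrix.fromBlocks_transpose, Matrix.fromBlocks_multiply,
      orthogonal_mul']
  · simp [embK, (Matrix.mem_specialOrthogonalGroup_iff.1 k.2).2]
  · simp [embK]

/-! ### The big cell of `K` -/

theorem kap_mulVec {d : ℕ} (x : EuclideanSpace ℝ (Fin d)) :
    (kap x).1 *ᵥ e₁ d = (1 + ‖x‖ ^ 2)⁻¹ • ((1 - ‖x‖ ^ 2) • e₁ d + 2 • lift x) := by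
  have h2 : lift x ⬝ᵥ e₁ d = 0 := by
    rw [dotProduct_comm]
    exact sum_e₁_lift x
  have h3 : e₁ d ⬝ᵥ e₁ d = 1 := sum_e₁_e₁ d
  have h : (1 : ℝ) + ‖x‖ ^ 2 ≠ 0 := by positivity
  rw [coe_kap, rotMat_sq, rotMat]
  simp only [Matrix.add_mulVec, Matrix.smul_mulVec, Matrix.sub_mulVec, Matrix.neg_mulVec,
    Matrix.one_mulVec, Matrix.vecMulVec_mulVec, h2, h3]
  ext i
  simp
  field_simp
  ring

/-- The coordinate `x` of `k = κ(n̄_x) m`. -/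
def cell {d : ℕ} (k : K d) : EuclideanSpace ℝ (Fin d) :=
  WithLp.toLp 2 fun i => (1 + k.1 0 0)⁻¹ * k.1 i.succ 0

theorem mulVec_e₁ {d : ℕ} (A : Matrix (Fin (d + 1)) (Fin (d + 1)) ℝ) (i : Fin (d + 1)) :
    (A *ᵥ e₁ d) i = A i 0 := by
  simp [e₁, Matrix.mulVec_single]

theorem kap_mul_apply {d : ℕ} (x : EuclideanSpace ℝ (Fin d)) {m : K d} (hm : m ∈ M d)
    (i : Fin (d + 1)) : (kap x * m).1 i 0 =
      (1 + ‖x‖ ^ 2)⁻¹ * ((1 - ‖x‖ ^ 2) * e₁ d i + 2 * lift x i) := by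
  refine (mulVec_e₁ _ i).symm.trans ?_
  rw [Submonoid.coe_mul, ← Matrix.mulVec_mulVec, M_mulVec hm, kap_mulVec]
  simp

theorem one_add_kap_mul {d : ℕ} (x : EuclideanSpace ℝ (Fin d)) {m : K d} (hm : m ∈ M d) :
    1 + (kap x * m).1 0 0 = 2 * (1 + ‖x‖ ^ 2)⁻¹ := by
  rw [kap_mul_apply x hm]
  simp [e₁, lift]
  field_simp
  ring

theorem cell_kap_mul {d : ℕ} (x : EuclideanSpace ℝ (Fin d)) {m : K d} (hm : m ∈ M d) :
    cell (kap x * m) = x := by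
  ext i
  simp only [cell]
  rw [one_add_kap_mul x hm, kap_mul_apply x hm]
  simp [e₁, lift]
  field_simp

theorem sum_col_sq {d : ℕ} (k : K d) : ∑ i, k.1 i 0 ^ 2 = 1 := by
  have := congrFun (congrFun (orthogonal_mul' k) 0) 0
  simpa [Matrix.mul_apply, sq] using this

/-- `cell k` is the stereographic projection of `k e₁` from `-e₁`, and `x ↦ kap x e₁` is its
inverse. The excluded point `k e₁ = -e₁` is the one with `k.1 0 0 = -1`. -/
theorem kap_cell_mulVec {d : ℕ} (k : K d) (hk : k.1 0 0 ≠ -1) :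
    (kap (cell k)).1 *ᵥ e₁ d = k.1 *ᵥ e₁ d := by
  have h0 : 1 + k.1 0 0 ≠ 0 := fun h => hk (by linarith)
  have hs := sum_col_sq k
  rw [Fin.sum_univ_succ] at hs
  have hn : ‖cell k‖ ^ 2 = (1 + k.1 0 0)⁻¹ ^ 2 * (1 - k.1 0 0 ^ 2) := by
    rw [EuclideanSpace.real_norm_sq_eq, ← eq_sub_iff_add_eq'.2 hs]
    simp [cell, mul_pow, Finset.mul_sum]
  have h1 : 1 + ‖cell k‖ ^ 2 = 2 * (1 + k.1 0 0)⁻¹ := by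
    rw [hn]
    field_simp
    ring
  have h2 : 1 - ‖cell k‖ ^ 2 = 2 * k.1 0 0 * (1 + k.1 0 0)⁻¹ := by
    rw [hn]
    field_simp
    ring
  rw [kap_mulVec, h1, h2]
  ext i
  rw [mulVec_e₁]
  refine Fin.cases ?_ (fun i => ?_) i
  · simp [e₁, lift]
    field_simp
  · simp [e₁, lift, cell]
    field_simp

theorem kap_cell_inv_mul_mem {d : ℕ} (k : K d) (hk : k.1 0 0 ≠ -1) :
    (kap (cell k))⁻¹ * k ∈ M d := by
  change ((kap (cell k))⁻¹ * k).1 *ᵥ e₁ d = e₁ d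
  rw [Submonoid.coe_mul, ← Matrix.mulVec_mulVec, ← kap_cell_mulVec k hk, Matrix.mulVec_mulVec,
    ← Submonoid.coe_mul, inv_mul_cancel]
  simp

theorem continuous_kap {d : ℕ} : Continuous (kap (d := d)) := by
  refine continuous_induced_rng.2 ?_
  have : (Subtype.val ∘ kap : EuclideanSpace ℝ (Fin d) → _) =
      fun x => 1 + (2 / (1 + ‖x‖ ^ 2)) • (rotMat x + rotMat x * rotMat x) := by
    ext1 x
    exact coe_kap x
  rw [this]
  have h1 : Continuous fun x : EuclideanSpace ℝ (Fin d) => rotMat x := by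
    have := LinearMap.continuous_of_finiteDimensional (rot (d := d))
    exact continuous_subtype_val.comp this
  have h2 : Continuous fun x : EuclideanSpace ℝ (Fin d) => 2 / (1 + ‖x‖ ^ 2) :=
    continuous_const.div (by fun_prop) fun x => by positivity
  fun_prop

/-! ### Haar probability measures -/

instance (d : ℕ) : SecondCountableTopology (K d) := by
  have : SecondCountableTopology (Matrix (Fin (d + 1)) (Fin (d + 1)) ℝ) :=
    inferInstanceAs (SecondCountableTopology (Fin (d + 1) → Fin (d + 1) → ℝ))
  exact TopologicalSpace.Subtype.secondCountableTopology _

section haarProb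

variable (H : Type) [Group H] [TopologicalSpace H] [IsTopologicalGroup H] [CompactSpace H]
    [MeasurableSpace H] [BorelSpace H]

instance : IsProbabilityMeasure (haarProb H) := ⟨Measure.haarMeasure_self⟩

instance : (haarProb H).IsHaarMeasure :=
  inferInstanceAs (Measure.haarMeasure (⊤ : TopologicalSpace.PositiveCompacts H)).IsHaarMeasure

-- Uniqueness of Haar measure. It yields invariance under right translation and inversion, and later
-- identifies the measure built on the big cell.
variable {H} in
theorem haarProb_eq (μ : Measure H) [IsProbabilityMeasure μ] [μ.IsMulLeftInvariant] :
    μ = haarProb H := by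
  have : μ.IsHaarMeasure := by
    refine Measure.isHaarMeasure_of_isCompact_nonempty_interior μ univ isCompact_univ ?_ ?_ ?_
    · simp
    · simp
    · simp
  exact Measure.isHaarMeasure_eq_of_isProbabilityMeasure _ _

instance : (haarProb H).IsMulRightInvariant := by
  refine ⟨fun g => ?_⟩
  have : IsProbabilityMeasure ((haarProb H).map (· * g)) :=
    Measure.isProbabilityMeasure_map (by fun_prop)
  exact haarProb_eq _

instance : (haarProb H).IsInvInvariant := by
  refine ⟨?_⟩
  have : IsProbabilityMeasure (haarProb H).inv :=
    Measure.isProbabilityMeasure_map (by fun_prop)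
  exact haarProb_eq _

end haarProb

/-! ### Integration over `ℝ^(d+1)` in horospherical coordinates -/

theorem lintegral_fin_succ {d : ℕ} {f : (Fin (d + 1) → ℝ) → ℝ≥0∞} (hf : Measurable f) :
    ∫⁻ y, f y = ∫⁻ z : EuclideanSpace ℝ (Fin d), ∫⁻ t : ℝ, f (Fin.cons t z) := by
  have h1 := (volume_preserving_piFinSuccAbove (fun _ : Fin (d + 1) => ℝ) 0).symm
  have h2 := EuclideanSpace.volume_preserving_symm_measurableEquiv_toLp (Fin d)
  rw [← h1.lintegral_comp hf, Measure.volume_eq_prod, lintegral_prod_symm'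
    (fun p => f ((MeasurableEquiv.piFinSuccAbove (fun _ => ℝ) 0).symm p))
    (hf.comp (MeasurableEquiv.measurable _)), ← h2.lintegral_comp]
  · refine lintegral_congr fun z => lintegral_congr fun t => ?_
    congr 1
    exact Fin.insertNth_zero' (β := ℝ) t z.ofLp
  · exact (hf.comp (MeasurableEquiv.measurable _)).lintegral_prod_left'

theorem lintegral_comp_smul_inv {d : ℕ} {f : EuclideanSpace ℝ (Fin d) → ℝ≥0∞} (hf : Measurable f)
    {r : ℝ} (hr : 0 < r) :
    ∫⁻ z, f (r⁻¹ • z) = ENNReal.ofReal (r ^ d) * ∫⁻ x, f x := by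
  have h := Measure.map_addHaar_smul (volume : Measure (EuclideanSpace ℝ (Fin d)))
    (inv_ne_zero hr.ne')
  rw [← lintegral_map hf (by fun_prop), h, lintegral_smul_measure, finrank_euclideanSpace_fin,
    inv_pow, inv_inv, abs_of_pos (by positivity)]
  rfl

/-- For `b = ‖z‖²` the inverse substitution is `r = t + ‖y‖` with `y = (t, z)`; in these terms `z /
r` is the stereographic coordinate of `y` and `‖y‖ = (r + b/r) / 2`. -/
theorem lintegral_half_sub_div {b : ℝ} (hb : 0 < b) (f : ℝ → ℝ≥0∞) :
    ∫⁻ t, f t = ∫⁻ r in Ioi (0 : ℝ), ENNReal.ofReal ((1 + b / r ^ 2) / 2) *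
      f ((r - b / r) / 2) := by
  have himg : (fun r : ℝ => (r - b / r) / 2) '' Ioi 0 = univ := by
    -- The positive root of `r² - 2tr - b = 0`.
    refine eq_univ_of_forall fun t => ⟨t + √(t ^ 2 + b), ?_, ?_⟩
    · have : |t| < √(t ^ 2 + b) := by
        rw [← Real.sqrt_sq_eq_abs]
        exact Real.sqrt_lt_sqrt (sq_nonneg t) (by linarith)
      have := neg_abs_le t
      simp only [mem_Ioi]
      linarith
    · have h1 : |t| < √(t ^ 2 + b) := by
        rw [← Real.sqrt_sq_eq_abs]
        exact Real.sqrt_lt_sqrt (sq_nonneg t) (by linarith)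
      have h2 := neg_abs_le t
      have h3 : t + √(t ^ 2 + b) ≠ 0 := by
        have : 0 < t + √(t ^ 2 + b) := by linarith
        exact this.ne'
      have h4 : √(t ^ 2 + b) ^ 2 = t ^ 2 + b := Real.sq_sqrt (by positivity)
      simp only
      field_simp
      linear_combination h4
  have hder : ∀ r ∈ Ioi (0 : ℝ), HasDerivWithinAt (fun r : ℝ => (r - b / r) / 2)
      ((1 + b / r ^ 2) / 2) (Ioi 0) r := by
    intro r hr
    have hr' : r ≠ 0 := (mem_Ioi.1 hr).ne'
    have h1 := ((hasDerivAt_id r).sub ((hasDerivAt_inv hr').const_mul b)).div_const 2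
    refine HasDerivAt.hasDerivWithinAt ?_
    refine (h1.congr_deriv ?_)
    field_simp
    ring
  have hinj : InjOn (fun r : ℝ => (r - b / r) / 2) (Ioi 0) := by
    intro r hr s hs h
    have hr' : 0 < r := hr
    have hs' : 0 < s := hs
    simp only at h
    field_simp at h
    have : (r - s) * (r * s + b) = 0 := by linear_combination h
    rcases mul_eq_zero.1 this with h | h
    · linarith
    · have : 0 < r * s + b := by positivity
      linarith
  have := lintegral_image_eq_lintegral_abs_deriv_mul measurableSet_Ioi hder hinj f
  rw [himg, Measure.restrict_univ] at this
  rw [this]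
  refine setLIntegral_congr_fun measurableSet_Ioi fun r hr => ?_
  rw [abs_of_pos (by have := mem_Ioi.1 hr; positivity)]

theorem lintegral_pow_mul_exp (d : ℕ) {q : ℝ} (hq : 0 < q) :
    ∫⁻ r in Ioi (0 : ℝ), ENNReal.ofReal (r ^ d) * ENNReal.ofReal (Real.exp (-(q * r))) =
      ENNReal.ofReal ((1 / q) ^ (d + 1) * Real.Gamma (d + 1)) := by
  have h := Real.integral_rpow_mul_exp_neg_mul_Ioi (a := (d : ℝ) + 1) (by positivity) hq
  have hi := integrableOn_rpow_mul_exp_neg_mul_rpow (p := 1) (s := d)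
    (by have : (0 : ℝ) ≤ d := by positivity
        linarith) one_pos hq
  simp only [add_sub_cancel_right, Real.rpow_natCast] at h
  simp only [Real.rpow_natCast, Real.rpow_one, neg_mul] at hi
  have h' : (1 / q) ^ ((d : ℝ) + 1) = (1 / q) ^ (d + 1) := by
    exact_mod_cast Real.rpow_natCast (1 / q) (d + 1)
  rw [← h', ← h, ofReal_integral_eq_lintegral_ofReal hi]
  · refine setLIntegral_congr_fun measurableSet_Ioi fun r hr => ?_
    exact (ENNReal.ofReal_mul (by have := mem_Ioi.1 hr; positivity)).symm
  · filter_upwards [ae_restrict_mem measurableSet_Ioi] with r hr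
    have := mem_Ioi.1 hr
    simp only [Pi.zero_apply]
    positivity

/-- The Euclidean norm on `Fin (d + 1) → ℝ`. -/
def euclNorm {d : ℕ} (y : Fin (d + 1) → ℝ) : ℝ := √(y ⬝ᵥ y)

/-- The stereographic coordinate of the direction of `y`. -/
def stereo {d : ℕ} (y : Fin (d + 1) → ℝ) : EuclideanSpace ℝ (Fin d) :=
  WithLp.toLp 2 fun i => (y 0 + euclNorm y)⁻¹ * y i.succ

/-- The weight `(1 + ‖x‖²)^{-d}`. -/
def weight {d : ℕ} (x : EuclideanSpace ℝ (Fin d)) : ℝ := ((1 + ‖x‖ ^ 2) ^ d)⁻¹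

theorem weight_pos {d : ℕ} (x : EuclideanSpace ℝ (Fin d)) : 0 < weight x := by
  unfold weight
  positivity

theorem continuous_weight {d : ℕ} : Continuous (weight (d := d)) :=
  Continuous.inv₀ (by fun_prop) fun x => by positivity

theorem continuous_euclNorm {d : ℕ} : Continuous (euclNorm (d := d)) := by
  unfold euclNorm
  fun_prop

theorem measurable_stereo {d : ℕ} : Measurable (stereo (d := d)) := by
  refine (MeasurableEquiv.toLp 2 (Fin d → ℝ)).measurable.comp (measurable_pi_lambda _ fun i => ?_)
  have := (continuous_euclNorm (d := d)).measurable
  fun_prop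

/-- Integrating a function of the direction against the rotation invariant density `e^{-‖y‖}` shows
the invariant measure of the sphere in stereographic coordinates. With `q = (1+‖x‖²)/2`, the
Jacobians are `q` (from `t` to `r`) and `r^d` (from `z` to `x = z/r`), and `q ∫ r^d e^{-qr} dr =
q^{-d} Γ(d+1)`. -/
theorem lintegral_exp_neg_mul_stereo {d : ℕ} (hd : 1 ≤ d)
    {F : EuclideanSpace ℝ (Fin d) → ℝ≥0∞} (hF : Measurable F) :
    ∫⁻ y : Fin (d + 1) → ℝ, ENNReal.ofReal (Real.exp (-euclNorm y)) * F (stereo y) =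
      ENNReal.ofReal (2 ^ d * Real.Gamma (d + 1)) *
        ∫⁻ x, ENNReal.ofReal (weight x) * F x := by
  have : Nonempty (Fin d) := ⟨⟨0, hd⟩⟩
  have hmeas : Measurable fun y : Fin (d + 1) → ℝ =>
      ENNReal.ofReal (Real.exp (-euclNorm y)) * F (stereo y) := by
    have := (continuous_euclNorm (d := d)).measurable
    exact Measurable.mul (by fun_prop) (hF.comp measurable_stereo)
  rw [lintegral_fin_succ hmeas]
  have h1 : ∀ᵐ z : EuclideanSpace ℝ (Fin d), ∫⁻ t : ℝ,
      ENNReal.ofReal (Real.exp (-euclNorm (Fin.cons t z.ofLp))) * F (stereo (Fin.cons t z.ofLp)) =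
      ∫⁻ r in Ioi (0 : ℝ), ENNReal.ofReal ((1 + ‖r⁻¹ • z‖ ^ 2) / 2) *
        (ENNReal.ofReal (Real.exp (-(r * (1 + ‖r⁻¹ • z‖ ^ 2) / 2))) * F (r⁻¹ • z)) := by
    -- The change of variables in `t` needs `‖z‖² > 0`; the origin is a null set because `d ≥ 1`.
    have h0 : ∀ᵐ z : EuclideanSpace ℝ (Fin d), z ≠ 0 := by
      simp [ae_iff]
    filter_upwards [h0] with z hz
    have hz' : 0 < ‖z‖ ^ 2 := by positivity
    rw [lintegral_half_sub_div hz']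
    refine setLIntegral_congr_fun measurableSet_Ioi fun r hr => ?_
    have hr : 0 < r := hr
    have hn : ‖r⁻¹ • z‖ ^ 2 = ‖z‖ ^ 2 / r ^ 2 := by
      rw [norm_smul, mul_pow, norm_inv, Real.norm_of_nonneg hr.le]
      field_simp
    have hsum : (Fin.cons ((r - ‖z‖ ^ 2 / r) / 2) z.ofLp : Fin (d + 1) → ℝ) ⬝ᵥ
        Fin.cons ((r - ‖z‖ ^ 2 / r) / 2) z.ofLp = (r * (1 + ‖z‖ ^ 2 / r ^ 2) / 2) ^ 2 := by
      have : ∑ i, z.ofLp i * z.ofLp i = ‖z‖ ^ 2 := by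
        rw [EuclideanSpace.real_norm_sq_eq]
        simp [sq]
      simp only [dotProduct, Fin.sum_univ_succ, Fin.cons_zero, Fin.cons_succ, this]
      field_simp
      ring
    have he : euclNorm (Fin.cons ((r - ‖z‖ ^ 2 / r) / 2) z.ofLp) =
        r * (1 + ‖z‖ ^ 2 / r ^ 2) / 2 := by
      rw [euclNorm, hsum, Real.sqrt_sq (by positivity)]
    have hs : stereo (Fin.cons ((r - ‖z‖ ^ 2 / r) / 2) z.ofLp) = r⁻¹ • z := by
      ext i
      simp only [stereo, he, Fin.cons_zero, Fin.cons_succ, PiLp.smul_apply, smul_eq_mul]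
      congr 2
      field_simp
      ring
    simp only [he, hs, hn]
  rw [lintegral_congr_ae h1]
  have hm2 : Measurable (Function.uncurry fun (z : EuclideanSpace ℝ (Fin d)) (r : ℝ) =>
      ENNReal.ofReal ((1 + ‖r⁻¹ • z‖ ^ 2) / 2) *
        (ENNReal.ofReal (Real.exp (-(r * (1 + ‖r⁻¹ • z‖ ^ 2) / 2))) * F (r⁻¹ • z))) := by
    have h : Measurable fun p : EuclideanSpace ℝ (Fin d) × ℝ => p.2⁻¹ • p.1 := by fun_prop
    have := hF.comp h
    unfold Function.uncurry
    simp only [Function.comp_def] at this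
    fun_prop
  rw [lintegral_lintegral_swap hm2.aemeasurable]
  have h2 : ∀ r ∈ Ioi (0 : ℝ), ∫⁻ z : EuclideanSpace ℝ (Fin d),
      ENNReal.ofReal ((1 + ‖r⁻¹ • z‖ ^ 2) / 2) *
        (ENNReal.ofReal (Real.exp (-(r * (1 + ‖r⁻¹ • z‖ ^ 2) / 2))) * F (r⁻¹ • z)) =
      ∫⁻ x : EuclideanSpace ℝ (Fin d), ENNReal.ofReal ((1 + ‖x‖ ^ 2) / 2) * F x *
        (ENNReal.ofReal (r ^ d) * ENNReal.ofReal (Real.exp (-((1 + ‖x‖ ^ 2) / 2 * r)))) := by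
    intro r hr
    rw [lintegral_comp_smul_inv (f := fun z => ENNReal.ofReal ((1 + ‖z‖ ^ 2) / 2) *
        (ENNReal.ofReal (Real.exp (-(r * (1 + ‖z‖ ^ 2) / 2))) * F z)) (by fun_prop) hr,
      ← lintegral_const_mul _ (by fun_prop)]
    refine lintegral_congr fun x => ?_
    rw [show (1 + ‖x‖ ^ 2) / 2 * r = r * (1 + ‖x‖ ^ 2) / 2 by ring]
    ring
  rw [setLIntegral_congr_fun measurableSet_Ioi h2, lintegral_lintegral_swap (by fun_prop),
    ← lintegral_const_mul _ (by have := (continuous_weight (d := d)).measurable; fun_prop)]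
  refine lintegral_congr fun x => ?_
  have hx : 0 < (1 + ‖x‖ ^ 2) / 2 := by positivity
  rw [lintegral_const_mul _ (by fun_prop), lintegral_pow_mul_exp d hx, mul_right_comm, ← mul_assoc,
    ← ENNReal.ofReal_mul hx.le, ← ENNReal.ofReal_mul (by positivity)]
  congr 2
  unfold weight
  rw [one_div, inv_div, div_pow]
  field_simp
  ring

/-! ### Haar measure of `K` on the big cell -/

theorem euclNorm_sq {d : ℕ} (y : Fin (d + 1) → ℝ) : euclNorm y ^ 2 = y ⬝ᵥ y :=
  Real.sq_sqrt (by
    have := dotProduct_star_self_nonneg y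
    simpa using this)

theorem abs_le_euclNorm {d : ℕ} (y : Fin (d + 1) → ℝ) : |y 0| ≤ euclNorm y := by
  refine abs_le_of_sq_le_sq (b := euclNorm y) ?_ (Real.sqrt_nonneg _)
  rw [euclNorm_sq, dotProduct, Fin.sum_univ_succ, sq]
  have : 0 ≤ ∑ i : Fin d, y i.succ * y i.succ := Finset.sum_nonneg fun i _ => mul_self_nonneg _
  linarith

theorem kap_stereo_mulVec {d : ℕ} {y : Fin (d + 1) → ℝ} (hy : y 0 + euclNorm y ≠ 0) :
    (kap (stereo y)).1 *ᵥ e₁ d = (euclNorm y)⁻¹ • y := by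
  have hs := euclNorm_sq y
  have habs := abs_le_euclNorm y
  have hρ : euclNorm y ≠ 0 := by
    intro h
    rw [h] at habs hy
    exact hy (by rw [abs_nonpos_iff.1 habs, add_zero])
  rw [dotProduct, Fin.sum_univ_succ] at hs
  have hn : ‖stereo y‖ ^ 2 = (y 0 + euclNorm y)⁻¹ ^ 2 * (euclNorm y ^ 2 - y 0 ^ 2) := by
    rw [EuclideanSpace.real_norm_sq_eq, hs, sq (y 0), add_sub_cancel_left]
    simp [stereo, mul_pow, Finset.mul_sum, ← sq]
  have h1 : 1 + ‖stereo y‖ ^ 2 = 2 * euclNorm y * (y 0 + euclNorm y)⁻¹ := by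
    rw [hn]
    field_simp
    ring
  have h2 : 1 - ‖stereo y‖ ^ 2 = 2 * y 0 * (y 0 + euclNorm y)⁻¹ := by
    rw [hn]
    field_simp
    ring
  rw [kap_mulVec, h1, h2]
  ext i
  refine Fin.cases ?_ (fun i => ?_) i
  · simp [e₁, lift]
    field_simp
  · simp [e₁, lift, stereo]
    field_simp

theorem ae_add_euclNorm_ne_zero {d : ℕ} (hd : 1 ≤ d) :
    ∀ᵐ y : Fin (d + 1) → ℝ, y 0 + euclNorm y ≠ 0 := by
  let i : Fin (d + 1) := Fin.succ ⟨0, hd⟩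
  let S : Submodule ℝ (Fin (d + 1) → ℝ) := LinearMap.ker (LinearMap.proj i)
  have hS : S ≠ ⊤ := by
    intro h
    have h1 : (Pi.single i 1 : Fin (d + 1) → ℝ) ∈ S := h ▸ Submodule.mem_top
    simp [S] at h1
  have h0 := Measure.addHaar_submodule volume S hS
  rw [ae_iff]
  refine measure_mono_null (fun y hy => ?_) h0
  have hy : y 0 + euclNorm y = 0 := by simpa using hy
  have h1 : euclNorm y ^ 2 = y 0 ^ 2 := by
    rw [eq_neg_of_add_eq_zero_right hy, neg_sq]
  rw [euclNorm_sq, dotProduct, Fin.sum_univ_succ] at h1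
  have h2 : ∑ i : Fin d, y i.succ * y i.succ = 0 := by linarith
  have h3 := (Finset.sum_eq_zero_iff_of_nonneg fun i _ => mul_self_nonneg _).1 h2 ⟨0, hd⟩
    (Finset.mem_univ _)
  simpa [S, i] using h3

theorem measurePreserving_mulVec {d : ℕ} (k : K d) :
    MeasurePreserving (fun y : Fin (d + 1) → ℝ => k.1 *ᵥ y) := by
  have hdet := (Matrix.mem_specialOrthogonalGroup_iff.1 k.2).2
  have h := Real.map_matrix_volume_pi_eq_smul_volume_pi (M := k.1) (by rw [hdet]; exact one_ne_zero)
  rw [hdet] at h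
  refine ⟨(Continuous.matrix_mulVec continuous_const continuous_id).measurable, ?_⟩
  have h' : (fun y : Fin (d + 1) → ℝ => k.1 *ᵥ y) = Matrix.toLin' k.1 := by
    ext1 y
    rfl
  rw [h']
  simpa using h

theorem euclNorm_mulVec {d : ℕ} (k : K d) (y : Fin (d + 1) → ℝ) :
    euclNorm (k.1 *ᵥ y) = euclNorm y := by
  rw [euclNorm, Matrix.dotProduct_mulVec, ← Matrix.vecMul_transpose, Matrix.vecMul_vecMul,
    orthogonal_mul', Matrix.vecMul_one, euclNorm]

/-- The integral over `K` in the coordinates of the big cell, up to a constant. -/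
def cellLIntegral {d : ℕ} (f : K d → ℝ≥0∞) : ℝ≥0∞ :=
  ∫⁻ x : EuclideanSpace ℝ (Fin d), ENNReal.ofReal (weight x) *
    ∫⁻ m : M d, f (kap x * m) ∂haarProb (M d)

theorem measurable_lintegral_M {d : ℕ} {f : K d → ℝ≥0∞} (hf : Measurable f) :
    Measurable fun x : EuclideanSpace ℝ (Fin d) => ∫⁻ m : M d, f (kap x * m) ∂haarProb (M d) := by
  refine Measurable.lintegral_prod_right' (f := fun p : EuclideanSpace ℝ (Fin d) × M d =>
    f (kap p.1 * p.2)) ?_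
  refine hf.comp (Continuous.measurable ?_)
  have := continuous_kap (d := d)
  fun_prop

/-- Up to a positive constant, `cellLIntegral` is an integral over `ℝ^(d+1)` against `e^{-‖y‖}`, and
the linear map `k` preserves both Lebesgue measure and the norm. -/
theorem cellLIntegral_mul_left {d : ℕ} (hd : 1 ≤ d) (k : K d) {f : K d → ℝ≥0∞}
    (hf : Measurable f) : cellLIntegral (fun l => f (k * l)) = cellLIntegral f := by
  have hC : ENNReal.ofReal (2 ^ d * Real.Gamma (d + 1)) ≠ 0 := by
    have := Real.Gamma_pos_of_pos (s := d + 1) (by positivity)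
    rw [Ne, ENNReal.ofReal_eq_zero, not_le]
    positivity
  refine (ENNReal.mul_right_inj hC ENNReal.ofReal_ne_top).1 ?_
  have hf' : Measurable fun l => f (k * l) := hf.comp (measurable_const_mul k)
  rw [cellLIntegral, cellLIntegral, ← lintegral_exp_neg_mul_stereo hd (measurable_lintegral_M hf'),
    ← lintegral_exp_neg_mul_stereo hd (measurable_lintegral_M hf),
    ← (measurePreserving_mulVec k).lintegral_comp (f := fun y =>
      ENNReal.ofReal (Real.exp (-euclNorm y)) *
        ∫⁻ m : M d, f (kap (stereo y) * m) ∂haarProb (M d))]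
  · have h1 := ae_add_euclNorm_ne_zero hd
    have h2 := (measurePreserving_mulVec k).quasiMeasurePreserving.ae h1
    refine lintegral_congr_ae ?_
    filter_upwards [h1, h2] with y hy hky
    rw [euclNorm_mulVec]
    congr 1
    -- Both `k * kap (stereo y)` and `kap (stereo (k y))` send `e₁` to `k y / ‖y‖`, so they differ
    -- by an element of `M`, which the integral over `M` absorbs.
    have hm : (kap (stereo (k.1 *ᵥ y)))⁻¹ * (k * kap (stereo y)) ∈ M d := by
      change ((kap (stereo (k.1 *ᵥ y)))⁻¹ * (k * kap (stereo y))).1 *ᵥ e₁ d = e₁ d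
      rw [Submonoid.coe_mul, ← Matrix.mulVec_mulVec, Submonoid.coe_mul, ← Matrix.mulVec_mulVec,
        kap_stereo_mulVec hy, Matrix.mulVec_smul, ← euclNorm_mulVec k, ← kap_stereo_mulVec hky,
        Matrix.mulVec_mulVec, ← Submonoid.coe_mul, inv_mul_cancel]
      simp
    rw [← lintegral_mul_left_eq_self (μ := haarProb (M d))
      (fun m : M d => f (kap (stereo (k.1 *ᵥ y)) * m)) (⟨_, hm⟩ : M d)]
    refine lintegral_congr fun m => ?_
    simp [mul_assoc]
  · exact Measurable.mul (by have := (continuous_euclNorm (d := d)).measurable; fun_prop)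
      ((measurable_lintegral_M hf).comp measurable_stereo)

theorem integrable_one_add_norm_sq {d : ℕ} {s : ℝ} (hs : (d : ℝ) / 2 < s) :
    Integrable fun x : EuclideanSpace ℝ (Fin d) => (1 + ‖x‖ ^ 2) ^ (-s) := by
  have := integrable_rpow_neg_one_add_norm_sq (E := EuclideanSpace ℝ (Fin d)) (μ := volume)
    (r := 2 * s) (by rw [finrank_euclideanSpace_fin]; linarith)
  convert this using 2
  ring_nf

theorem weight_eq_rpow {d : ℕ} (x : EuclideanSpace ℝ (Fin d)) :
    weight x = (1 + ‖x‖ ^ 2) ^ (-(d : ℝ)) := by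
  rw [weight, Real.rpow_neg (by positivity), Real.rpow_natCast]

theorem integrable_weight {d : ℕ} (hd : 1 ≤ d) : Integrable (weight (d := d)) := by
  have : (1 : ℝ) ≤ d := by exact_mod_cast hd
  refine (integrable_one_add_norm_sq (s := d) (by linarith)).congr ?_
  exact Filter.Eventually.of_forall fun x => (weight_eq_rpow x).symm

/-- The normalizing factor of the Haar measure on the big cell. -/
def cellConst (d : ℕ) : ℝ := (∫ x : EuclideanSpace ℝ (Fin d), weight x)⁻¹

theorem integral_weight_pos {d : ℕ} (hd : 1 ≤ d) :
    0 < ∫ x : EuclideanSpace ℝ (Fin d), weight x := by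
  rw [integral_pos_iff_support_of_nonneg (fun x => (weight_pos x).le) (integrable_weight hd)]
  have : Function.support (weight (d := d)) = univ := by
    ext x
    simp [(weight_pos x).ne']
  rw [this]
  exact isOpen_univ.measure_pos volume univ_nonempty

theorem cellConst_pos {d : ℕ} (hd : 1 ≤ d) : 0 < cellConst d := inv_pos.2 (integral_weight_pos hd)

theorem lintegral_haarProb {d : ℕ} (hd : 1 ≤ d) {f : K d → ℝ≥0∞} (hf : Measurable f) :
    ∫⁻ k, f k ∂haarProb (K d) = ENNReal.ofReal (cellConst d) * cellLIntegral f := by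
  let Φ : EuclideanSpace ℝ (Fin d) × M d → K d := fun p => kap p.1 * p.2
  have hΦ : Measurable Φ := by
    refine Continuous.measurable ?_
    have := continuous_kap (d := d)
    fun_prop
  have hw : Measurable fun x : EuclideanSpace ℝ (Fin d) => ENNReal.ofReal (weight x) :=
    (continuous_weight (d := d)).measurable.ennreal_ofReal
  let ν : Measure (K d) := ENNReal.ofReal (cellConst d) • Measure.map Φ
    ((volume.withDensity fun x : EuclideanSpace ℝ (Fin d) => ENNReal.ofReal (weight x)).prod
      (haarProb (M d)))
  have hν : ∀ g : K d → ℝ≥0∞, Measurable g →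
      ∫⁻ k, g k ∂ν = ENNReal.ofReal (cellConst d) * cellLIntegral g := by
    intro g hg
    rw [lintegral_smul_measure, lintegral_map hg hΦ, lintegral_prod (fun p => g (Φ p)) (hg.comp hΦ).aemeasurable,
      lintegral_withDensity_eq_lintegral_mul _ hw (measurable_lintegral_M hg)]
    rfl
  have hprob : IsProbabilityMeasure ν := by
    refine ⟨?_⟩
    rw [← lintegral_one, hν _ measurable_const]
    have : cellLIntegral (fun _ : K d => 1) =
        ENNReal.ofReal (∫ x : EuclideanSpace ℝ (Fin d), weight x) := by
      rw [ofReal_integral_eq_lintegral_ofReal (integrable_weight hd)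
        (Filter.Eventually.of_forall fun x => (weight_pos x).le)]
      simp [cellLIntegral]
    rw [this, ← ENNReal.ofReal_mul (cellConst_pos hd).le, cellConst,
      inv_mul_cancel₀ (integral_weight_pos hd).ne', ENNReal.ofReal_one]
  have hinv : ν.IsMulLeftInvariant := by
    refine ⟨fun k => ?_⟩
    refine Measure.ext_of_lintegral _ fun g hg => ?_
    rw [lintegral_map hg (measurable_const_mul k), hν (fun l => g (k * l)) (hg.comp (measurable_const_mul k)),
      hν _ hg]
    congr 1
    exact cellLIntegral_mul_left hd k hg
  rw [← haarProb_eq ν, hν _ hf]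

/-- The map from the big cell coordinates to `K`. -/
def cellMap {d : ℕ} (p : EuclideanSpace ℝ (Fin d) × M d) : K d := kap p.1 * p.2

theorem continuous_cellMap {d : ℕ} : Continuous (cellMap (d := d)) := by
  have := continuous_kap (d := d)
  unfold cellMap
  fun_prop

theorem haarProb_eq_map {d : ℕ} (hd : 1 ≤ d) :
    haarProb (K d) = ENNReal.ofReal (cellConst d) • Measure.map cellMap
      ((volume.withDensity fun x : EuclideanSpace ℝ (Fin d) => ENNReal.ofReal (weight x)).prod
        (haarProb (M d))) := by
  have hw : Measurable fun x : EuclideanSpace ℝ (Fin d) => ENNReal.ofReal (weight x) :=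
    (continuous_weight (d := d)).measurable.ennreal_ofReal
  have hΦ := (continuous_cellMap (d := d)).measurable
  refine Measure.ext_of_lintegral _ fun g hg => ?_
  have hg' : Measurable fun x : EuclideanSpace ℝ (Fin d) =>
      ∫⁻ m : M d, g (cellMap (x, m)) ∂haarProb (M d) := measurable_lintegral_M hg
  rw [lintegral_haarProb hd hg, lintegral_smul_measure, lintegral_map hg hΦ,
    lintegral_prod (fun p => g (cellMap p)) (hg.comp hΦ).aemeasurable,
    lintegral_withDensity_eq_lintegral_mul _ hw hg']
  rfl

/-- Since the weight is everywhere positive, Haar null sets of `K` are the null sets of `dx dm` in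
cell coordinates. -/
theorem ae_haarProb_iff {d : ℕ} (hd : 1 ≤ d) {p : K d → Prop} (hp : MeasurableSet {k | p k}) :
    (∀ᵐ k ∂haarProb (K d), p k) ↔
      ∀ᵐ z ∂(volume : Measure (EuclideanSpace ℝ (Fin d))).prod (haarProb (M d)), p (cellMap z) := by
  have hc : ENNReal.ofReal (cellConst d) ≠ 0 := by
    rw [Ne, ENNReal.ofReal_eq_zero, not_le]
    exact cellConst_pos hd
  have hw : Measurable fun x : EuclideanSpace ℝ (Fin d) => ENNReal.ofReal (weight x) :=
    (continuous_weight (d := d)).measurable.ennreal_ofReal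
  have h1 : (volume.withDensity fun x : EuclideanSpace ℝ (Fin d) =>
      ENNReal.ofReal (weight x)) ≪ volume := withDensity_absolutelyContinuous _ _
  have h2 : volume ≪ volume.withDensity fun x : EuclideanSpace ℝ (Fin d) =>
      ENNReal.ofReal (weight x) := by
    refine withDensity_absolutelyContinuous' hw.aemeasurable
      (Filter.Eventually.of_forall fun x => ?_)
    rw [Ne, ENNReal.ofReal_eq_zero, not_le]
    exact weight_pos x
  rw [haarProb_eq_map hd, Measure.ae_ennreal_smul_measure_iff hc,
    ae_map_iff continuous_cellMap.measurable.aemeasurable hp]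
  exact ⟨fun h => (h2.prod Measure.AbsolutelyContinuous.rfl).ae_le h,
    fun h => (h1.prod Measure.AbsolutelyContinuous.rfl).ae_le h⟩

theorem integral_haarProb {d : ℕ} (hd : 1 ≤ d) {E : Type*} [NormedAddCommGroup E]
    [NormedSpace ℝ E] {f : K d → E} (hf : Integrable f (haarProb (K d))) :
    ∫ k, f k ∂haarProb (K d) = cellConst d • ∫ x : EuclideanSpace ℝ (Fin d), weight x •
      ∫ m : M d, f (kap x * m) ∂haarProb (M d) := by
  have hc : ENNReal.ofReal (cellConst d) ≠ 0 := by
    rw [Ne, ENNReal.ofReal_eq_zero, not_le]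
    exact cellConst_pos hd
  have hΦ := (continuous_cellMap (d := d)).measurable
  have hw : Measurable fun x : EuclideanSpace ℝ (Fin d) => Real.toNNReal (weight x) :=
    (continuous_weight (d := d)).measurable.real_toNNReal
  rw [haarProb_eq_map hd, integrable_smul_measure hc ENNReal.ofReal_ne_top] at hf
  rw [haarProb_eq_map hd, integral_smul_measure, integral_map hΦ.aemeasurable hf.1,
    ENNReal.toReal_ofReal (cellConst_pos hd).le, integral_prod (fun p => f (cellMap p)) (hf.comp_measurable hΦ)]
  congr 1
  refine (integral_withDensity_eq_integral_smul hw _).trans ?_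
  refine integral_congr_ae (Filter.Eventually.of_forall fun x => ?_)
  simp only [cellMap, NNReal.smul_def, Real.coe_toNNReal _ (weight_pos x).le]

/-! ### The left regular representation of `K` -/

/-- The left translation by `k` as a linear isometry of `L²(K)`. -/
def lam {d : ℕ} (k : K d) : L2K d →ₗᵢ[ℂ] L2K d :=
  Lp.compMeasurePreservingₗᵢ ℂ (fun x => k⁻¹ * x) (measurePreserving_mul_left _ _)

theorem coeFn_lam {d : ℕ} (k : K d) (v : L2K d) :
    lam k v =ᵐ[haarProb (K d)] fun x => v (k⁻¹ * x) :=
  Lp.coeFn_compMeasurePreserving v (measurePreserving_mul_left (haarProb (K d)) k⁻¹)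

theorem onL2_eq {d : ℕ} {F : (K d → ℂ) → K d → ℂ} {v w : L2K d}
    (h : w =ᵐ[haarProb (K d)] F v) : onL2 F v = w := by
  have hm : MemLp (F v) 2 (haarProb (K d)) := (Lp.memLp w).ae_eq h
  rw [onL2, dif_pos hm]
  exact Lp.ext (hm.coeFn_toLp.trans h.symm)

theorem leftReg_eq {d : ℕ} (k : K d) (v : L2K d) : leftReg k v = lam k v :=
  onL2_eq (coeFn_lam k v)

theorem U_embK {d : ℕ} (s : ℝ) (k : K d) (v : L2K d) : U s (embK k) v = lam k v := by
  refine onL2_eq ((coeFn_lam k v).trans (Filter.Eventually.of_forall fun x => ?_))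
  simp only [embK_inv, ← embK_mul, kappa_embK, height_embK]
  simp

theorem lam_mul {d : ℕ} (k l : K d) (v : L2K d) : lam (k * l) v = lam k (lam l v) := by
  have h : (fun x : K d => (k * l)⁻¹ * x) = (fun x => l⁻¹ * x) ∘ fun x => k⁻¹ * x := by
    ext1 x
    simp [mul_assoc]
  refine Lp.ext ?_
  refine (coeFn_lam _ _).trans (Filter.EventuallyEq.trans ?_ (coeFn_lam _ _).symm)
  have := (measurePreserving_mul_left (haarProb (K d)) k⁻¹).quasiMeasurePreserving.ae_eq_comp
    (coeFn_lam l v)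
  refine Filter.EventuallyEq.trans (Filter.Eventually.of_forall fun x => ?_) this.symm
  exact congrArg v (congrFun h x)

theorem lam_one {d : ℕ} (v : L2K d) : lam 1 v = v := by
  refine Lp.ext ((coeFn_lam _ _).trans (Filter.Eventually.of_forall fun x => ?_))
  simp

theorem inner_lam_lam {d : ℕ} (k : K d) (v w : L2K d) :
    inner ℂ (lam k v) (lam k w) = inner ℂ v w := (lam k).inner_map_map v w

theorem inner_lam_left {d : ℕ} (k : K d) (v w : L2K d) :
    inner ℂ (lam k v) w = inner ℂ v (lam k⁻¹ w) := by
  rw [← inner_lam_lam k v, ← lam_mul, mul_inv_cancel, lam_one]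

theorem continuous_lam_apply {d : ℕ} (v : L2K d) : Continuous fun k : K d => lam k v := by
  let g : C(K d, C(K d, K d)) :=
    ContinuousMap.curry ⟨fun q : K d × K d => q.1⁻¹ * q.2, by fun_prop⟩
  have hg : ∀ k, MeasurePreserving (g k) (haarProb (K d)) (haarProb (K d)) := fun k =>
    measurePreserving_mul_left (haarProb (K d)) k⁻¹
  have h : Continuous fun k => Lp.compMeasurePreserving (g k) (hg k) v :=
    Continuous.compMeasurePreservingLp continuous_const g.continuous hg (by simp)
  refine h.congr fun k => Lp.ext ?_
  exact (Lp.coeFn_compMeasurePreserving v (hg k)).trans (coeFn_lam k v).symm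

/-- The element of `L²(K)` given by a continuous function. -/
def ofCont {d : ℕ} : C(K d, ℂ) →L[ℂ] L2K d := ContinuousMap.toLp 2 (haarProb (K d)) ℂ

theorem coeFn_ofCont {d : ℕ} (f : C(K d, ℂ)) : ofCont f =ᵐ[haarProb (K d)] f :=
  ContinuousMap.coeFn_toLp _ f

theorem ofCont_injective {d : ℕ} : Function.Injective (ofCont (d := d)) :=
  ContinuousMap.toLp_injective _

theorem evalAt_ofCont {d : ℕ} (f : C(K d, ℂ)) (k : K d) : evalAt (ofCont f) k = f k := by
  have h := Function.leftInverse_invFun (ofCont_injective (d := d)) f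
  exact congrArg (fun f : C(K d, ℂ) => f k) h

/-- Left translation of continuous functions. -/
def transl {d : ℕ} (k : K d) (f : C(K d, ℂ)) : C(K d, ℂ) := ⟨fun x => f (k⁻¹ * x), by fun_prop⟩

theorem lam_ofCont {d : ℕ} (k : K d) (f : C(K d, ℂ)) : lam k (ofCont f) = ofCont (transl k f) := by
  refine Lp.ext ((coeFn_lam _ _).trans (Filter.EventuallyEq.trans ?_ (coeFn_ofCont _).symm))
  exact (measurePreserving_mul_left (haarProb (K d)) k⁻¹).quasiMeasurePreserving.ae_eq_comp
    (coeFn_ofCont f)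

theorem continuous_transl {d : ℕ} (f : C(K d, ℂ)) : Continuous fun k : K d => transl k f :=
  (ContinuousMap.curry ⟨fun q : K d × K d => f (q.1⁻¹ * q.2), by fun_prop⟩).continuous

theorem integrable_of_continuous {H : Type} [Group H] [TopologicalSpace H] [IsTopologicalGroup H]
    [CompactSpace H] [T2Space H] [MeasurableSpace H] [BorelSpace H] {E : Type*} [NormedAddCommGroup E]
    {f : H → E} (hf : Continuous f) : Integrable f (haarProb H) := by
  rw [← integrableOn_univ]
  exact hf.continuousOn.integrableOn_compact isCompact_univ

/-! ### Matrix coefficients of representations of `K` -/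

namespace IrredRep

variable {H : Type} [Group H] [TopologicalSpace H]

/-- The complex conjugate of the matrix of `τ h`. -/
def conjMat (τ : IrredRep H) (h : H) : Matrix (Fin τ.dim) (Fin τ.dim) ℂ :=
  (LinearMap.toMatrix' (τ.rep h)).map (starRingEnd ℂ)

theorem conjMat_mul (τ : IrredRep H) (h h' : H) :
    τ.conjMat (h * h') = τ.conjMat h * τ.conjMat h' := by
  rw [conjMat, map_mul, LinearMap.toMatrix'_mul, Matrix.map_mul]
  rfl

theorem conjMat_one (τ : IrredRep H) : τ.conjMat 1 = 1 := by
  rw [conjMat, map_one, LinearMap.toMatrix'_one, Matrix.map_one _ (map_zero _) (map_one _)]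

theorem continuous_conjMat (τ : IrredRep H) : Continuous τ.conjMat := by
  refine continuous_matrix fun i j => ?_
  have h1 : Continuous fun h => τ.rep h (Pi.single j 1) i :=
    (continuous_apply i).comp (τ.continuous_rep _)
  have h2 : (fun h => τ.conjMat h i j) = fun h => conj (τ.rep h (Pi.single j 1) i) := by
    ext1 h
    simp [conjMat, LinearMap.toMatrix'_apply]
  rw [h2]
  exact Complex.continuous_conj.comp h1

theorem conj_chi (τ : IrredRep H) (h : H) : conj (τ.chi h) = τ.dim * (τ.conjMat h).trace := by
  have h1 : LinearMap.trace ℂ (Fin τ.dim → ℂ) (τ.rep h) =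
      (LinearMap.toMatrix' (τ.rep h)).trace :=
    LinearMap.trace_eq_matrix_trace ℂ (Pi.basisFun ℂ (Fin τ.dim)) _
  rw [chi, h1, map_mul, map_natCast]
  congr 1
  simp [conjMat, Matrix.trace]

theorem continuous_conj_chi (τ : IrredRep H) : Continuous fun h => conj (τ.chi h) := by
  simp only [conj_chi]
  exact continuous_const.mul (Continuous.matrix_trace τ.continuous_conjMat)

theorem conj_chi_conj (τ : IrredRep H) (g h : H) :
    conj (τ.chi (g * h * g⁻¹)) = conj (τ.chi h) := by
  rw [conj_chi, conj_chi, conjMat_mul, conjMat_mul, Matrix.trace_mul_comm, ← mul_assoc,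
    ← conjMat_mul, inv_mul_cancel, conjMat_one, one_mul]

/-- Schur's lemma for the conjugate representation, obtained from the one for `τ` by conjugating all
entries. -/
theorem eq_smul_one_of_commute (τ : IrredRep H) {A : Matrix (Fin τ.dim) (Fin τ.dim) ℂ}
    (hA : ∀ h, A * τ.conjMat h = τ.conjMat h * A) : ∃ c : ℂ, A = c • 1 := by
  set B := A.map (starRingEnd ℂ) with hB
  have hcomm : ∀ h, B * LinearMap.toMatrix' (τ.rep h) = LinearMap.toMatrix' (τ.rep h) * B := by
    intro h
    have h1 := congrArg (fun X : Matrix _ _ ℂ => X.map (starRingEnd ℂ)) (hA h)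
    simp only [Matrix.map_mul, conjMat] at h1
    have h2 : ((LinearMap.toMatrix' (τ.rep h)).map (starRingEnd ℂ)).map (starRingEnd ℂ) =
        LinearMap.toMatrix' (τ.rep h) := by
      ext i j
      simp
    rwa [h2] at h1
  have := τ.irreducible
  let f : Representation.IntertwiningMap τ.rep τ.rep :=
    { toLinearMap := Matrix.toLin' B
      isIntertwining' := by
        intro h
        apply LinearMap.toMatrix'.injective
        simp only [LinearMap.toMatrix'_comp, LinearMap.toMatrix'_toLin', hcomm h] }
  obtain ⟨c, hc⟩ := (Representation.IsIrreducible.algebraMap_intertwiningMap_bijective_of_isAlgClosed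
    (ρ := τ.rep)).2 f
  have hc' : Matrix.toLin' B = c • LinearMap.id := by
    have : f.toLinearMap = c • LinearMap.id := by
      rw [← hc]
      rfl
    exact this
  refine ⟨conj c, ?_⟩
  have h3 : B = c • 1 := by
    have := congrArg LinearMap.toMatrix' hc'
    simpa using this
  have h4 : A = B.map (starRingEnd ℂ) := by
    ext i j
    simp [hB]
  rw [h4, h3]
  ext i j
  by_cases hij : i = j <;> simp [hij]

end IrredRep

/-- The function `x ↦ tr (C τ(x)‾)`. -/
def coefCont {d : ℕ} (τ : IrredRep (K d)) :
    Matrix (Fin τ.dim) (Fin τ.dim) ℂ →ₗ[ℂ] C(K d, ℂ) where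
  toFun C := ⟨fun x => (C * τ.conjMat x).trace,
    Continuous.matrix_trace (continuous_const.matrix_mul τ.continuous_conjMat)⟩
  map_add' C D := by
    ext x
    simp [Matrix.add_mul]
  map_smul' c C := by
    ext x
    simp

/-- The element `x ↦ tr (C τ(x)‾)` of `L²(K)`. -/
def coef {d : ℕ} (τ : IrredRep (K d)) : Matrix (Fin τ.dim) (Fin τ.dim) ℂ →ₗ[ℂ] L2K d :=
  ofCont.toLinearMap ∘ₗ coefCont τ

theorem coef_apply {d : ℕ} (τ : IrredRep (K d)) (C : Matrix (Fin τ.dim) (Fin τ.dim) ℂ) :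
    coef τ C = ofCont (coefCont τ C) := rfl

theorem lam_coef {d : ℕ} (τ : IrredRep (K d)) (k : K d) (C : Matrix (Fin τ.dim) (Fin τ.dim) ℂ) :
    lam k (coef τ C) = coef τ (C * τ.conjMat k⁻¹) := by
  rw [coef_apply, coef_apply, lam_ofCont]
  congr 1
  ext x
  simp [transl, coefCont, IrredRep.conjMat_mul, Matrix.mul_assoc]

/-! ### The projection onto an isotypic part -/

/-- `P_τ` as a continuous linear map. -/
def projCLM {d : ℕ} (τ : IrredRep (K d)) : L2K d →L[ℂ] L2K d :=
  LinearMap.mkContinuous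
    { toFun := projK τ
      map_add' := fun v w => by
        simp only [projK, leftReg_eq, map_add, smul_add]
        exact integral_add
          (integrable_of_continuous (τ.continuous_conj_chi.smul (continuous_lam_apply v)))
          (integrable_of_continuous (τ.continuous_conj_chi.smul (continuous_lam_apply w)))
      map_smul' := fun c v => by
        simp only [projK, leftReg_eq, map_smul, RingHom.id_apply]
        rw [← integral_smul]
        exact integral_congr_ae (Filter.Eventually.of_forall fun k => smul_comm _ _ _) }
    (∫ k, ‖conj (τ.chi k)‖ ∂haarProb (K d)) (fun v => by
      simp only [LinearMap.coe_mk, AddHom.coe_mk, projK, leftReg_eq]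
      refine (norm_integral_le_integral_norm _).trans ?_
      rw [← integral_mul_const]
      refine integral_mono_of_nonneg (Filter.Eventually.of_forall fun k => norm_nonneg _)
        (integrable_of_continuous (τ.continuous_conj_chi.norm.mul continuous_const))
        (Filter.Eventually.of_forall fun k => ?_)
      simp [norm_smul])

/-- The kernel of `P_τ` is a class function and Haar measure is invariant on both sides. -/
theorem projK_lam {d : ℕ} (τ : IrredRep (K d)) (g : K d) (v : L2K d) :
    projK τ (lam g v) = lam g (projK τ v) := by
  have hi := integrable_of_continuous (τ.continuous_conj_chi.smul (continuous_lam_apply v))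
  have h1 : lam g (projK τ v) = ∫ k, conj (τ.chi k) • lam (g * k) v ∂haarProb (K d) := by
    simp only [projK, leftReg_eq]
    refine ((lam g).toContinuousLinearMap.integral_comp_comm hi).symm.trans ?_
    refine integral_congr_ae (Filter.Eventually.of_forall fun k => ?_)
    simp [lam_mul]
  rw [h1, projK]
  rw [← integral_mul_left_eq_self (fun k => conj (τ.chi k) • leftReg k (lam g v)) g,
    ← integral_mul_right_eq_self (fun k => conj (τ.chi (g * k)) • leftReg (g * k) (lam g v)) g⁻¹]
  refine integral_congr_ae (Filter.Eventually.of_forall fun k => ?_)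
  simp only [leftReg_eq, ← lam_mul, ← mul_assoc]
  rw [τ.conj_chi_conj, inv_mul_cancel_right]

theorem integral_mul_left_inv_eq {d : ℕ} (f : K d → ℂ) (x : K d) :
    ∫ k, f (k⁻¹ * x) ∂haarProb (K d) = ∫ k, f k ∂haarProb (K d) := by
  rw [integral_inv_eq_self (fun k => f (k * x)), integral_mul_right_eq_self]

/-- Since `P_τ f (x) = ∫ conj(χ_τ(x y⁻¹)) f(y) dy` and `τ(x y⁻¹) = τ(x) τ(y⁻¹)`, the variable `x`
separates, and integrating the rest over `y` gives the matrix `D`. -/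
theorem projK_ofCont_mem {d : ℕ} (τ : IrredRep (K d)) (f : C(K d, ℂ)) :
    projK τ (ofCont f) ∈ LinearMap.range (coef τ) := by
  let D : Matrix (Fin τ.dim) (Fin τ.dim) ℂ :=
    Matrix.of fun i j => ∫ y, τ.dim * (f y * τ.conjMat y⁻¹ i j) ∂haarProb (K d)
  refine ⟨D, ?_⟩
  have hc : Continuous fun k => conj (τ.chi k) • transl k f :=
    τ.continuous_conj_chi.smul (continuous_transl f)
  have hi := integrable_of_continuous hc
  have h1 : projK τ (ofCont f) = ofCont (∫ k, conj (τ.chi k) • transl k f ∂haarProb (K d)) := by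
    rw [← ofCont.integral_comp_comm hi]
    simp [projK, leftReg_eq, lam_ofCont]
  rw [h1, coef_apply]
  congr 1
  ext x
  have hev := (ContinuousMap.evalCLM ℂ x).integral_comp_comm hi
  have h2 : (∫ k, conj (τ.chi k) • transl k f ∂haarProb (K d)) x =
      ∫ k, conj (τ.chi k) * f (k⁻¹ * x) ∂haarProb (K d) := hev.symm
  have hcm : Continuous fun y => τ.conjMat y⁻¹ := τ.continuous_conjMat.comp continuous_inv
  have hint : ∀ i j, Integrable (fun y => τ.dim * (f y * τ.conjMat y⁻¹ i j)) (haarProb (K d)) := by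
    intro i j
    refine integrable_of_continuous ?_
    have : Continuous fun y => τ.conjMat y⁻¹ i j := hcm.matrix_elem i j
    fun_prop
  have h3 : ∫ k, conj (τ.chi k) * f (k⁻¹ * x) ∂haarProb (K d) =
      ∫ y, conj (τ.chi (x * y⁻¹)) * f y ∂haarProb (K d) := by
    rw [← integral_mul_left_inv_eq (fun y => conj (τ.chi (x * y⁻¹)) * f y) x]
    simp
  rw [h2, h3]
  have hD : (D * τ.conjMat x).trace =
      ∑ i, ∑ j, ∫ y, τ.dim * (f y * τ.conjMat y⁻¹ i j) * τ.conjMat x j i ∂haarProb (K d) := by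
    simp only [Matrix.trace, Matrix.diag, Matrix.mul_apply, D, Matrix.of_apply]
    exact Finset.sum_congr rfl fun i _ => Finset.sum_congr rfl fun j _ =>
      (integral_mul_const _ _).symm
  have hsum : ∀ i, ∑ j, ∫ y, τ.dim * (f y * τ.conjMat y⁻¹ i j) * τ.conjMat x j i ∂haarProb (K d) =
      ∫ y, ∑ j, τ.dim * (f y * τ.conjMat y⁻¹ i j) * τ.conjMat x j i ∂haarProb (K d) :=
    fun i => (integral_finsetSum _ fun j _ => (hint i j).mul_const _).symm
  refine hD.trans ((Finset.sum_congr rfl fun i _ => hsum i).trans ?_)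
  refine (integral_finsetSum _ fun i _ => integrable_finsetSum _ fun j _ =>
    (hint i j).mul_const _).symm.trans ?_
  refine integral_congr_ae (Filter.Eventually.of_forall fun y => ?_)
  simp only [τ.conj_chi, τ.conjMat_mul]
  rw [Matrix.trace_mul_comm]
  simp only [Matrix.trace, Matrix.diag, Matrix.mul_apply, Finset.mul_sum, Finset.sum_mul]
  refine Finset.sum_congr rfl fun i _ => Finset.sum_congr rfl fun j _ => ?_
  ring

/-- Continuous functions are dense, and a finite-dimensional range is closed. This makes `K`-types
finite-dimensional and gives their vectors continuous representatives. -/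
theorem projK_mem {d : ℕ} (τ : IrredRep (K d)) (v : L2K d) :
    projK τ v ∈ LinearMap.range (coef τ) := by
  have hcl : IsClosed {v : L2K d | projCLM τ v ∈ LinearMap.range (coef τ)} :=
    (Submodule.closed_of_finiteDimensional _).preimage (projCLM τ).continuous
  have hd : DenseRange (ofCont (d := d)) := ContinuousMap.toLp_denseRange _ _ _ (by simp)
  exact hd.induction_on (p := fun v => projCLM τ v ∈ LinearMap.range (coef τ)) v hcl
    (projK_ofCont_mem τ)

/-! ### Differentiability of representations of `K` -/

theorem expK_add {d : ℕ} (X : LieK d) (s t : ℝ) :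
    expK ((s + t) • X) = expK (s • X) * expK (t • X) := by
  apply Subtype.ext
  change NormedSpace.exp ((s + t) • X.1) = NormedSpace.exp (s • X.1) * NormedSpace.exp (t • X.1)
  rw [add_smul, Matrix.exp_add_of_commute]
  exact ((Commute.refl X.1).smul_left s).smul_right t

theorem expK_neg {d : ℕ} (X : LieK d) (t : ℝ) : expK ((-t) • X) = (expK (t • X))⁻¹ := by
  rw [eq_inv_iff_mul_eq_one, ← expK_add, neg_add_cancel, zero_smul, expK_zero]

open scoped Matrix.Norms.Operator in
theorem hasDerivAt_exp_smul {d : ℕ} (X : LieK d) (t : ℝ) :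
    HasDerivAt (fun t : ℝ => (expK (t • X)).1) ((expK (t • X)).1 * X.1) t :=
  hasDerivAt_exp_smul_const X.1 t

open scoped Matrix.Norms.Operator in
theorem continuous_expK_smul {d : ℕ} (X : LieK d) : Continuous fun t : ℝ => expK (t • X) := by
  refine continuous_induced_rng.2 ?_
  exact continuous_iff_continuousAt.2 fun t => (hasDerivAt_exp_smul X t).continuousAt

theorem trace_one_sub_sq {d : ℕ} (k : K d) :
    ∑ i, ∑ j, (k.1 i j - (1 : Matrix (Fin (d + 1)) (Fin (d + 1)) ℝ) i j) ^ 2 =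
      2 * ((d + 1 : ℝ) - k.1.trace) := by
  have h1 : ((k.1 - 1)ᵀ * (k.1 - 1)).trace =
      ∑ i, ∑ j, (k.1 i j - (1 : Matrix (Fin (d + 1)) (Fin (d + 1)) ℝ) i j) ^ 2 := by
    simp only [Matrix.trace, Matrix.diag, Matrix.mul_apply, Matrix.transpose_apply,
      Matrix.sub_apply, ← sq]
    exact Finset.sum_comm
  rw [← h1, Matrix.transpose_sub, Matrix.sub_mul, Matrix.mul_sub, Matrix.mul_sub, orthogonal_mul']
  simp
  ring

theorem trace_le {d : ℕ} (k : K d) : k.1.trace ≤ d + 1 := by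
  have := trace_one_sub_sq k
  have h : 0 ≤ ∑ i, ∑ j, (k.1 i j - (1 : Matrix (Fin (d + 1)) (Fin (d + 1)) ℝ) i j) ^ 2 :=
    Finset.sum_nonneg fun i _ => Finset.sum_nonneg fun j _ => sq_nonneg _
  linarith

/-- The trace measures the distance to `1`: the squared Hilbert–Schmidt norm of `k - 1` is `2(d + 1
- tr k)`. Off an open neighbourhood of `1` the trace attains, by compactness, a maximum below `d +
1`. -/
theorem exists_trace_nhds {d : ℕ} {s : Set (K d)} (hs : s ∈ nhds 1) :
    ∃ δ > 0, ∀ k : K d, (d + 1 : ℝ) - δ < k.1.trace → k ∈ s := by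
  by_contra! hcon
  obtain ⟨u, hus, huo, h1u⟩ := mem_nhds_iff.1 hs
  rcases (uᶜ).eq_empty_or_nonempty with he | hne
  · obtain ⟨k, -, hk⟩ := hcon 1 one_pos
    exact hk (hus (by rw [compl_empty_iff.1 he]; trivial))
  have hc : IsCompact uᶜ := huo.isClosed_compl.isCompact
  have htr : Continuous fun k : K d => k.1.trace :=
    Continuous.matrix_trace continuous_subtype_val
  obtain ⟨k₀, hk₀, hmax⟩ := hc.exists_isMaxOn hne htr.continuousOn
  have hlt : k₀.1.trace < d + 1 := by
    refine lt_of_le_of_ne (trace_le k₀) fun h => ?_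
    have h0 := trace_one_sub_sq k₀
    rw [h, sub_self, mul_zero] at h0
    have h2 : k₀ = 1 := by
      apply Subtype.ext
      ext i j
      have h3 := (Finset.sum_eq_zero_iff_of_nonneg fun i _ =>
        Finset.sum_nonneg fun j _ => sq_nonneg _).1 h0 i (Finset.mem_univ _)
      have h4 := (Finset.sum_eq_zero_iff_of_nonneg fun j _ => sq_nonneg _).1 h3 j
        (Finset.mem_univ _)
      exact sub_eq_zero.1 (pow_eq_zero_iff two_ne_zero |>.1 h4)
    exact hk₀ (h2 ▸ h1u)
  obtain ⟨k, hk, hks⟩ := hcon (d + 1 - k₀.1.trace) (by linarith)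
  have : k.1.trace ≤ k₀.1.trace := hmax (show k ∈ uᶜ from fun h => hks (hus h))
  linarith

/-- A smooth function on `ℝ` that is positive exactly to the right of `b`. -/
def cutoff (b s : ℝ) : ℝ := Real.smoothTransition (s - b)

theorem contDiff_cutoff (b : ℝ) : ContDiff ℝ 1 (cutoff b) :=
  Real.smoothTransition.contDiff.comp (by fun_prop)

variable {d : ℕ} (τ : IrredRep (K d))

theorem continuous_trace : Continuous fun k : K d => k.1.trace :=
  Continuous.matrix_trace continuous_subtype_val

theorem continuous_conjMat_apply (i j : Fin τ.dim) : Continuous fun k => τ.conjMat k i j :=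
  τ.continuous_conjMat.matrix_elem i j

/-- The average of `τ(k)‾` near `1`. -/
def avgMat (b : ℝ) : Matrix (Fin τ.dim) (Fin τ.dim) ℂ :=
  Matrix.of fun i j => ∫ k, (cutoff b k.1.trace : ℂ) * τ.conjMat k i j ∂haarProb (K d)

theorem continuous_cutoff_trace (b : ℝ) : Continuous fun k : K d => (cutoff b k.1.trace : ℂ) :=
  Complex.continuous_ofReal.comp ((contDiff_cutoff b).continuous.comp continuous_trace)

theorem exists_det_avgMat_ne_zero : ∃ b, (avgMat τ b).det ≠ 0 := by
  -- Each entry of the average is within `εc` of that of `c · 1`; `dim · ε < 1` then makes the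
  -- matrix strictly diagonally dominant.
  let ε : ℝ := 1 / (τ.dim + 1)
  have hε : 0 < ε := by positivity
  have hnhds : {k : K d | ∀ i j, ‖τ.conjMat k i j -
      (1 : Matrix (Fin τ.dim) (Fin τ.dim) ℂ) i j‖ < ε} ∈ nhds 1 := by
    have : {k : K d | ∀ i j, ‖τ.conjMat k i j -
        (1 : Matrix (Fin τ.dim) (Fin τ.dim) ℂ) i j‖ < ε} = ⋂ i, ⋂ j, {k : K d |
        ‖τ.conjMat k i j - (1 : Matrix (Fin τ.dim) (Fin τ.dim) ℂ) i j‖ < ε} := by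
      ext k
      simp
    rw [this]
    refine Filter.iInter_mem.2 fun i => Filter.iInter_mem.2 fun j => ?_
    have ho : IsOpen {k : K d |
        ‖τ.conjMat k i j - (1 : Matrix (Fin τ.dim) (Fin τ.dim) ℂ) i j‖ < ε} :=
      isOpen_lt ((continuous_conjMat_apply τ i j).sub continuous_const).norm continuous_const
    refine ho.mem_nhds ?_
    simp [τ.conjMat_one, hε]
  obtain ⟨δ, hδ, hk⟩ := exists_trace_nhds hnhds
  set b : ℝ := d + 1 - δ with hb
  refine ⟨b, ?_⟩
  have hcont : Continuous fun k : K d => cutoff b k.1.trace :=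
    (contDiff_cutoff b).continuous.comp continuous_trace
  have hnn : ∀ k : K d, 0 ≤ cutoff b k.1.trace := fun k => Real.smoothTransition.nonneg _
  set c : ℝ := ∫ k : K d, cutoff b k.1.trace ∂haarProb (K d) with hc
  have hcpos : 0 < c := by
    refine hcont.integral_pos_of_hasCompactSupport_nonneg_nonzero
      (HasCompactSupport.of_compactSpace _) hnn (x := 1) ?_
    refine (Real.smoothTransition.pos_of_pos ?_).ne'
    simp [hb, hδ]
  have hclose : ∀ i j, ‖avgMat τ b i j - c * (1 : Matrix (Fin τ.dim) (Fin τ.dim) ℂ) i j‖ ≤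
      ε * c := by
    intro i j
    have h1 : avgMat τ b i j - c * (1 : Matrix (Fin τ.dim) (Fin τ.dim) ℂ) i j =
        ∫ k : K d, (cutoff b k.1.trace : ℂ) * (τ.conjMat k i j -
          (1 : Matrix (Fin τ.dim) (Fin τ.dim) ℂ) i j) ∂haarProb (K d) := by
      rw [hc, ← integral_complex_ofReal, ← integral_mul_const]
      simp only [avgMat, Matrix.of_apply, mul_sub]
      refine (integral_sub ?_ ?_).symm
      · exact integrable_of_continuous
          ((continuous_cutoff_trace b).mul (continuous_conjMat_apply τ i j))
      · exact integrable_of_continuous ((continuous_cutoff_trace b).mul continuous_const)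
    rw [h1, hc, ← integral_const_mul]
    refine norm_integral_le_of_norm_le (integrable_of_continuous (hcont.const_mul ε))
      (Filter.Eventually.of_forall fun k => ?_)
    rw [norm_mul, Complex.norm_real, Real.norm_of_nonneg (hnn k), mul_comm]
    by_cases hbk : b < k.1.trace
    · exact mul_le_mul_of_nonneg_right (hk k hbk i j).le (hnn k)
    · have : cutoff b k.1.trace = 0 :=
        Real.smoothTransition.zero_of_nonpos (by linarith)
      rw [this, mul_zero, mul_zero]
  refine det_ne_zero_of_sum_row_lt_diag fun i => ?_
  have h1 : ∀ j ∈ Finset.univ.erase i, ‖avgMat τ b i j‖ ≤ ε * c := by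
    intro j hj
    have := hclose i j
    rwa [Matrix.one_apply_ne (Finset.ne_of_mem_erase hj).symm, mul_zero, sub_zero] at this
  have h2 : c - ε * c ≤ ‖avgMat τ b i i‖ := by
    have := hclose i i
    rw [Matrix.one_apply_eq, mul_one, norm_sub_rev] at this
    have h3 := norm_sub_norm_le (c : ℂ) (avgMat τ b i i)
    rw [Complex.norm_real, Real.norm_of_nonneg hcpos.le] at h3
    linarith
  refine (Finset.sum_le_sum h1).trans_lt (lt_of_lt_of_le ?_ h2)
  have hpos : 1 ≤ τ.dim := i.pos
  rw [Finset.sum_const, Finset.card_erase_of_mem (Finset.mem_univ _), Finset.card_univ,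
    Fintype.card_fin, nsmul_eq_mul, Nat.cast_sub hpos]
  have : ε * (τ.dim + 1) = 1 := by
    simp only [ε]
    field_simp
  push_cast
  nlinarith

/-- The parameter of a cutoff for which the average of `τ(k)‾` is invertible. -/
def cutoffParam : ℝ := (exists_det_avgMat_ne_zero τ).choose

/-- After translating the integral, `x` occurs only in the smooth cutoff, so this product can be
differentiated although `τ` is only known to be continuous. -/
theorem conjMat_mul_avgMat (b : ℝ) (x : K d) (i j : Fin τ.dim) :
    (τ.conjMat x * avgMat τ b) i j =
      ∫ k : K d, (cutoff b ((x.1)ᵀ * k.1).trace : ℂ) * τ.conjMat k i j ∂haarProb (K d) := by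
  rw [← integral_mul_left_eq_self _ x]
  have h1 : ∀ k : K d, (cutoff b ((x.1)ᵀ * (x * k).1).trace : ℂ) * τ.conjMat (x * k) i j =
      ∑ l, τ.conjMat x i l * ((cutoff b k.1.trace : ℂ) * τ.conjMat k l j) := by
    intro k
    rw [Submonoid.coe_mul, ← Matrix.mul_assoc, orthogonal_mul', Matrix.one_mul, τ.conjMat_mul,
      Matrix.mul_apply, Finset.mul_sum]
    exact Finset.sum_congr rfl fun l _ => by ring
  simp only [h1]
  rw [integral_finsetSum, Matrix.mul_apply]
  · refine Finset.sum_congr rfl fun l _ => ?_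
    rw [integral_const_mul]
    rfl
  · intro l _
    exact integrable_of_continuous (continuous_const.mul
      ((continuous_cutoff_trace b).mul (continuous_conjMat_apply τ l j)))

/-- The derivative of the smoothed matrix coefficients. -/
def avgDeriv (b : ℝ) (X : Matrix (Fin (d + 1)) (Fin (d + 1)) ℝ) :
    Matrix (Fin τ.dim) (Fin τ.dim) ℂ :=
  Matrix.of fun i j => ∫ k : K d, ((deriv (cutoff b) k.1.trace * (Xᵀ * k.1).trace : ℝ) : ℂ) *
    τ.conjMat k i j ∂haarProb (K d)

theorem continuous_deriv_cutoff (b : ℝ) : Continuous (deriv (cutoff b)) :=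
  (contDiff_cutoff b).continuous_deriv le_rfl

theorem continuous_avgDeriv_integrand (b : ℝ) (X : Matrix (Fin (d + 1)) (Fin (d + 1)) ℝ)
    (i j : Fin τ.dim) : Continuous fun k : K d =>
      ((deriv (cutoff b) k.1.trace * (Xᵀ * k.1).trace : ℝ) : ℂ) * τ.conjMat k i j := by
  refine (Complex.continuous_ofReal.comp (Continuous.mul ?_ ?_)).mul
    (continuous_conjMat_apply τ i j)
  · exact (continuous_deriv_cutoff b).comp continuous_trace
  · exact Continuous.matrix_trace (continuous_const.matrix_mul continuous_subtype_val)

open scoped Matrix.Norms.Operator in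
theorem hasDerivAt_conjMat_mul_avgMat (b : ℝ) (X : LieK d) (i j : Fin τ.dim) :
    HasDerivAt (fun t : ℝ => (τ.conjMat (expK (t • X)) * avgMat τ b) i j)
      (avgDeriv τ b X.1 i j) 0 := by
  simp only [conjMat_mul_avgMat]
  let F' : ℝ → K d → ℂ := fun t k =>
    ((deriv (cutoff b) ((expK (t • X)).1ᵀ * k.1).trace *
      (((expK (t • X)).1 * X.1)ᵀ * k.1).trace : ℝ) : ℂ) * τ.conjMat k i j
  have hexp : Continuous fun t : ℝ => (expK (t • X)).1 :=
    continuous_subtype_val.comp (continuous_expK_smul X)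
  have hF' : Continuous (Function.uncurry F') := by
    have h1 : Continuous fun p : ℝ × K d => (expK (p.1 • X)).1 := hexp.comp continuous_fst
    have h2 : Continuous fun p : ℝ × K d => p.2.1 := continuous_subtype_val.comp continuous_snd
    refine (Complex.continuous_ofReal.comp (Continuous.mul ?_ ?_)).mul
      ((continuous_conjMat_apply τ i j).comp continuous_snd)
    · exact (continuous_deriv_cutoff b).comp (h1.matrix_transpose.matrix_mul h2).matrix_trace
    · exact ((h1.matrix_mul continuous_const).matrix_transpose.matrix_mul h2).matrix_trace
  obtain ⟨B, hB⟩ := (isCompact_Icc.prod isCompact_univ : IsCompact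
    (Icc (-1 : ℝ) 1 ×ˢ (univ : Set (K d)))).exists_bound_of_continuousOn hF'.continuousOn
  have hder : ∀ (k : K d) (t : ℝ), HasDerivAt (fun t : ℝ =>
      (cutoff b ((expK (t • X)).1ᵀ * k.1).trace : ℂ) * τ.conjMat k i j) (F' t k) t := by
    intro k t
    have h1 := hasDerivAt_exp_smul X t
    let ℓ : Matrix (Fin (d + 1)) (Fin (d + 1)) ℝ →ₗ[ℝ] ℝ :=
      { toFun := fun A => (Aᵀ * k.1).trace
        map_add' := fun A A' => by simp [Matrix.add_mul]
        map_smul' := fun c A => by simp }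
    have h2 : HasDerivAt (fun t : ℝ => ((expK (t • X)).1ᵀ * k.1).trace)
        (((expK (t • X)).1 * X.1)ᵀ * k.1).trace t :=
      ((LinearMap.toContinuousLinearMap ℓ).hasFDerivAt.comp_hasDerivAt t h1)
    have h3 := ((contDiff_cutoff b).differentiable one_ne_zero
      ((expK (t • X)).1ᵀ * k.1).trace).hasDerivAt.comp t h2
    exact h3.ofReal_comp.mul_const _
  have key := (hasDerivAt_integral_of_dominated_loc_of_deriv_le (μ := haarProb (K d))
    (F := fun t k => (cutoff b ((expK (t • X)).1ᵀ * k.1).trace : ℂ) * τ.conjMat k i j)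
    (F' := F') (x₀ := 0) (s := Icc (-1) 1) (bound := fun _ => B)
    (Icc_mem_nhds (by norm_num) (by norm_num)) ?_ ?_ ?_ ?_ (integrable_const _) ?_).2
  · refine key.congr_deriv ?_
    simp [avgDeriv, F', expK_zero]
  · refine Filter.Eventually.of_forall fun t => ?_
    refine (Continuous.mul (Complex.continuous_ofReal.comp ((contDiff_cutoff b).continuous.comp ?_))
      (continuous_conjMat_apply τ i j)).aestronglyMeasurable
    exact (continuous_const.matrix_mul continuous_subtype_val).matrix_trace
  · refine integrable_of_continuous ?_
    refine (Continuous.mul (Complex.continuous_ofReal.comp ((contDiff_cutoff b).continuous.comp ?_))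
      (continuous_conjMat_apply τ i j))
    exact (continuous_const.matrix_mul continuous_subtype_val).matrix_trace
  · exact (hF'.comp (Continuous.prodMk continuous_const continuous_id)).aestronglyMeasurable
  · exact Filter.Eventually.of_forall fun k t ht => hB (t, k) ⟨ht, mem_univ _⟩
  · exact Filter.Eventually.of_forall fun k t _ => hder k t

/-- The derivative `dτ‾` of the conjugate of `τ`. -/
def dMat : LieK d →ₗ[ℝ] Matrix (Fin τ.dim) (Fin τ.dim) ℂ where
  toFun X := avgDeriv τ (cutoffParam τ) X.1 * (avgMat τ (cutoffParam τ))⁻¹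
  map_add' X Y := by
    rw [← Matrix.add_mul]
    congr 1
    ext i j
    simp only [avgDeriv, Matrix.of_apply, Matrix.add_apply]
    rw [← integral_add (integrable_of_continuous (continuous_avgDeriv_integrand τ _ _ _ _))
      (integrable_of_continuous (continuous_avgDeriv_integrand τ _ _ _ _))]
    refine integral_congr_ae (Filter.Eventually.of_forall fun k => ?_)
    simp [Matrix.add_mul]
    ring
  map_smul' c X := by
    rw [RingHom.id_apply, ← Matrix.smul_mul]
    congr 1
    ext i j
    simp only [avgDeriv, Matrix.of_apply, Matrix.smul_apply]
    rw [← integral_smul]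
    refine integral_congr_ae (Filter.Eventually.of_forall fun k => ?_)
    simp
    ring

/-- The averaged matrix is invertible, so differentiability passes from `τ(·)‾ A` to `τ(·)‾`. The
explicit derivative is visibly linear in `X`, which supplies additivity of `X ↦ dλ(X)`. -/
theorem hasDerivAt_conjMat (X : LieK d) (i j : Fin τ.dim) :
    HasDerivAt (fun t : ℝ => τ.conjMat (expK (t • X)) i j) (dMat τ X i j) 0 := by
  have hdet : IsUnit (avgMat τ (cutoffParam τ)).det :=
    (exists_det_avgMat_ne_zero τ).choose_spec.isUnit
  have h : ∀ A : Matrix (Fin τ.dim) (Fin τ.dim) ℂ, A i j =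
      ∑ l, (A * avgMat τ (cutoffParam τ)) i l * (avgMat τ (cutoffParam τ))⁻¹ l j := by
    intro A
    rw [← Matrix.mul_apply, Matrix.mul_nonsing_inv_cancel_right _ _ hdet]
  have h2 : (fun t : ℝ => τ.conjMat (expK (t • X)) i j) = fun t : ℝ =>
      ∑ l, (τ.conjMat (expK (t • X)) * avgMat τ (cutoffParam τ)) i l *
        (avgMat τ (cutoffParam τ))⁻¹ l j := funext fun t => h _
  rw [h2]
  exact HasDerivAt.fun_sum fun l _ =>
    (hasDerivAt_conjMat_mul_avgMat τ (cutoffParam τ) X i l).mul_const _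

/-! ### The derived representation -/

section Derived

variable {d : ℕ} (τ : IrredRep (K d))

theorem coef_eq_sum (C : Matrix (Fin τ.dim) (Fin τ.dim) ℂ) :
    coef τ C = ∑ i, ∑ j, C i j • coef τ (Matrix.single i j 1) := by
  conv_lhs => rw [Matrix.matrix_eq_sum_single C]
  simp only [map_sum]
  refine Finset.sum_congr rfl fun i _ => Finset.sum_congr rfl fun j _ => ?_
  rw [← map_smul, Matrix.smul_single, smul_eq_mul, mul_one]

theorem hasDerivAt_coef {A : ℝ → Matrix (Fin τ.dim) (Fin τ.dim) ℂ}
    {A' : Matrix (Fin τ.dim) (Fin τ.dim) ℂ} {t : ℝ}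
    (h : ∀ i j, HasDerivAt (fun t => A t i j) (A' i j) t) :
    HasDerivAt (fun t => coef τ (A t)) (coef τ A') t := by
  have h1 : (fun t => coef τ (A t)) =
      fun t => ∑ i, ∑ j, A t i j • coef τ (Matrix.single i j 1) := funext fun t => coef_eq_sum τ _
  rw [h1, coef_eq_sum τ A']
  exact HasDerivAt.fun_sum fun i _ => HasDerivAt.fun_sum fun j _ => (h i j).smul_const _

theorem hasDerivAt_lam_coef (X : LieK d) (C : Matrix (Fin τ.dim) (Fin τ.dim) ℂ) :
    HasDerivAt (fun t : ℝ => lam (expK (t • X)) (coef τ C)) (coef τ (-(C * dMat τ X))) 0 := by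
  have h1 : (fun t : ℝ => lam (expK (t • X)) (coef τ C)) =
      fun t => coef τ (C * τ.conjMat (expK ((-t) • X))) := by
    ext1 t
    rw [lam_coef, expK_neg]
  rw [h1]
  refine hasDerivAt_coef τ fun i j => ?_
  simp only [Matrix.mul_apply, Matrix.neg_apply, ← Finset.sum_neg_distrib]
  refine HasDerivAt.fun_sum fun l _ => ?_
  have h2 : HasDerivAt (fun t : ℝ => τ.conjMat (expK (t • X)) l j) (dMat τ X l j) (-0) := by
    rw [neg_zero]
    exact hasDerivAt_conjMat τ X l j
  have h3 := (h2.scomp (0 : ℝ) (hasDerivAt_neg (0 : ℝ))).const_mul (C i l)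
  refine h3.congr_deriv ?_
  simp

theorem dLeft_coef (X : LieK d) (C : Matrix (Fin τ.dim) (Fin τ.dim) ℂ) :
    dLeft X (coef τ C) = coef τ (-(C * dMat τ X)) := by
  simp only [dLeft, leftReg_eq]
  exact (hasDerivAt_lam_coef τ X C).deriv

variable {τ}

theorem hasDerivAt_lam (X : LieK d) {v : L2K d} (hv : v ∈ LinearMap.range (coef τ)) (t : ℝ) :
    HasDerivAt (fun t : ℝ => lam (expK (t • X)) v) (lam (expK (t • X)) (dLeft X v)) t := by
  obtain ⟨C, rfl⟩ := hv
  have h0 := hasDerivAt_lam_coef τ X C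
  rw [← dLeft_coef] at h0
  have h1 : (fun r : ℝ => lam (expK (r • X)) (coef τ C)) =
      fun r => lam (expK (t • X)) (lam (expK ((r - t) • X)) (coef τ C)) := by
    ext1 r
    rw [← lam_mul, ← expK_add, add_sub_cancel]
  rw [h1]
  have h2 : HasDerivAt (fun r : ℝ => lam (expK ((r - t) • X)) (coef τ C))
      (dLeft X (coef τ C)) t := by
    have h3 : HasDerivAt (fun t : ℝ => lam (expK (t • X)) (coef τ C)) (dLeft X (coef τ C))
        (t - t) := by
      rw [sub_self]
      exact h0
    exact HasDerivAt.comp_sub_const (f := fun t : ℝ => lam (expK (t • X)) (coef τ C)) t t h3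
  exact ((lam (expK (t • X))).toContinuousLinearMap.restrictScalars ℝ).hasFDerivAt.comp_hasDerivAt
    t h2

theorem dLeft_mem_range (X : LieK d) {v : L2K d} (hv : v ∈ LinearMap.range (coef τ)) :
    dLeft X v ∈ LinearMap.range (coef τ) := by
  obtain ⟨C, rfl⟩ := hv
  rw [dLeft_coef]
  exact ⟨_, rfl⟩

theorem dLeft_add (X Y : LieK d) {v : L2K d} (hv : v ∈ LinearMap.range (coef τ)) :
    dLeft (X + Y) v = dLeft X v + dLeft Y v := by
  obtain ⟨C, rfl⟩ := hv
  rw [dLeft_coef, dLeft_coef, dLeft_coef, ← map_add, map_add, Matrix.mul_add, neg_add]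

theorem dLeft_smul (c : ℝ) (X : LieK d) {v : L2K d} (hv : v ∈ LinearMap.range (coef τ)) :
    dLeft (c • X) v = (c : ℂ) • dLeft X v := by
  obtain ⟨C, rfl⟩ := hv
  rw [dLeft_coef, dLeft_coef, ← map_smul, map_smul, Matrix.mul_smul, smul_neg]
  rfl

theorem dLeft_sum {ι : Type*} (s : Finset ι) (c : ι → ℝ) (X : ι → LieK d) {v : L2K d}
    (hv : v ∈ LinearMap.range (coef τ)) :
    dLeft (∑ i ∈ s, c i • X i) v = ∑ i ∈ s, (c i : ℂ) • dLeft (X i) v := by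
  classical
  induction s using Finset.induction_on with
  | empty =>
    have := dLeft_smul 0 (0 : LieK d) hv
    simpa using this
  | insert i s hi ih =>
    rw [Finset.sum_insert hi, Finset.sum_insert hi, dLeft_add _ _ hv, dLeft_smul _ _ hv, ih]

/-- The difference quotients lie in `W`, and `W` is closed. -/
theorem dLeft_mem {W : Submodule ℂ (L2K d)} (hW : IsClosed (W : Set (L2K d)))
    (hinv : ∀ k : K d, ∀ v ∈ W, lam k v ∈ W) (hr : W ≤ LinearMap.range (coef τ)) (X : LieK d)
    {v : L2K d} (hv : v ∈ W) : dLeft X v ∈ W := by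
  have h := hasDerivAt_lam X (hr hv) 0
  rw [zero_smul, expK_zero, lam_one] at h
  have h2 := h.tendsto_slope
  refine hW.mem_of_tendsto h2 (Filter.Eventually.of_forall fun t => ?_)
  rw [slope_def_module]
  have h3 : ((((t - 0)⁻¹ : ℝ) : ℂ)) • (lam (expK (t • X)) v - lam (expK ((0 : ℝ) • X)) v) ∈ W :=
    W.smul_mem _ (W.sub_mem (hinv _ _ hv) (hinv _ _ hv))
  rwa [Complex.coe_smul] at h3

/-- Differentiating the constant `⟨λ(exp tX) v, λ(exp tX) w⟩` at `t = 0`. -/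
theorem inner_dLeft (X : LieK d) {v w : L2K d} (hv : v ∈ LinearMap.range (coef τ))
    (hw : w ∈ LinearMap.range (coef τ)) :
    inner ℂ (dLeft X v) w = -inner ℂ v (dLeft X w) := by
  have h1 := hasDerivAt_lam X hv 0
  have h2 := hasDerivAt_lam X hw 0
  have h3 := h1.inner ℂ h2
  simp only [inner_lam_lam, zero_smul, expK_zero, lam_one] at h3
  have h4 := h3.unique (hasDerivAt_const (0 : ℝ) (inner ℂ v w))
  exact eq_neg_of_add_eq_zero_right h4

theorem norm_lam_sub_self_le (X : LieK d) {v : L2K d} (hv : v ∈ LinearMap.range (coef τ)) (t : ℝ) :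
    ‖lam (expK (t • X)) v - v‖ ≤ ‖dLeft X v‖ * |t| := by
  have h := Convex.norm_image_sub_le_of_norm_hasDerivWithin_le (s := univ) (x := 0) (y := t)
    (fun r _ => (hasDerivAt_lam X hv r).hasDerivWithinAt)
    (fun r _ => (LinearIsometry.norm_map (lam (expK (r • X))) (dLeft X v)).le) convex_univ
    (mem_univ _) (mem_univ _)
  simpa [expK_zero, lam_one] using h

theorem norm_lam_sub_sub_le (X : LieK d) {v : L2K d} (hv : v ∈ LinearMap.range (coef τ)) (t : ℝ) :
    ‖lam (expK (t • X)) v - v - (t : ℂ) • dLeft X v‖ ≤ ‖dLeft X (dLeft X v)‖ * |t| ^ 2 := by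
  have hder : ∀ r : ℝ, HasDerivAt (fun r : ℝ => lam (expK (r • X)) v - (r : ℂ) • dLeft X v)
      (lam (expK (r • X)) (dLeft X v) - dLeft X v) r := by
    intro r
    have h1 : HasDerivAt (fun r : ℝ => (r : ℂ) • dLeft X v) (dLeft X v) r := by
      simpa using ((hasDerivAt_id r).ofReal_comp).smul_const (dLeft X v)
    exact (hasDerivAt_lam X hv r).sub h1
  have h := Convex.norm_image_sub_le_of_norm_hasDerivWithin_le (s := uIcc 0 t) (x := 0) (y := t)
    (C := ‖dLeft X (dLeft X v)‖ * |t|)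
    (fun r _ => (hder r).hasDerivWithinAt)
    (fun r hr => (norm_lam_sub_self_le X (dLeft_mem_range X hv) r).trans ?_) (convex_uIcc 0 t)
    left_mem_uIcc right_mem_uIcc
  · have h2 : lam (expK (t • X)) v - (t : ℂ) • dLeft X v -
        (lam (expK ((0 : ℝ) • X)) v - ((0 : ℝ) : ℂ) • dLeft X v) =
        lam (expK (t • X)) v - v - (t : ℂ) • dLeft X v := by
      rw [zero_smul, expK_zero, lam_one]
      simp
      abel
    rw [h2] at h
    refine h.trans (le_of_eq ?_)
    rw [sub_zero, Real.norm_eq_abs]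
    ring
  · have := abs_sub_left_of_mem_uIcc hr
    rw [sub_zero, sub_zero] at this
    exact mul_le_mul_of_nonneg_left this (norm_nonneg _)

end Derived

/-! ### The Casimir operator -/

section Casimir

variable {d : ℕ}

/-- The infinitesimal rotation in the plane of two coordinates. -/
def elemRot (p : Fin (d + 1) × Fin (d + 1)) : LieK d :=
  ⟨Matrix.single p.1 p.2 1 - Matrix.single p.2 p.1 1, by
    rw [mem_skewAdjointMatricesSubmodule]
    simp [Matrix.IsSkewAdjoint, Matrix.IsAdjointPair]⟩

/-- The adjoint action of `K` on its Lie algebra. -/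
def adK (k : K d) (X : LieK d) : LieK d :=
  ⟨k.1 * X.1 * (k.1)ᵀ, by
    have h : X.1ᵀ = -X.1 := by
      simpa [Matrix.IsSkewAdjoint, Matrix.IsAdjointPair] using
        (mem_skewAdjointMatricesSubmodule _ _).1 X.2
    rw [mem_skewAdjointMatricesSubmodule]
    simp [Matrix.IsSkewAdjoint, Matrix.IsAdjointPair, h, Matrix.mul_assoc]⟩

theorem expK_adK (k : K d) (X : LieK d) (t : ℝ) :
    expK (t • adK k X) = k * expK (t • X) * k⁻¹ := by
  apply Subtype.ext
  have hu : IsUnit k.1 := by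
    rw [Matrix.isUnit_iff_isUnit_det, (Matrix.mem_specialOrthogonalGroup_iff.1 k.2).2]
    exact isUnit_one
  have hinv : k.1⁻¹ = (k.1)ᵀ := Matrix.inv_eq_right_inv (orthogonal_mul k)
  change NormedSpace.exp (t • (k.1 * X.1 * (k.1)ᵀ)) = k.1 * NormedSpace.exp (t • X.1) * (k.1)ᵀ
  rw [← hinv, ← Matrix.exp_conj _ _ hu, Matrix.mul_smul, Matrix.smul_mul]

theorem adK_elemRot (k : K d) (p : Fin (d + 1) × Fin (d + 1)) :
    adK k (elemRot p) = ∑ q : Fin (d + 1) × Fin (d + 1), (k.1 q.1 p.1 * k.1 q.2 p.2) • elemRot q := by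
  apply Subtype.ext
  have h : ∀ A B : Fin (d + 1), k.1 * Matrix.single A B 1 * (k.1)ᵀ =
      ∑ q : Fin (d + 1) × Fin (d + 1), (k.1 q.1 A * k.1 q.2 B) • Matrix.single q.1 q.2 (1 : ℝ) := by
    intro A B
    conv_lhs => rw [Matrix.matrix_eq_sum_single (k.1 * Matrix.single A B 1 * (k.1)ᵀ)]
    rw [Fintype.sum_prod_type]
    refine Finset.sum_congr rfl fun i _ => Finset.sum_congr rfl fun j _ => ?_
    rw [Matrix.smul_single]
    congr 1
    rw [Matrix.mul_apply, Finset.sum_eq_single B]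
    · simp
    · intro l _ hl
      rw [Matrix.mul_single_apply_of_ne _ _ _ _ _ hl, zero_mul]
    · simp
  have h2 : ∑ q : Fin (d + 1) × Fin (d + 1), (k.1 q.1 p.1 * k.1 q.2 p.2) •
      Matrix.single q.2 q.1 (1 : ℝ) = k.1 * Matrix.single p.2 p.1 1 * (k.1)ᵀ := by
    rw [h p.2 p.1, ← (Equiv.prodComm _ _).sum_comp]
    refine Finset.sum_congr rfl fun q _ => ?_
    simp [mul_comm]
  have h3 : (∑ q : Fin (d + 1) × Fin (d + 1), (k.1 q.1 p.1 * k.1 q.2 p.2) • elemRot q : LieK d).1 =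
      ∑ q : Fin (d + 1) × Fin (d + 1), (k.1 q.1 p.1 * k.1 q.2 p.2) •
        (Matrix.single q.1 q.2 1 - Matrix.single q.2 q.1 1) := by
    rw [Submodule.coe_sum]
    rfl
  rw [h3]
  simp only [smul_sub, Finset.sum_sub_distrib]
  rw [h2, ← h p.1 p.2]
  simp [adK, elemRot, Matrix.mul_sub, Matrix.sub_mul]

variable (τ : IrredRep (K d))

theorem dMat_adK (k : K d) (X : LieK d) :
    dMat τ (adK k X) = τ.conjMat k * dMat τ X * τ.conjMat k⁻¹ := by
  ext i j
  have h1 := hasDerivAt_conjMat τ (adK k X) i j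
  simp only [expK_adK, τ.conjMat_mul] at h1
  refine h1.unique ?_
  simp only [Matrix.mul_apply]
  exact HasDerivAt.fun_sum fun l _ => (HasDerivAt.fun_sum fun l' _ =>
    (hasDerivAt_conjMat τ X l' l).const_mul _).mul_const _

/-- The Casimir operator. -/
def casimir : Matrix (Fin τ.dim) (Fin τ.dim) ℂ :=
  ∑ p : Fin (d + 1) × Fin (d + 1), dMat τ (elemRot p) * dMat τ (elemRot p)

theorem sum_mul_row (k : K d) (i j : Fin (d + 1)) :
    ∑ l, k.1 i l * k.1 j l = (1 : Matrix (Fin (d + 1)) (Fin (d + 1)) ℝ) i j := by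
  rw [← orthogonal_mul k, Matrix.mul_apply]
  rfl

/-- `Ad(k)` transforms the family `elemRot p`, indexed by all ordered pairs, by the orthogonal
matrix `k ⊗ k`, and a sum of squares is invariant under orthogonal substitutions. Using ordered
pairs avoids handling exterior squares; it only counts each rotation twice. -/
theorem sum_dMat_adK (k : K d) :
    ∑ p : Fin (d + 1) × Fin (d + 1), dMat τ (adK k (elemRot p)) * dMat τ (adK k (elemRot p)) =
      casimir τ := by
  simp only [adK_elemRot, map_sum, map_smul, Finset.sum_mul, Finset.mul_sum, smul_mul_smul_comm]
  rw [Finset.sum_comm]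
  refine (Finset.sum_congr rfl fun q _ => Finset.sum_comm).trans ?_
  refine Finset.sum_congr rfl fun q _ => ?_
  have h : ∀ q' : Fin (d + 1) × Fin (d + 1), ∑ p : Fin (d + 1) × Fin (d + 1),
      (k.1 q'.1 p.1 * k.1 q'.2 p.2 * (k.1 q.1 p.1 * k.1 q.2 p.2)) = if q' = q then 1 else 0 := by
    intro q'
    have h1 : ∀ p : Fin (d + 1) × Fin (d + 1),
        k.1 q'.1 p.1 * k.1 q'.2 p.2 * (k.1 q.1 p.1 * k.1 q.2 p.2) =
        (k.1 q'.1 p.1 * k.1 q.1 p.1) * (k.1 q'.2 p.2 * k.1 q.2 p.2) := fun p => by ring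
    simp only [h1]
    rw [Fintype.sum_prod_type]
    simp only [← Finset.mul_sum, ← Finset.sum_mul, sum_mul_row, Matrix.one_apply]
    by_cases ha : q'.1 = q.1 <;> by_cases hb : q'.2 = q.2 <;> simp [ha, hb, Prod.ext_iff]
  simp only [← Finset.sum_smul, h]
  simp

theorem exists_casimir_eq : ∃ c : ℂ, casimir τ = c • 1 := by
  refine τ.eq_smul_one_of_commute fun k => ?_
  have h := sum_dMat_adK τ k
  simp only [dMat_adK] at h
  have h1 : ∀ A : Matrix (Fin τ.dim) (Fin τ.dim) ℂ,
      τ.conjMat k * A * τ.conjMat k⁻¹ * (τ.conjMat k * A * τ.conjMat k⁻¹) =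
      τ.conjMat k * (A * A) * τ.conjMat k⁻¹ := by
    intro A
    have : τ.conjMat k⁻¹ * τ.conjMat k = 1 := by
      rw [← τ.conjMat_mul, inv_mul_cancel, τ.conjMat_one]
    calc _ = τ.conjMat k * A * (τ.conjMat k⁻¹ * τ.conjMat k) * A * τ.conjMat k⁻¹ := by
          simp only [Matrix.mul_assoc]
      _ = _ := by
          rw [this]
          simp only [Matrix.mul_assoc, Matrix.mul_one]
  simp only [h1] at h
  rw [← Finset.sum_mul, ← Finset.mul_sum] at h
  change τ.conjMat k * casimir τ * τ.conjMat k⁻¹ = casimir τ at h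
  nth_rewrite 1 [← h]
  rw [Matrix.mul_assoc, ← τ.conjMat_mul, inv_mul_cancel, τ.conjMat_one, Matrix.mul_one]

/-- By skew-adjointness the sum is `-⟨v, Σ dλ(X_p)² v⟩`, and the Casimir operator is a scalar by
Schur's lemma. -/
theorem exists_sum_norm_dLeft_sq : ∃ c : ℝ, ∀ v ∈ LinearMap.range (coef τ),
    ∑ p : Fin (d + 1) × Fin (d + 1), ‖dLeft (elemRot p) v‖ ^ 2 = c * ‖v‖ ^ 2 := by
  obtain ⟨c, hc⟩ := exists_casimir_eq τ
  refine ⟨(-c).re, fun v hv => ?_⟩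
  have h1 : ∀ p, ((‖dLeft (elemRot p) v‖ ^ 2 : ℝ) : ℂ) =
      -inner ℂ v (dLeft (elemRot p) (dLeft (elemRot p) v)) := by
    intro p
    rw [← inner_dLeft _ hv (dLeft_mem_range _ hv), inner_self_eq_norm_sq_to_K]
    norm_cast
  have h2 : ∑ p, dLeft (elemRot p) (dLeft (elemRot p) v) = c • v := by
    obtain ⟨C, rfl⟩ := hv
    simp only [dLeft_coef]
    rw [← map_sum, ← map_smul]
    congr 1
    have : ∀ p, -(-(C * dMat τ (elemRot p)) * dMat τ (elemRot p)) =
        C * (dMat τ (elemRot p) * dMat τ (elemRot p)) := by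
      intro p
      rw [Matrix.neg_mul, neg_neg, Matrix.mul_assoc]
    simp only [this]
    rw [← Finset.mul_sum]
    change C * casimir τ = _
    rw [hc]
    simp
  have h3 : ((∑ p : Fin (d + 1) × Fin (d + 1), ‖dLeft (elemRot p) v‖ ^ 2 : ℝ) : ℂ) =
      -c * (‖v‖ ^ 2 : ℝ) := by
    rw [Complex.ofReal_sum]
    simp only [h1]
    rw [Finset.sum_neg_distrib, ← inner_sum, h2, inner_smul_right, inner_self_eq_norm_sq_to_K]
    push_cast
    simp
  have h4 := congrArg Complex.re h3
  rwa [Complex.ofReal_re, Complex.re_mul_ofReal] at h4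

theorem rot_eq_sum (x : EuclideanSpace ℝ (Fin d)) :
    rot x = ∑ i, x i • elemRot (i.succ, (0 : Fin (d + 1))) := by
  apply Subtype.ext
  rw [Submodule.coe_sum]
  ext i j
  simp only [rot, LinearMap.coe_mk, AddHom.coe_mk, rotMat, Matrix.sum_apply, Submodule.coe_smul,
    elemRot, Matrix.smul_apply, Matrix.sub_apply, Matrix.vecMulVec_apply, Matrix.single_apply]
  refine Fin.cases ?_ (fun i => ?_) i <;> refine Fin.cases ?_ (fun j => ?_) j <;>
    simp [lift, e₁, Fin.succ_ne_zero, (Fin.succ_ne_zero _).symm]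

/-- The constant of the Casimir operator. -/
def casimirConst : ℝ := (exists_sum_norm_dLeft_sq τ).choose

variable {τ} in
theorem sum_norm_dLeft_sq {v : L2K d} (hv : v ∈ LinearMap.range (coef τ)) :
    ∑ p : Fin (d + 1) × Fin (d + 1), ‖dLeft (elemRot p) v‖ ^ 2 = casimirConst τ * ‖v‖ ^ 2 :=
  (exists_sum_norm_dLeft_sq τ).choose_spec v hv

-- The vectors `elemRot (i+1, 0)` are the coordinates of `rot`; Cauchy–Schwarz bounds the square by
-- `‖x‖²` times a part of the Casimir sum. The bound holds for every vector of the isotypic part, so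
-- it can be iterated.
variable {τ} in
theorem norm_dLeft_rot_sq_le (x : EuclideanSpace ℝ (Fin d)) {v : L2K d}
    (hv : v ∈ LinearMap.range (coef τ)) :
    ‖dLeft (rot x) v‖ ^ 2 ≤ casimirConst τ * ‖x‖ ^ 2 * ‖v‖ ^ 2 := by
  rw [rot_eq_sum, dLeft_sum _ _ _ hv]
  have h1 : ‖∑ i, ((x i : ℝ) : ℂ) • dLeft (elemRot (i.succ, (0 : Fin (d + 1)))) v‖ ≤
      ∑ i, |x i| * ‖dLeft (elemRot (i.succ, (0 : Fin (d + 1)))) v‖ := by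
    refine (norm_sum_le _ _).trans (le_of_eq (Finset.sum_congr rfl fun i _ => ?_))
    rw [norm_smul, Complex.norm_real, Real.norm_eq_abs]
  have h2 := Finset.sum_mul_sq_le_sq_mul_sq Finset.univ (fun i => |x i|)
    fun i => ‖dLeft (elemRot (i.succ, (0 : Fin (d + 1)))) v‖
  have h3 : ∑ i : Fin d, ‖dLeft (elemRot (i.succ, (0 : Fin (d + 1)))) v‖ ^ 2 ≤
      casimirConst τ * ‖v‖ ^ 2 := by
    rw [← sum_norm_dLeft_sq hv, Fintype.sum_prod_type, Fin.sum_univ_succ]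
    have h4 : ∀ i : Fin d, ‖dLeft (elemRot (i.succ, (0 : Fin (d + 1)))) v‖ ^ 2 ≤
        ∑ j, ‖dLeft (elemRot (i.succ, j)) v‖ ^ 2 := fun i =>
      Finset.single_le_sum (f := fun j => ‖dLeft (elemRot (i.succ, j)) v‖ ^ 2)
        (fun j _ => sq_nonneg _) (Finset.mem_univ 0)
    have h5 : 0 ≤ ∑ j, ‖dLeft (elemRot ((0 : Fin (d + 1)), j)) v‖ ^ 2 :=
      Finset.sum_nonneg fun j _ => sq_nonneg _
    have h6 := Finset.sum_le_sum fun i (_ : i ∈ Finset.univ) => h4 i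
    linarith
  have h7 : ∑ i, |x i| ^ 2 = ‖x‖ ^ 2 := by
    rw [EuclideanSpace.norm_sq_eq]
    simp
  rw [h7] at h2
  calc _ ≤ (∑ i, |x i| * ‖dLeft (elemRot (i.succ, (0 : Fin (d + 1)))) v‖) ^ 2 := by gcongr
    _ ≤ _ := h2
    _ ≤ ‖x‖ ^ 2 * (casimirConst τ * ‖v‖ ^ 2) := by gcongr
    _ = _ := by ring

/-- Expanding the elementary rotations in the given basis bounds the Casimir sum by first
derivatives of `v` along the `X j`. The constant depends on the basis alone, not on `τ`. -/
theorem exists_casimirConst_le {ι : Type*} [Fintype ι] (X : Module.Basis ι ℝ (LieK d)) :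
    ∃ C : ℝ, 0 ≤ C ∧ ∀ (τ : IrredRep (K d)), ∀ v ∈ LinearMap.range (coef τ),
      (1 + casimirConst τ) * ‖v‖ ^ 2 ≤ (C * sobolev X v) ^ 2 := by
  refine ⟨√(1 + ∑ p : Fin (d + 1) × Fin (d + 1), ∑ j, X.repr (elemRot p) j ^ 2), Real.sqrt_nonneg _,
    fun τ v hv => ?_⟩
  have hS : 0 ≤ ∑ j, ‖dLeft (X j) v‖ ^ 2 := Finset.sum_nonneg fun j _ => sq_nonneg _
  have hP : 0 ≤ ∑ p : Fin (d + 1) × Fin (d + 1), ∑ j, X.repr (elemRot p) j ^ 2 :=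
    Finset.sum_nonneg fun p _ => Finset.sum_nonneg fun j _ => sq_nonneg _
  have h0 : ∀ p, ‖dLeft (elemRot p) v‖ ^ 2 ≤
      (∑ j, X.repr (elemRot p) j ^ 2) * ∑ j, ‖dLeft (X j) v‖ ^ 2 := by
    intro p
    conv_lhs => rw [← X.sum_repr (elemRot p), dLeft_sum _ _ _ hv]
    have h1 : ‖∑ j, ((X.repr (elemRot p) j : ℝ) : ℂ) • dLeft (X j) v‖ ≤
        ∑ j, |X.repr (elemRot p) j| * ‖dLeft (X j) v‖ := by
      refine (norm_sum_le _ _).trans (le_of_eq (Finset.sum_congr rfl fun i _ => ?_))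
      rw [norm_smul, Complex.norm_real, Real.norm_eq_abs]
    have h2 := Finset.sum_mul_sq_le_sq_mul_sq Finset.univ (fun j => |X.repr (elemRot p) j|)
      fun j => ‖dLeft (X j) v‖
    simp only [sq_abs] at h2
    exact (by gcongr : _ ≤ (∑ j, |X.repr (elemRot p) j| * ‖dLeft (X j) v‖) ^ 2).trans h2
  rw [mul_pow, sobolev, Real.sq_sqrt (by positivity), Real.sq_sqrt (by positivity), add_mul,
    ← sum_norm_dLeft_sq hv, one_mul]
  calc _ ≤ ‖v‖ ^ 2 + ∑ p : Fin (d + 1) × Fin (d + 1),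
        (∑ j, X.repr (elemRot p) j ^ 2) * ∑ j, ‖dLeft (X j) v‖ ^ 2 := by
        gcongr with p
        exact h0 p
    _ = ‖v‖ ^ 2 + (∑ p : Fin (d + 1) × Fin (d + 1), ∑ j, X.repr (elemRot p) j ^ 2) *
        ∑ j, ‖dLeft (X j) v‖ ^ 2 := by rw [Finset.sum_mul]
    _ ≤ _ := by nlinarith [mul_nonneg hP (sq_nonneg ‖v‖)]

end Casimir

/-! ### `K`-types -/

section KType

variable {d : ℕ} {V : Submodule ℂ (L2K d)} {τ : IrredRep (K d)}

theorem mem_kType {v : L2K d} : v ∈ kType V τ ↔ v ∈ V ∧ projK τ v = v := by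
  refine ⟨fun h => ?_, fun h => Submodule.subset_span h⟩
  have hle : kType V τ ≤ V ⊓ LinearMap.ker ((projCLM τ : L2K d →ₗ[ℂ] L2K d) - LinearMap.id) := by
    refine Submodule.span_le.2 fun w hw => ⟨hw.1, ?_⟩
    rw [SetLike.mem_coe, LinearMap.mem_ker]
    exact sub_eq_zero.2 hw.2
  obtain ⟨h1, h2⟩ := hle h
  exact ⟨h1, sub_eq_zero.1 h2⟩

theorem kType_le_range : kType V τ ≤ LinearMap.range (coef τ) := fun v hv => by
  rw [← (mem_kType.1 hv).2]
  exact projK_mem τ v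

instance : FiniteDimensional ℂ (kType V τ) :=
  Submodule.finiteDimensional_of_le kType_le_range

theorem lam_mem_kType (hV : ∀ k : K d, ∀ v ∈ V, lam k v ∈ V) (k : K d) {v : L2K d}
    (hv : v ∈ kType V τ) : lam k v ∈ kType V τ := by
  rw [mem_kType] at hv ⊢
  exact ⟨hV k v hv.1, by rw [projK_lam, hv.2]⟩

theorem exists_eq_ofCont {v : L2K d} (hv : v ∈ LinearMap.range (coef τ)) : ∃ f, v = ofCont f := by
  obtain ⟨C, rfl⟩ := hv
  exact ⟨_, coef_apply τ C⟩

theorem evalAt_lam {v : L2K d} (hv : v ∈ LinearMap.range (coef τ)) (k x : K d) :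
    evalAt (lam k v) x = evalAt v (k⁻¹ * x) := by
  obtain ⟨f, rfl⟩ := exists_eq_ofCont hv
  rw [lam_ofCont, evalAt_ofCont, evalAt_ofCont]
  rfl

/-- The evaluation at a point, as a linear functional on a `K`-type. -/
def evalKType (V : Submodule ℂ (L2K d)) (τ : IrredRep (K d)) (k : K d) : kType V τ →ₗ[ℂ] ℂ where
  toFun v := evalAt (v : L2K d) k
  map_add' v w := by
    obtain ⟨f, hf⟩ := exists_eq_ofCont (kType_le_range v.2)
    obtain ⟨g, hg⟩ := exists_eq_ofCont (kType_le_range w.2)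
    rw [Submodule.coe_add, hf, hg, ← map_add, evalAt_ofCont, evalAt_ofCont, evalAt_ofCont]
    rfl
  map_smul' c v := by
    obtain ⟨f, hf⟩ := exists_eq_ofCont (kType_le_range v.2)
    rw [Submodule.coe_smul, hf, ← map_smul, evalAt_ofCont, evalAt_ofCont]
    rfl

theorem chiVec_eq : chiVec V τ =
    ∑ i, conj (evalAt (stdOrthonormalBasis ℂ (kType V τ) i : L2K d) 1) •
      (stdOrthonormalBasis ℂ (kType V τ) i : L2K d) := by
  rw [chiVec, dif_pos]

/-- `χ_τ` is the Riesz representative of evaluation at `e`; its translates represent evaluation at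
the other points. -/
theorem inner_chiVec {v : L2K d} (hv : v ∈ kType V τ) :
    inner ℂ (chiVec V τ) v = evalAt v 1 := by
  set b := stdOrthonormalBasis ℂ (kType V τ) with hb
  have h1 : evalAt v 1 = evalKType V τ 1 ⟨v, hv⟩ := rfl
  rw [h1, ← b.sum_repr' ⟨v, hv⟩, map_sum, chiVec_eq, sum_inner]
  refine Finset.sum_congr rfl fun i _ => ?_
  rw [inner_smul_left, map_smul, smul_eq_mul, mul_comm, Complex.conj_conj]
  rfl

theorem evalAt_eq_inner (hV : ∀ k : K d, ∀ v ∈ V, lam k v ∈ V) {v : L2K d} (hv : v ∈ kType V τ)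
    (k : K d) : evalAt v k = inner ℂ (lam k (chiVec V τ)) v := by
  rw [inner_lam_left, inner_chiVec (lam_mem_kType hV _ hv), evalAt_lam (kType_le_range hv), inv_inv,
    mul_one]

theorem innerK_eq (u v : L2K d) : innerK u v = inner ℂ v u := by
  rw [L2.inner_def]
  rfl

theorem continuous_lam_coe (v : L2K d) : Continuous fun m : M d => lam (m : K d) v :=
  (continuous_lam_apply v).comp continuous_subtype_val

/-- The operator `T` extended to all of `L²(K)`. -/
def TOp (V : Submodule ℂ (L2K d)) (τ₁ τ₂ : IrredRep (K d)) : L2K d →L[ℂ] L2K d :=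
  LinearMap.mkContinuous
    { toFun := fun w => ∫ m : M d, inner ℂ (lam (m : K d) (chiVec V τ₁)) w •
        lam (m : K d) (chiVec V τ₂) ∂haarProb (M d)
      map_add' := fun v w => by
        have h1 := continuous_lam_coe (chiVec V τ₁)
        have h2 := continuous_lam_coe (chiVec V τ₂)
        simp only [inner_add_right, add_smul]
        exact integral_add
          (integrable_of_continuous ((h1.inner (𝕜 := ℂ) continuous_const).smul h2))
          (integrable_of_continuous ((h1.inner (𝕜 := ℂ) continuous_const).smul h2))
      map_smul' := fun c v => by
        simp only [inner_smul_right, RingHom.id_apply, mul_smul]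
        rw [← integral_smul] }
    (‖chiVec V τ₁‖ * ‖chiVec V τ₂‖) (fun v => by
      simp only [LinearMap.coe_mk, AddHom.coe_mk]
      have h : ∀ m : M d, ‖inner ℂ (lam (m : K d) (chiVec V τ₁)) v •
          lam (m : K d) (chiVec V τ₂)‖ ≤ ‖chiVec V τ₁‖ * ‖chiVec V τ₂‖ * ‖v‖ := by
        intro m
        rw [norm_smul, LinearIsometry.norm_map]
        have := norm_inner_le_norm (𝕜 := ℂ) (lam (m : K d) (chiVec V τ₁)) v
        rw [LinearIsometry.norm_map] at this
        calc _ ≤ ‖chiVec V τ₁‖ * ‖v‖ * ‖chiVec V τ₂‖ := by gcongr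
          _ = _ := by ring
      have h2 := norm_integral_le_of_norm_le_const (μ := haarProb (M d))
        (Filter.Eventually.of_forall h)
      simpa using h2)

theorem T_eq (hV : ∀ k : K d, ∀ v ∈ V, lam k v ∈ V) (s : ℝ) (τ₁ τ₂ : IrredRep (K d)) {w : L2K d}
    (hw : w ∈ kType V τ₁) : T s V τ₂ w = TOp V τ₁ τ₂ w := by
  simp only [T, U_embK, evalAt_eq_inner hV hw]
  rfl

theorem norm_TOp_le (hV : ∀ k : K d, ∀ v ∈ V, lam k v ∈ V) (s : ℝ) (τ₁ τ₂ : IrredRep (K d))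
    {w : L2K d} (hw : w ∈ kType V τ₁) : ‖TOp V τ₁ τ₂ w‖ ≤ normT s V τ₁ τ₂ * ‖w‖ := by
  rcases eq_or_ne w 0 with rfl | h0
  · simp
  have hpos : 0 < ‖w‖ := norm_pos_iff.2 h0
  rw [← div_le_iff₀ hpos]
  refine le_csInf ⟨‖TOp V τ₁ τ₂‖, norm_nonneg _, fun v hv => ?_⟩ fun c hc => ?_
  · rw [T_eq hV s τ₁ τ₂ hv]
    exact (TOp V τ₁ τ₂).le_opNorm v
  · rw [div_le_iff₀ hpos, ← T_eq hV s τ₁ τ₂ hw]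
    exact hc.2 w hw

theorem normT_nonneg (s : ℝ) (V : Submodule ℂ (L2K d)) (τ₁ τ₂ : IrredRep (K d)) :
    0 ≤ normT s V τ₁ τ₂ := Real.sInf_nonneg fun _ hc => hc.1

/-- Pairing the definition of `T` with `v` replaces the translates of `χ_τ₂` by values of `v`. This
is how the inner integral over `M` in cell coordinates is expressed by `T`. -/
theorem inner_TOp (hV : ∀ k : K d, ∀ v ∈ V, lam k v ∈ V) (τ₁ τ₂ : IrredRep (K d)) {v w : L2K d}
    (hw : w ∈ kType V τ₁) (hv : v ∈ kType V τ₂) :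
    inner ℂ v (TOp V τ₁ τ₂ w) =
      ∫ m : M d, evalAt w (m : K d) * conj (evalAt v (m : K d)) ∂haarProb (M d) := by
  have h1 := continuous_lam_coe (chiVec V τ₁)
  have h2 := continuous_lam_coe (chiVec V τ₂)
  have hi := integrable_of_continuous (H := M d)
    ((h1.inner (𝕜 := ℂ) (continuous_const (y := w))).smul h2)
  have h3 := ((innerSL ℂ v).integral_comp_comm hi).symm
  refine h3.trans ?_
  refine integral_congr_ae (Filter.Eventually.of_forall fun m => ?_)
  change inner ℂ v (inner ℂ (lam (m : K d) (chiVec V τ₁)) w • lam (m : K d) (chiVec V τ₂)) = _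
  simp only [inner_smul_right, evalAt_eq_inner hV hw, evalAt_eq_inner hV hv, inner_conj_symm]

end KType

/-! ### Matrix coefficients -/

section Coefficient

variable {d : ℕ}

theorem measurable_entry (i j : Fin (d + 1)) : Measurable fun k : K d => k.1 i j :=
  Continuous.measurable ((continuous_subtype_val).matrix_elem i j)

theorem measurable_cell : Measurable (cell (d := d)) := by
  refine (WithLp.measurable_toLp 2 (Fin d → ℝ)).comp (measurable_pi_iff.2 fun i => ?_)
  exact ((measurable_entry 0 0).const_add 1).inv.mul (measurable_entry _ _)

/-- The action of `a_{-t}` on `K = G / AN`. -/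
def flow (t : ℝ) (k : K d) : K d := kap (Real.exp t • cell k) * ((kap (cell k))⁻¹ * k)

/-- The height of `a_{-t} k`, as a function of the coordinate of `k`. -/
def flowHeight (t : ℝ) (x : EuclideanSpace ℝ (Fin d)) : ℝ :=
  Real.log ((1 + Real.exp t ^ 2 * ‖x‖ ^ 2) / (Real.exp t * (1 + ‖x‖ ^ 2)))

theorem measurable_flow (t : ℝ) : Measurable (flow (d := d) t) := by
  have h1 := (continuous_kap (d := d)).measurable
  have h2 := measurable_cell (d := d)
  have h3 : Measurable fun k : K d => Real.exp t • cell k := by fun_prop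
  exact (h1.comp h3).mul ((h1.comp h2).inv.mul measurable_id)

theorem measurable_flowHeight (t : ℝ) : Measurable (flowHeight (d := d) t) := by
  unfold flowHeight
  fun_prop

theorem flow_kap_mul (t : ℝ) (x : EuclideanSpace ℝ (Fin d)) {m : K d} (hm : m ∈ M d) :
    flow t (kap x * m) = kap (Real.exp t • x) * m := by
  rw [flow, cell_kap_mul x hm, inv_mul_cancel_left]

theorem ae_entry_ne (hd : 1 ≤ d) : ∀ᵐ k ∂haarProb (K d), k.1 0 0 ≠ -1 := by
  refine (ae_haarProb_iff hd ?_).2 (Filter.Eventually.of_forall fun z h => ?_)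
  · exact (measurableSet_eq_fun (measurable_entry 0 0) measurable_const).compl
  · have h1 := one_add_kap_mul z.1 z.2.2
    have h2 : (0 : ℝ) < 2 * (1 + ‖z.1‖ ^ 2)⁻¹ := by positivity
    have h3 : (cellMap z).1 0 0 = (kap z.1 * z.2 : K d).1 0 0 := rfl
    rw [h3] at h
    linarith

theorem kappa_a_inv_mul (t : ℝ) {k : K d} (hk : k.1 0 0 ≠ -1) :
    kappa ((a d t)⁻¹ * embK k) = flow t k := by
  have h := kappa_a_inv t (cell k) (kap_cell_inv_mul_mem k hk)
  rwa [mul_inv_cancel_left] at h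

theorem height_a_inv_mul (t : ℝ) {k : K d} (hk : k.1 0 0 ≠ -1) :
    height ((a d t)⁻¹ * embK k) = flowHeight t (cell k) := by
  have h := height_a_inv t (cell k) (kap_cell_inv_mul_mem k hk)
  rwa [mul_inv_cancel_left] at h

theorem quasiMeasurePreserving_smul {c : ℝ} (hc : c ≠ 0) :
    Measure.QuasiMeasurePreserving
      (fun z : EuclideanSpace ℝ (Fin d) × M d => (c • z.1, z.2))
      ((volume : Measure (EuclideanSpace ℝ (Fin d))).prod (haarProb (M d)))
      ((volume : Measure (EuclideanSpace ℝ (Fin d))).prod (haarProb (M d))) := by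
  have h1 : Measure.QuasiMeasurePreserving (fun x : EuclideanSpace ℝ (Fin d) => c • x)
      volume volume := by
    refine ⟨measurable_const_smul c, ?_⟩
    rw [Measure.map_addHaar_smul _ hc]
    exact Measure.smul_absolutelyContinuous
  refine ⟨(measurable_fst.const_smul c).prodMk measurable_snd, ?_⟩
  have h2 := Measure.map_prod_map (volume : Measure (EuclideanSpace ℝ (Fin d))) (haarProb (M d))
    h1.measurable measurable_id
  rw [Measure.map_id] at h2
  exact h2.symm.absolutelyContinuous.trans
    (h1.absolutelyContinuous.prod Measure.AbsolutelyContinuous.rfl)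

/-- In cell coordinates the flow is a dilation, so it pulls null sets back to null sets. This is
needed because `U` acts on a representative of an `L²` class. -/
theorem ae_flow (hd : 1 ≤ d) (t : ℝ) {p : K d → Prop} (hp : MeasurableSet {k | p k})
    (h : ∀ᵐ k ∂haarProb (K d), p k) : ∀ᵐ k ∂haarProb (K d), p (flow t k) := by
  refine (ae_haarProb_iff hd (measurable_flow t hp)).2 ?_
  have h1 := (ae_haarProb_iff hd hp).1 h
  filter_upwards [(quasiMeasurePreserving_smul (Real.exp_pos t).ne').ae h1] with z hz
  rw [cellMap, flow_kap_mul t _ z.2.2]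
  exact hz

theorem neg_le_flowHeight {t : ℝ} (ht : 0 ≤ t) (x : EuclideanSpace ℝ (Fin d)) :
    -t ≤ flowHeight t x := by
  rw [flowHeight, Real.le_log_iff_exp_le (by positivity), le_div_iff₀ (by positivity),
    ← mul_assoc, ← Real.exp_add, neg_add_cancel, Real.exp_zero, one_mul]
  have : 1 ≤ Real.exp t ^ 2 := one_le_pow₀ (Real.one_le_exp ht)
  nlinarith [sq_nonneg ‖x‖]

theorem measurable_U_a_aux (s t : ℝ) (f : C(K d, ℂ)) : Measurable fun k : K d =>
    (Real.exp (-s * flowHeight t (cell k)) : ℂ) * f (flow t k) := by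
  refine Measurable.mul ?_ (f.continuous.measurable.comp (measurable_flow t))
  have := (measurable_flowHeight (d := d) t).comp measurable_cell
  exact Complex.measurable_ofReal.comp (this.const_mul (-s)).exp

theorem norm_U_a_aux_le {s t : ℝ} (hs : 0 ≤ s) (ht : 0 ≤ t) (f : C(K d, ℂ)) (k : K d) :
    ‖(Real.exp (-s * flowHeight t (cell k)) : ℂ) * f (flow t k)‖ ≤ Real.exp (s * t) * ‖f‖ := by
  rw [norm_mul, Complex.norm_real, Real.norm_eq_abs, Real.abs_exp]
  refine mul_le_mul (Real.exp_le_exp.2 ?_) (f.norm_coe_le_norm _) (norm_nonneg _)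
    (Real.exp_nonneg _)
  nlinarith [neg_le_flowHeight ht (cell k)]

theorem memLp_U_a_aux {s t : ℝ} (hs : 0 ≤ s) (ht : 0 ≤ t) (f : C(K d, ℂ)) :
    MemLp (fun k : K d => (Real.exp (-s * flowHeight t (cell k)) : ℂ) * f (flow t k)) 2
      (haarProb (K d)) :=
  MemLp.of_bound (measurable_U_a_aux s t f).aestronglyMeasurable (Real.exp (s * t) * ‖f‖)
    (Filter.Eventually.of_forall (norm_U_a_aux_le hs ht f))

theorem ae_ofCont_flow (hd : 1 ≤ d) (t : ℝ) (f : C(K d, ℂ)) :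
    ∀ᵐ k ∂haarProb (K d), ofCont f (flow t k) = f (flow t k) :=
  ae_flow hd t (p := fun k => ofCont f k = f k)
    (measurableSet_eq_fun (Lp.stronglyMeasurable _).measurable f.continuous.measurable)
    (coeFn_ofCont f)

theorem coeFn_U_a (hd : 1 ≤ d) {s t : ℝ} (hs : 0 ≤ s) (ht : 0 ≤ t) (f : C(K d, ℂ)) :
    U s (a d t) (ofCont f) =ᵐ[haarProb (K d)]
      fun k => (Real.exp (-s * flowHeight t (cell k)) : ℂ) * f (flow t k) := by
  have hm := memLp_U_a_aux hs ht f
  have h2 : U s (a d t) (ofCont f) = hm.toLp := by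
    refine onL2_eq (hm.coeFn_toLp.trans ?_)
    filter_upwards [ae_ofCont_flow hd t f, ae_entry_ne hd] with k hk hk'
    rw [kappa_a_inv_mul t hk', height_a_inv_mul t hk', hk]
  rw [h2]
  exact hm.coeFn_toLp

theorem innerK_U_a_ofCont (hd : 1 ≤ d) {s t : ℝ} (hs : 0 ≤ s) (ht : 0 ≤ t) (f g : C(K d, ℂ)) :
    innerK (U s (a d t) (ofCont f)) (ofCont g) =
      cellConst d • ∫ x : EuclideanSpace ℝ (Fin d), weight x •
        ∫ m : M d, (Real.exp (-s * flowHeight t x) : ℂ) * f (kap (Real.exp t • x) * m) *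
          conj (g (kap x * m)) ∂haarProb (M d) := by
  have h1 : innerK (U s (a d t) (ofCont f)) (ofCont g) =
      ∫ k, (Real.exp (-s * flowHeight t (cell k)) : ℂ) * f (flow t k) * conj (g k)
        ∂haarProb (K d) := by
    refine integral_congr_ae ?_
    filter_upwards [coeFn_U_a hd hs ht f, coeFn_ofCont g] with k h1 h2
    rw [h1, h2]
  have hi : Integrable (fun k : K d => (Real.exp (-s * flowHeight t (cell k)) : ℂ) *
      f (flow t k) * conj (g k)) (haarProb (K d)) := by
    refine Integrable.of_bound ((measurable_U_a_aux s t f).mul ?_).aestronglyMeasurable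
      (Real.exp (s * t) * ‖f‖ * ‖g‖) (Filter.Eventually.of_forall fun k => ?_)
    · exact (Complex.continuous_conj.comp g.continuous).measurable
    · rw [norm_mul]
      refine mul_le_mul (norm_U_a_aux_le hs ht f k) ?_ (norm_nonneg _) (by positivity)
      rw [RCLike.norm_conj]
      exact g.norm_coe_le_norm _
  rw [h1, integral_haarProb hd hi]
  congr 2
  ext1 x
  congr 2
  ext1 m
  rw [cell_kap_mul x m.2, flow_kap_mul t x m.2]

variable {V : Submodule ℂ (L2K d)} {τ₁ τ₂ : IrredRep (K d)}

/-- The sesquilinear form of `T` on translates of `u` and `v`. -/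
def pairing (V : Submodule ℂ (L2K d)) (τ₁ τ₂ : IrredRep (K d)) (u v : L2K d)
    (x y : EuclideanSpace ℝ (Fin d)) : ℂ :=
  inner ℂ (lam (kap y)⁻¹ v) (TOp V τ₁ τ₂ (lam (kap x)⁻¹ u))

/-- The Haar density and the Iwasawa factor share powers of `1+‖x‖²`. The prefactor `e^{st}` becomes
`e^{(s-d)t}` once the dilation `y = e^t x` contributes `e^{-dt}`. -/
theorem weight_mul_exp_flowHeight (s t : ℝ) (x : EuclideanSpace ℝ (Fin d)) :
    weight x * Real.exp (-s * flowHeight t x) = Real.exp (s * t) *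
      ((1 + ‖Real.exp t • x‖ ^ 2) ^ (-s) * (1 + ‖x‖ ^ 2) ^ (s - d)) := by
  have h1 : (0 : ℝ) < 1 + ‖x‖ ^ 2 := by positivity
  have h2 : (0 : ℝ) < 1 + Real.exp t ^ 2 * ‖x‖ ^ 2 := by positivity
  rw [weight_eq_rpow, norm_smul, Real.norm_eq_abs, Real.abs_exp, mul_pow, flowHeight,
    Real.log_div h2.ne' (by positivity), Real.log_mul (Real.exp_pos t).ne' h1.ne', Real.log_exp,
    Real.rpow_def_of_pos h1, Real.rpow_def_of_pos h2, Real.rpow_def_of_pos h1, ← Real.exp_add,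
    ← Real.exp_add, ← Real.exp_add]
  congr 1
  ring

theorem innerK_U_a (hd : 1 ≤ d) (hV : ∀ k : K d, ∀ v ∈ V, lam k v ∈ V) {s t : ℝ} (hs : 0 ≤ s)
    (ht : 0 ≤ t) {u v : L2K d} (hu : u ∈ kType V τ₁) (hv : v ∈ kType V τ₂) :
    innerK (U s (a d t) u) v = Real.exp ((s - d) * t) * (cellConst d *
      ∫ y : EuclideanSpace ℝ (Fin d), (((1 + ‖y‖ ^ 2) ^ (-s) *
        (1 + ‖Real.exp (-t) • y‖ ^ 2) ^ (s - d) : ℝ) : ℂ) *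
          pairing V τ₁ τ₂ u v y (Real.exp (-t) • y)) := by
  obtain ⟨f, hf⟩ := exists_eq_ofCont (kType_le_range hu)
  obtain ⟨g, hg⟩ := exists_eq_ofCont (kType_le_range hv)
  have hP : ∀ x : EuclideanSpace ℝ (Fin d),
      ∫ m : M d, f (kap (Real.exp t • x) * m) * conj (g (kap x * m)) ∂haarProb (M d) =
        pairing V τ₁ τ₂ u v (Real.exp t • x) x := by
    intro x
    rw [pairing, inner_TOp hV τ₁ τ₂ (lam_mem_kType hV _ hu) (lam_mem_kType hV _ hv)]
    refine integral_congr_ae (Filter.Eventually.of_forall fun m => ?_)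
    simp only [evalAt_lam (kType_le_range hu), evalAt_lam (kType_le_range hv), inv_inv]
    rw [hf, hg, evalAt_ofCont, evalAt_ofCont]
  set F : EuclideanSpace ℝ (Fin d) → ℂ := fun y => (((1 + ‖y‖ ^ 2) ^ (-s) *
        (1 + ‖Real.exp (-t) • y‖ ^ 2) ^ (s - d) : ℝ) : ℂ) *
          pairing V τ₁ τ₂ u v y (Real.exp (-t) • y) with hF
  have h1 : innerK (U s (a d t) u) v = cellConst d • ∫ x : EuclideanSpace ℝ (Fin d),
      (Real.exp (s * t) : ℂ) * F (Real.exp t • x) := by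
    rw [hf, hg, innerK_U_a_ofCont hd hs ht]
    congr 2
    ext1 x
    have h2 : ∀ m : M d, (Real.exp (-s * flowHeight t x) : ℂ) * f (kap (Real.exp t • x) * m) *
        conj (g (kap x * m)) = (Real.exp (-s * flowHeight t x) : ℂ) *
          (f (kap (Real.exp t • x) * m) * conj (g (kap x * m))) := fun m => mul_assoc _ _ _
    simp only [h2]
    have h3 : Real.exp (-t) • Real.exp t • x = x := by
      rw [smul_smul, ← Real.exp_add, neg_add_cancel, Real.exp_zero, one_smul]
    rw [integral_const_mul, hP, hF]
    simp only [h3]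
    rw [Complex.real_smul, ← mul_assoc, ← mul_assoc, ← Complex.ofReal_mul, ← Complex.ofReal_mul,
      weight_mul_exp_flowHeight]
  have h4 : (Real.exp ((s - d) * t) : ℝ) = Real.exp (s * t) * ((Real.exp t) ^ d)⁻¹ := by
    rw [← Real.exp_nat_mul, ← Real.exp_neg, ← Real.exp_add]
    ring_nf
  rw [h1, integral_const_mul, Measure.integral_comp_smul, finrank_euclideanSpace_fin, h4,
    abs_of_pos (by positivity), Complex.real_smul, Complex.real_smul]
  push_cast
  ring

theorem integral_mem_of_closed {E α : Type*} [NormedAddCommGroup E] [InnerProductSpace ℂ E]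
    [CompleteSpace E] [MeasurableSpace α] {μ : Measure α} (W : Submodule ℂ E)
    [FiniteDimensional ℂ W] {F : α → E} (hF : Integrable F μ) (h : ∀ x, F x ∈ W) :
    ∫ x, F x ∂μ ∈ W := by
  have h1 := W.starProjection.integral_comp_comm hF
  have h2 : ∀ x, W.starProjection (F x) = F x := fun x =>
    Submodule.starProjection_eq_self_iff.2 (h x)
  simp only [h2] at h1
  rw [h1]
  exact Submodule.starProjection_apply_mem _ _

theorem real_smul_eq (r : ℝ) (w : L2K d) : r • w = (r : ℂ) • w := by
  refine Lp.ext ((Lp.coeFn_smul _ _).trans (Filter.EventuallyEq.trans ?_ (Lp.coeFn_smul _ _).symm))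
  exact Filter.Eventually.of_forall fun k => (Complex.coe_smul r (w k)).symm

theorem integrable_rpow_smul_lam {s : ℝ} (hs : (d : ℝ) / 2 < s) (u : L2K d) :
    Integrable fun x : EuclideanSpace ℝ (Fin d) => (1 + ‖x‖ ^ 2) ^ (-s) • lam (kap x)⁻¹ u := by
  refine (integrable_one_add_norm_sq hs).smul_bdd (C := ‖u‖) ?_ ?_
  · have h1 : Continuous fun x : EuclideanSpace ℝ (Fin d) => (kap x)⁻¹ := continuous_kap.inv
    exact ((continuous_lam_apply u).comp h1).aestronglyMeasurable
  · exact Filter.Eventually.of_forall fun x => by rw [LinearIsometry.norm_map]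

/-- Here `H(n̄_x) = log(1+‖x‖²)` and the normalization of `dn̄` is the same constant as that of Haar
measure on the big cell. So this is the integral of `innerK_U_a` with `e^{-t} y` replaced by `0`. -/
theorem innerK_T_Cplus (hV : ∀ k : K d, ∀ v ∈ V, lam k v ∈ V) {s : ℝ}
    (hs : (d : ℝ) / 2 < s) {u v : L2K d} (hu : u ∈ kType V τ₁) :
    innerK (T s V τ₂ (Cplus s u)) v = cellConst d *
      ∫ x : EuclideanSpace ℝ (Fin d), (((1 + ‖x‖ ^ 2) ^ (-s) : ℝ) : ℂ) *
        inner ℂ v (TOp V τ₁ τ₂ (lam (kap x)⁻¹ u)) := by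
  have hw : ∀ (r : ℝ) (x : EuclideanSpace ℝ (Fin d)), Real.exp (-r * height (nbar x)) =
      (1 + ‖x‖ ^ 2) ^ (-r) := by
    intro r x
    rw [height_nbar, Real.rpow_def_of_pos (by positivity), mul_comm]
  have hi := integrable_rpow_smul_lam hs u
  have h1 : Cplus s u = cellConst d • ∫ x : EuclideanSpace ℝ (Fin d),
      (1 + ‖x‖ ^ 2) ^ (-s) • lam (kap x)⁻¹ u := by
    simp only [Cplus, hw, kappa_nbar, U_embK, cellConst, weight_eq_rpow]
  -- `C₊(s)` averages translates by elements of `K`, so it preserves the `K`-type; only there does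
  -- `T`, which evaluates at points, agree with the operator `TOp`.
  have h2 : Cplus s u ∈ kType V τ₁ := by
    rw [h1, real_smul_eq]
    refine Submodule.smul_mem _ _ (integral_mem_of_closed _ hi fun x => ?_)
    rw [real_smul_eq]
    exact Submodule.smul_mem _ _ (lam_mem_kType hV _ hu)
  rw [T_eq hV s τ₁ τ₂ h2, innerK_eq, h1, real_smul_eq, map_smul, inner_smul_right]
  congr 1
  have h3 := ((innerSL ℂ v).comp (TOp V τ₁ τ₂)).integral_comp_comm hi
  refine h3.symm.trans (integral_congr_ae (Filter.Eventually.of_forall fun x => ?_))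
  change inner ℂ v (TOp V τ₁ τ₂ ((1 + ‖x‖ ^ 2) ^ (-s) • lam (kap x)⁻¹ u)) = _
  rw [real_smul_eq, map_smul, inner_smul_right]

end Coefficient

/-! ### An oscillatory integral -/

section Oscillatory

variable {d : ℕ} {s η : ℝ}

theorem one_add_sq_rpow_le (hη : (d + η) / 2 ≤ s) (h0 : 0 ≤ η) {r : ℝ} (hr : 0 < r) :
    (1 + r ^ 2) ^ (-s) ≤ r ^ (-(d + η)) := by
  calc (1 + r ^ 2) ^ (-s) ≤ (1 + r ^ 2) ^ (-((d + η) / 2)) :=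
        Real.rpow_le_rpow_of_exponent_le (by nlinarith) (by linarith)
    _ ≤ (r ^ 2) ^ (-((d + η) / 2)) :=
        Real.rpow_le_rpow_of_nonpos (by positivity) (by linarith)
          (by have : (0 : ℝ) ≤ d := d.cast_nonneg
              linarith)
    _ = r ^ (-(d + η)) := by
        rw [← Real.rpow_natCast r 2, ← Real.rpow_mul hr.le]
        congr 1
        push_cast
        ring

theorem pow_mul_one_add_sq_rpow_le (hη : (d + η) / 2 ≤ s) (h0 : 0 ≤ η) {r : ℝ} (hr : 0 < r) :
    r ^ d * (1 + r ^ 2) ^ (-s) ≤ r ^ (-η) := by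
  calc r ^ d * (1 + r ^ 2) ^ (-s) ≤ r ^ d * r ^ (-(d + η)) := by
        gcongr
        exact one_add_sq_rpow_le hη h0 hr
    _ = r ^ (-η) := by
        rw [← Real.rpow_natCast r d, ← Real.rpow_add hr]
        congr 1
        ring

theorem arctan_le_self {r : ℝ} (hr : 0 ≤ r) : Real.arctan r ≤ r := by
  have := Real.le_tan (Real.arctan_nonneg.2 hr) (Real.arctan_lt_pi_div_two r)
  rwa [Real.tan_arctan] at this

theorem abs_two_mul_arctan_sub_le {r : ℝ} (hr : 0 ≤ r) :
    |2 * Real.arctan r - 2 * r| ≤ r ^ 2 := by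
  have h1 := arctan_le_self hr
  have h2 : r / (1 + r ^ 2) ≤ Real.arctan r := by
    refine le_trans ?_ (Real.sin_le (Real.arctan_nonneg.2 hr))
    rw [Real.sin_arctan]
    gcongr
    exact Real.sqrt_le_self_iff.2 (Or.inr (by nlinarith [sq_nonneg r]))
  have h3 : r - r / (1 + r ^ 2) ≤ r ^ 2 / 2 := by
    rw [sub_le_iff_le_add, ← sub_le_iff_le_add', le_div_iff₀ (by positivity)]
    nlinarith [mul_nonneg (sq_nonneg r) (sq_nonneg (r - 1))]
  rw [abs_of_nonpos (by linarith)]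
  linarith

/-- Since `2 arctan r = π - 2 arctan(1/r)` and `n` is an integer, the sine equals that of `2n
arctan(1/r)` up to sign. -/
theorem abs_sin_two_mul_arctan_le (n : ℤ) {r : ℝ} (hr : 0 < r) :
    |Real.sin (n * (2 * Real.arctan r))| ≤ 2 * |(n : ℝ)| / r := by
  have h1 : (n : ℝ) * (2 * Real.arctan r) = n * Real.pi - n * (2 * Real.arctan r⁻¹) := by
    rw [Real.arctan_inv_of_pos hr]
    ring
  have h2 : |Real.arctan r⁻¹| ≤ r⁻¹ := by
    rw [abs_of_nonneg (Real.arctan_nonneg.2 (inv_nonneg.2 hr.le))]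
    exact arctan_le_self (inv_nonneg.2 hr.le)
  rw [h1, Real.sin_int_mul_pi_sub, abs_neg, abs_mul, abs_zpow, abs_neg, abs_one, one_zpow, one_mul]
  refine (Real.abs_sin_le_abs).trans ?_
  rw [abs_mul, abs_mul, abs_two]
  calc |(n : ℝ)| * (2 * |Real.arctan r⁻¹|) ≤ |(n : ℝ)| * (2 * r⁻¹) := by gcongr
    _ = _ := by ring

/-- The weight function of the integration by parts. -/
def ibpWeight (d : ℕ) (s r : ℝ) : ℝ := r ^ d * (1 + r ^ 2) ^ (1 - s)

/-- The derivative of `ibpWeight`. -/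
def ibpDeriv (d : ℕ) (s r : ℝ) : ℝ :=
  d * r ^ (d - 1) * (1 + r ^ 2) ^ (1 - s) +
    r ^ d * (2 * r * (1 - s) * (1 + r ^ 2) ^ (-s))

theorem hasDerivAt_ibpWeight (d : ℕ) (s r : ℝ) :
    HasDerivAt (ibpWeight d s) (ibpDeriv d s r) r := by
  have h1 : HasDerivAt (fun r : ℝ => 1 + r ^ 2) (2 * r) r := by
    simpa using ((hasDerivAt_id r).pow 2).const_add 1
  have h2 := h1.rpow_const (p := 1 - s) (Or.inl (by positivity))
  refine ((hasDerivAt_pow d r).mul h2).congr_deriv ?_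
  rw [ibpDeriv, show (1 - s - 1) = -s by ring]

theorem continuous_one_add_sq_rpow (p : ℝ) : Continuous fun r : ℝ => (1 + r ^ 2) ^ p :=
  Continuous.rpow_const (by fun_prop) fun r => Or.inl (by positivity)

theorem continuous_ibpDeriv (d : ℕ) (s : ℝ) : Continuous (ibpDeriv d s) := by
  have h1 := continuous_one_add_sq_rpow (1 - s)
  have h2 := continuous_one_add_sq_rpow (-s)
  unfold ibpDeriv
  fun_prop

theorem pow_pred_mul_le (hd : 1 ≤ d) (hη : (d + η) / 2 ≤ s) (h0 : 0 ≤ η) (h1 : η ≤ 1) (hs : 0 ≤ s)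
    {r A : ℝ} (hr : 0 < r) (hA : r ≤ A) :
    r ^ (d - 1) * (1 + r ^ 2) ^ (1 - s) ≤ 2 * max 1 (A ^ (1 - η)) := by
  have hsplit : (1 + r ^ 2) ^ (1 - s) = (1 + r ^ 2) * (1 + r ^ 2) ^ (-s) := by
    rw [sub_eq_add_neg, Real.rpow_add (by positivity), Real.rpow_one]
  rw [hsplit]
  rcases le_total r 1 with h | h
  · have h2 : r ^ (d - 1) ≤ 1 := pow_le_one₀ hr.le h
    have h3 : (1 + r ^ 2) ^ (-s) ≤ 1 :=
      Real.rpow_le_one_of_one_le_of_nonpos (by nlinarith) (by linarith)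
    calc r ^ (d - 1) * ((1 + r ^ 2) * (1 + r ^ 2) ^ (-s)) ≤ 1 * (2 * 1) := by
          gcongr
          nlinarith
      _ ≤ 2 * max 1 (A ^ (1 - η)) := by
          have := le_max_left 1 (A ^ (1 - η))
          linarith
  · have h2 : r ^ (d - 1) * r = r ^ d := by rw [← pow_succ, Nat.sub_add_cancel hd]
    calc _ ≤ r ^ (d - 1) * (2 * r ^ 2 * (1 + r ^ 2) ^ (-s)) := by
          gcongr
          nlinarith
      _ = 2 * r * (r ^ (d - 1) * r * (1 + r ^ 2) ^ (-s)) := by ring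
      _ ≤ 2 * r * r ^ (-η) := by
          rw [h2]
          gcongr
          exact pow_mul_one_add_sq_rpow_le hη h0 hr
      _ = 2 * r ^ (1 - η) := by
          rw [sub_eq_add_neg, Real.rpow_add hr, Real.rpow_one]
          ring
      _ ≤ 2 * A ^ (1 - η) := by gcongr
      _ ≤ _ := by gcongr; exact le_max_right _ _

theorem abs_ibpDeriv_le (hd : 1 ≤ d) (hη : (d + η) / 2 ≤ s) (h0 : 0 ≤ η) (h1 : η ≤ 1) (hs : 0 ≤ s)
    (hs' : s ≤ d) {r A : ℝ} (hr : 0 < r) (hA : r ≤ A) :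
    |ibpDeriv d s r| ≤ 6 * d * max 1 (A ^ (1 - η)) := by
  have hd' : (1 : ℝ) ≤ d := by exact_mod_cast hd
  have hb := pow_pred_mul_le hd hη h0 h1 hs hr hA
  have h2 : r ^ (d - 1) * r = r ^ d := by rw [← pow_succ, Nat.sub_add_cancel hd]
  have hsplit : (1 + r ^ 2) ^ (1 - s) = (1 + r ^ 2) * (1 + r ^ 2) ^ (-s) := by
    rw [sub_eq_add_neg, Real.rpow_add (by positivity), Real.rpow_one]
  have h3 : |1 - s| ≤ d := abs_le.2 ⟨by linarith, by linarith⟩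
  have hp : 0 ≤ (1 + r ^ 2) ^ (-s) := by positivity
  have h4 : r ^ (d - 1) * (r ^ 2 * (1 + r ^ 2) ^ (-s)) ≤ r ^ (d - 1) * (1 + r ^ 2) ^ (1 - s) := by
    rw [hsplit]
    gcongr
    linarith
  rw [ibpDeriv]
  calc _ ≤ |d * r ^ (d - 1) * (1 + r ^ 2) ^ (1 - s)| +
        |r ^ d * (2 * r * (1 - s) * (1 + r ^ 2) ^ (-s))| := abs_add_le _ _
    _ = d * (r ^ (d - 1) * (1 + r ^ 2) ^ (1 - s)) +
        2 * |1 - s| * (r ^ (d - 1) * (r ^ 2 * (1 + r ^ 2) ^ (-s))) := by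
        rw [abs_of_nonneg (by positivity), ← h2]
        simp only [abs_mul, abs_two, abs_of_pos hr, abs_of_nonneg hp, abs_pow]
        ring
    _ ≤ d * (2 * max 1 (A ^ (1 - η))) + 2 * d * (2 * max 1 (A ^ (1 - η))) :=
        add_le_add (mul_le_mul_of_nonneg_left hb (by positivity))
          (mul_le_mul (by gcongr) (h4.trans hb) (by positivity) (by positivity))
    _ = _ := by ring

/-- Integration by parts against `-cos(2μ arctan r)`, whose derivative carries the factor
`2μ/(1+r²)`; hence `ibpWeight` has exponent `1 - s`. The boundary term and the integral are at most
`2Am` and `6dAm`, and dividing by `2μ ≥ 2A` removes the factor `A`. -/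
theorem abs_oscillatory_le_of_le (hd : 1 ≤ d) (hη : (d + η) / 2 ≤ s) (h0 : 0 ≤ η) (h1 : η ≤ 1)
    (hs : 0 ≤ s) (hs' : s ≤ d) {μ A : ℝ} (hA : 0 < A) (hμ : A ≤ μ) :
    |∫ r in (0 : ℝ)..A, r ^ d * (1 + r ^ 2) ^ (-s) * Real.sin (μ * (2 * Real.arctan r))| ≤
      (3 * d + 1) * max 1 (A ^ (1 - η)) := by
  have hμ0 : 0 < μ := hA.trans_le hμ
  set m := max 1 (A ^ (1 - η)) with hm
  have hm1 : 1 ≤ m := le_max_left _ _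
  have hv : ∀ r : ℝ, HasDerivAt (fun r : ℝ => -Real.cos (μ * (2 * Real.arctan r)))
      (Real.sin (μ * (2 * Real.arctan r)) * (μ * (2 * (1 / (1 + r ^ 2))))) r := by
    intro r
    have h := (((Real.hasDerivAt_arctan r).const_mul 2).const_mul μ).cos.neg
    refine h.congr_deriv ?_
    ring
  have hcont : Continuous fun r : ℝ =>
      Real.sin (μ * (2 * Real.arctan r)) * (μ * (2 * (1 / (1 + r ^ 2)))) := by
    have h : Continuous fun r : ℝ => 1 / (1 + r ^ 2) :=
      continuous_const.div (by fun_prop) fun r => by positivity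
    fun_prop
  have hibp := intervalIntegral.integral_mul_deriv_eq_deriv_mul (a := 0) (b := A)
    (u := ibpWeight d s) (u' := ibpDeriv d s)
    (fun r _ => hasDerivAt_ibpWeight d s r) (fun r _ => hv r)
    ((continuous_ibpDeriv d s).intervalIntegrable _ _) (hcont.intervalIntegrable _ _)
  have hL : ∫ r in (0 : ℝ)..A, ibpWeight d s r *
      (Real.sin (μ * (2 * Real.arctan r)) * (μ * (2 * (1 / (1 + r ^ 2))))) =
      2 * μ * ∫ r in (0 : ℝ)..A, r ^ d * (1 + r ^ 2) ^ (-s) *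
        Real.sin (μ * (2 * Real.arctan r)) := by
    rw [← intervalIntegral.integral_const_mul]
    refine intervalIntegral.integral_congr fun r _ => ?_
    have h : (0 : ℝ) < 1 + r ^ 2 := by positivity
    simp only [ibpWeight]
    rw [sub_eq_add_neg, Real.rpow_add h, Real.rpow_one]
    field_simp
  have hg0 : ibpWeight d s 0 = 0 := by
    simp [ibpWeight, show d ≠ 0 by omega]
  have hgA : |ibpWeight d s A| ≤ A * (2 * m) := by
    have h := pow_pred_mul_le hd hη h0 h1 hs hA le_rfl
    rw [ibpWeight, abs_of_nonneg (by positivity)]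
    calc A ^ d * (1 + A ^ 2) ^ (1 - s) = A * (A ^ (d - 1) * (1 + A ^ 2) ^ (1 - s)) := by
          rw [← mul_assoc, ← pow_succ', Nat.sub_add_cancel hd]
      _ ≤ _ := by gcongr
  have hint : |∫ r in (0 : ℝ)..A, ibpDeriv d s r * -Real.cos (μ * (2 * Real.arctan r))| ≤
      6 * d * m * A := by
    have h := intervalIntegral.norm_integral_le_of_norm_le_const (a := 0) (b := A)
      (f := fun r => ibpDeriv d s r * -Real.cos (μ * (2 * Real.arctan r))) (C := 6 * d * m) ?_
    · rwa [sub_zero, abs_of_pos hA] at h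
    · intro r hr
      rw [uIoc_of_le hA.le] at hr
      rw [norm_mul, norm_neg, Real.norm_eq_abs, Real.norm_eq_abs]
      calc _ ≤ 6 * d * m * 1 := by
            gcongr
            · exact abs_ibpDeriv_le hd hη h0 h1 hs hs' hr.1 hr.2
            · exact Real.abs_cos_le_one _
        _ = _ := mul_one _
  rw [hL, hg0] at hibp
  have hcos : |ibpWeight d s A * -Real.cos (μ * (2 * Real.arctan A))| ≤ A * (2 * m) := by
    rw [abs_mul, abs_neg]
    calc _ ≤ A * (2 * m) * 1 := by
          gcongr
          exact Real.abs_cos_le_one _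
      _ = _ := mul_one _
  have hfin : 2 * μ * |∫ r in (0 : ℝ)..A, r ^ d * (1 + r ^ 2) ^ (-s) *
      Real.sin (μ * (2 * Real.arctan r))| ≤ 2 * μ * ((3 * d + 1) * m) := by
    rw [← abs_of_pos (show (0 : ℝ) < 2 * μ by positivity), ← abs_mul, hibp,
      abs_of_pos (show (0 : ℝ) < 2 * μ by positivity), zero_mul, sub_zero]
    calc _ ≤ A * (2 * m) + 6 * d * m * A := (abs_sub _ _).trans (add_le_add hcos hint)
      _ = 2 * A * ((3 * d + 1) * m) := by ring
      _ ≤ _ := by gcongr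
  exact le_of_mul_le_mul_left hfin (by positivity)

/-- Splitting at `r = n` balances the two mechanisms: oscillation below `n`, and `|sin| ≤ 2n/r`
above. The outcome is uniform in `n`, and its constant stays bounded as `η → 1`. -/
theorem abs_oscillatory_le (hd : 1 ≤ d) (hη : (d + η) / 2 ≤ s) (h0 : 0 < η) (h1 : η ≤ 1)
    (hs : 0 ≤ s) (hs' : s ≤ d) (n : ℤ) {R : ℝ} (hR : 0 < R) :
    |∫ r in (0 : ℝ)..R, r ^ d * (1 + r ^ 2) ^ (-s) * Real.sin (n * (2 * Real.arctan r))| ≤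
      (3 * d + 3) / η * max 1 (R ^ (1 - η)) := by
  have hm1 : 1 ≤ max 1 (R ^ (1 - η)) := le_max_left _ _
  have hdη : (3 * d + 3 : ℝ) ≤ (3 * d + 3) / η := by
    rw [le_div_iff₀ h0]
    nlinarith [(d.cast_nonneg : (0 : ℝ) ≤ d)]
  wlog hn : 0 ≤ n with H
  · have := H hd hη h0 h1 hs hs' (-n) hR hm1 hdη (by omega)
    simpa [neg_mul, Real.sin_neg, abs_neg] using this
  rcases hn.eq_or_lt with rfl | hn
  · simp
    positivity
  have hn1 : (1 : ℝ) ≤ n := by exact_mod_cast hn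
  rcases le_total R n with hRn | hRn
  · refine (abs_oscillatory_le_of_le hd hη h0.le h1 hs hs' hR hRn).trans ?_
    gcongr
    linarith
  have hcont : Continuous fun r : ℝ => r ^ d * (1 + r ^ 2) ^ (-s) *
      Real.sin (n * (2 * Real.arctan r)) := by
    have := continuous_one_add_sq_rpow (-s)
    fun_prop
  have hn0 : (0 : ℝ) < n := by linarith
  rw [← intervalIntegral.integral_add_adjacent_intervals (b := (n : ℝ))
    (hcont.intervalIntegrable _ _) (hcont.intervalIntegrable _ _)]
  have hI1 := abs_oscillatory_le_of_le hd hη h0.le h1 hs hs' hn0 (le_refl (n : ℝ))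
  have hmono : max 1 ((n : ℝ) ^ (1 - η)) ≤ max 1 (R ^ (1 - η)) :=
    max_le_max le_rfl (Real.rpow_le_rpow hn0.le hRn (by linarith))
  -- The extra factor `n/r` makes the tail integrable: `2n ∫ r^(-1-η) dr` over `r ≥ n` is `2 n^(1-η)
  -- / η`.
  have hI2 : |∫ r in (n : ℝ)..R, r ^ d * (1 + r ^ 2) ^ (-s) *
      Real.sin (n * (2 * Real.arctan r))| ≤ 2 / η * max 1 (R ^ (1 - η)) := by
    have hb : ∀ r ∈ Ioc (n : ℝ) R, ‖r ^ d * (1 + r ^ 2) ^ (-s) *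
        Real.sin (n * (2 * Real.arctan r))‖ ≤ 2 * n * r ^ (-1 - η) := by
      intro r hr
      have hr0 : 0 < r := hn0.trans hr.1
      rw [norm_mul, Real.norm_eq_abs, Real.norm_eq_abs, abs_of_nonneg (by positivity)]
      calc _ ≤ r ^ (-η) * (2 * |(n : ℝ)| / r) := by
            gcongr
            · exact pow_mul_one_add_sq_rpow_le hη h0.le hr0
            · exact abs_sin_two_mul_arctan_le n hr0
        _ = _ := by
            rw [show -1 - η = -η + -1 by ring, Real.rpow_add hr0, Real.rpow_neg_one,
              abs_of_pos hn0]
            ring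
    have hint : IntervalIntegrable (fun r : ℝ => 2 * (n : ℝ) * r ^ (-1 - η)) volume n R := by
      refine (intervalIntegral.intervalIntegrable_rpow (Or.inr ?_)).const_mul _
      rw [uIcc_of_le hRn]
      exact fun h => absurd h.1 (by linarith)
    have h2 := intervalIntegral.norm_integral_le_of_norm_le hRn
      (Filter.Eventually.of_forall hb) hint
    refine h2.trans ?_
    rw [intervalIntegral.integral_const_mul, integral_rpow (Or.inr ⟨by linarith, ?_⟩)]
    · have h3 : (n : ℝ) * (n : ℝ) ^ (-η) = (n : ℝ) ^ (1 - η) := by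
        rw [sub_eq_add_neg, Real.rpow_add hn0, Real.rpow_one]
      have h4 : 0 ≤ (n : ℝ) * R ^ (-η) := by positivity
      calc 2 * (n : ℝ) * ((R ^ (-1 - η + 1) - (n : ℝ) ^ (-1 - η + 1)) / (-1 - η + 1)) =
          2 / η * ((n : ℝ) * (n : ℝ) ^ (-η) - n * R ^ (-η)) := by
            rw [show -1 - η + 1 = -η by ring]
            field_simp
            ring
        _ ≤ 2 / η * max 1 (R ^ (1 - η)) := by
            gcongr
            rw [h3]
            exact (sub_le_self _ h4).trans ((le_max_right _ _).trans hmono)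
    · rw [uIcc_of_le hRn]
      exact fun h => absurd h.1 (by linarith)
  have hη1 : 1 ≤ 1 / η := by rw [le_div_iff₀ h0]; linarith
  calc _ ≤ (3 * d + 1) * max 1 ((n : ℝ) ^ (1 - η)) + 2 / η * max 1 (R ^ (1 - η)) :=
        (abs_add_le _ _).trans (add_le_add hI1 hI2)
    _ ≤ (3 * d + 1) * (1 / η) * max 1 (R ^ (1 - η)) + 2 / η * max 1 (R ^ (1 - η)) := by
        gcongr
        exact le_mul_of_one_le_right (by positivity) hη1
    _ = _ := by ring

end Oscillatory

/-! ### Spectral decomposition of a rotation on a `K`-type -/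

section Spectral

variable {d : ℕ} {τ : IrredRep (K d)}

theorem dLeft_add_right (X : LieK d) {v w : L2K d} (hv : v ∈ LinearMap.range (coef τ))
    (hw : w ∈ LinearMap.range (coef τ)) : dLeft X (v + w) = dLeft X v + dLeft X w := by
  obtain ⟨B, rfl⟩ := hv
  obtain ⟨C, rfl⟩ := hw
  rw [← map_add, dLeft_coef, dLeft_coef, dLeft_coef, ← map_add, Matrix.add_mul, neg_add]

theorem dLeft_smul_right (X : LieK d) (c : ℂ) {v : L2K d} (hv : v ∈ LinearMap.range (coef τ)) :
    dLeft X (c • v) = c • dLeft X v := by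
  obtain ⟨C, rfl⟩ := hv
  rw [← map_smul, dLeft_coef, dLeft_coef, ← map_smul, Matrix.smul_mul, smul_neg]

theorem expK_two_pi_smul_rot {θ : EuclideanSpace ℝ (Fin d)} (hθ : ‖θ‖ = 1) :
    expK ((2 * Real.pi) • rot θ) = 1 := by
  apply Subtype.ext
  rw [coe_expK_smul_rot hθ, Real.sin_two_pi, Real.cos_two_pi]
  simp

variable {W : Submodule ℂ (L2K d)}

/-- The self-adjoint operator `-i dλ(X)` on an invariant subspace of a `K`-type. -/
def generator (hW : IsClosed (W : Set (L2K d))) (hinv : ∀ k : K d, ∀ v ∈ W, lam k v ∈ W)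
    (hr : W ≤ LinearMap.range (coef τ)) (X : LieK d) : W →ₗ[ℂ] W where
  toFun v := ⟨-Complex.I • dLeft X (v : L2K d), W.smul_mem _ (dLeft_mem hW hinv hr X v.2)⟩
  map_add' v w := Subtype.ext (by
    simp only [Submodule.coe_add]
    rw [dLeft_add_right X (hr v.2) (hr w.2), smul_add])
  map_smul' c v := Subtype.ext (by
    simp only [Submodule.coe_smul, RingHom.id_apply]
    rw [dLeft_smul_right X c (hr v.2), smul_comm])

theorem isSymmetric_generator (hW : IsClosed (W : Set (L2K d)))
    (hinv : ∀ k : K d, ∀ v ∈ W, lam k v ∈ W) (hr : W ≤ LinearMap.range (coef τ)) (X : LieK d) :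
    (generator hW hinv hr X).IsSymmetric := fun v w => by
  change inner ℂ (-Complex.I • dLeft X (v : L2K d)) (w : L2K d) =
    inner ℂ (v : L2K d) (-Complex.I • dLeft X (w : L2K d))
  rw [inner_smul_left, inner_smul_right, inner_dLeft X (hr v.2) (hr w.2)]
  simp

theorem lam_expK_of_dLeft_eq (X : LieK d) {v : L2K d} (hv : v ∈ LinearMap.range (coef τ)) {c : ℂ}
    (h : dLeft X v = c • v) (t : ℝ) : lam (expK (t • X)) v = Complex.exp (c * t) • v := by
  have hder : ∀ r : ℝ, HasDerivAt (fun r : ℝ => Complex.exp (-(c * r)) • lam (expK (r • X)) v)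
      0 r := by
    intro r
    have h1 : HasDerivAt (fun r : ℝ => Complex.exp (-(c * r)))
        (Complex.exp (-(c * r)) * -(c * 1)) r :=
      (((hasDerivAt_id r).ofReal_comp).const_mul c).neg.cexp
    refine (h1.smul (hasDerivAt_lam X hv r)).congr_deriv ?_
    rw [h, map_smul, smul_smul, ← add_smul]
    simp
  have hconst := is_const_of_deriv_eq_zero (fun r => (hder r).differentiableAt)
    (fun r => (hder r).deriv) t 0
  simp only [Complex.ofReal_zero, mul_zero, neg_zero, Complex.exp_zero, one_smul, zero_smul,
    expK_zero, lam_one] at hconst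
  conv_rhs => rw [← hconst]
  rw [smul_smul, ← Complex.exp_add, add_neg_cancel, Complex.exp_zero, one_smul]

/-- The spectral theorem for the symmetric operator `-i dλ(rot θ)`. Its eigenvalues are integers
because `exp(2π rot θ) = 1`. -/
theorem exists_eigenbasis [FiniteDimensional ℂ W] (hinv : ∀ k : K d, ∀ v ∈ W, lam k v ∈ W)
    (hr : W ≤ LinearMap.range (coef τ)) {θ : EuclideanSpace ℝ (Fin d)} (hθ : ‖θ‖ = 1) :
    ∃ (b : OrthonormalBasis (Fin (Module.finrank ℂ W)) ℂ W) (μ : Fin (Module.finrank ℂ W) → ℤ),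
      ∀ i (t : ℝ), lam (expK (t • rot θ)) (b i : L2K d) =
        Complex.exp (Complex.I * μ i * t) • (b i : L2K d) := by
  have hsym := isSymmetric_generator W.closed_of_finiteDimensional hinv hr (rot θ)
  have hb : ∀ i (t : ℝ), lam (expK (t • rot θ)) (hsym.eigenvectorBasis rfl i : L2K d) =
      Complex.exp (Complex.I * hsym.eigenvalues rfl i * t) •
        (hsym.eigenvectorBasis rfl i : L2K d) := by
    intro i t
    refine lam_expK_of_dLeft_eq (rot θ) (hr (Subtype.prop _)) ?_ t
    have h := congrArg Subtype.val (hsym.apply_eigenvectorBasis rfl i)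
    change -Complex.I • dLeft (rot θ) (hsym.eigenvectorBasis rfl i : L2K d) =
      (hsym.eigenvalues rfl i : ℂ) • (hsym.eigenvectorBasis rfl i : L2K d) at h
    rw [mul_smul, ← h, smul_smul]
    simp
  have hint : ∀ i, ∃ n : ℤ, hsym.eigenvalues rfl i = n := by
    intro i
    have h := hb i (2 * Real.pi)
    rw [expK_two_pi_smul_rot hθ, lam_one] at h
    have hne : (hsym.eigenvectorBasis rfl i : L2K d) ≠ 0 := fun h0 =>
      (hsym.eigenvectorBasis rfl).orthonormal.ne_zero i (Subtype.ext h0)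
    have h1 : Complex.exp (Complex.I * hsym.eigenvalues rfl i * (2 * Real.pi : ℝ)) = 1 := by
      have h2 : (Complex.exp (Complex.I * hsym.eigenvalues rfl i * (2 * Real.pi : ℝ)) - 1) •
          (hsym.eigenvectorBasis rfl i : L2K d) = 0 := by
        rw [sub_smul, ← h, one_smul, sub_self]
      exact sub_eq_zero.1 ((smul_eq_zero.1 h2).resolve_right hne)
    obtain ⟨n, hn⟩ := Complex.exp_eq_one_iff.1 h1
    refine ⟨n, ?_⟩
    have hpi : (2 * Real.pi * Complex.I : ℂ) ≠ 0 := Complex.two_pi_I_ne_zero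
    have h3 : (hsym.eigenvalues rfl i : ℂ) = n := by
      refine mul_right_cancel₀ hpi ?_
      rw [← hn]
      push_cast
      ring
    exact_mod_cast h3
  choose μ hμ using hint
  refine ⟨hsym.eigenvectorBasis rfl, μ, fun i t => ?_⟩
  rw [hb i t, hμ i]
  norm_cast

/-- The odd part of the rotation of `u` by twice the arctangent of `r`. -/
def oddRot (θ : EuclideanSpace ℝ (Fin d)) (u : L2K d) (r : ℝ) : L2K d :=
  lam (expK ((-(2 * Real.arctan r)) • rot θ)) u - lam (expK ((2 * Real.arctan r) • rot θ)) u

theorem continuous_oddRot (θ : EuclideanSpace ℝ (Fin d)) (u : L2K d) :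
    Continuous (oddRot θ u) := by
  have h := continuous_expK_smul (rot θ)
  have h1 : Continuous fun r : ℝ => expK ((-(2 * Real.arctan r)) • rot θ) :=
    h.comp (f := fun r : ℝ => -(2 * Real.arctan r)) (by fun_prop)
  have h2 : Continuous fun r : ℝ => expK ((2 * Real.arctan r) • rot θ) :=
    h.comp (f := fun r : ℝ => 2 * Real.arctan r) (by fun_prop)
  exact ((continuous_lam_apply u).comp h1).sub ((continuous_lam_apply u).comp h2)

/-- In an eigenbasis the odd part multiplies the coefficient of frequency `n` by `-2i sin(2n arctan
r)`. Integrating and applying Parseval turns the scalar bound into an operator bound that does not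
depend on the dimension. -/
theorem norm_integral_oddRot_le [FiniteDimensional ℂ W] (hinv : ∀ k : K d, ∀ v ∈ W, lam k v ∈ W)
    (hr : W ≤ LinearMap.range (coef τ)) {θ : EuclideanSpace ℝ (Fin d)} (hθ : ‖θ‖ = 1)
    {w : ℝ → ℝ} (hw : Continuous w) {R C : ℝ} (hC : 0 ≤ C)
    (hb : ∀ n : ℤ, |∫ r in (0 : ℝ)..R, w r * Real.sin (n * (2 * Real.arctan r))| ≤ C)
    {u : L2K d} (hu : u ∈ W) :
    ‖∫ r in (0 : ℝ)..R, w r • oddRot θ u r‖ ≤ 2 * C * ‖u‖ := by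
  obtain ⟨b, μ, hμ⟩ := exists_eigenbasis hinv hr hθ
  set c : Fin (Module.finrank ℂ W) → ℂ := fun i => inner ℂ (b i) (⟨u, hu⟩ : W) with hc
  have hu' : u = ∑ i, c i • (b i : L2K d) := by
    have h := congrArg Subtype.val (b.sum_repr' ⟨u, hu⟩)
    rw [Submodule.coe_sum] at h
    exact h.symm
  set κ : Fin (Module.finrank ℂ W) → ℝ := fun i =>
    ∫ r in (0 : ℝ)..R, w r * Real.sin (μ i * (2 * Real.arctan r)) with hκ
  have h1 : ∀ r : ℝ, w r • oddRot θ u r = ∑ i, (w r * Real.sin (μ i * (2 * Real.arctan r))) •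
      ((-2 * Complex.I * c i) • (b i : L2K d)) := by
    intro r
    rw [oddRot, hu', map_sum, map_sum, ← Finset.sum_sub_distrib, Finset.smul_sum]
    refine Finset.sum_congr rfl fun i _ => ?_
    rw [map_smul, map_smul, hμ, hμ, mul_smul]
    congr 1
    rw [real_smul_eq, smul_smul, smul_smul, smul_smul, ← sub_smul]
    congr 1
    have h2 : Complex.I * μ i * ((-(2 * Real.arctan r) : ℝ) : ℂ) =
        ((-(μ i * (2 * Real.arctan r)) : ℝ) : ℂ) * Complex.I := by
      push_cast
      ring
    have h3 : Complex.I * μ i * ((2 * Real.arctan r : ℝ) : ℂ) =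
        ((μ i * (2 * Real.arctan r) : ℝ) : ℂ) * Complex.I := by
      push_cast
      ring
    rw [h2, h3, Complex.exp_mul_I, Complex.exp_mul_I, ← Complex.ofReal_cos, ← Complex.ofReal_sin,
      ← Complex.ofReal_cos, ← Complex.ofReal_sin, Real.cos_neg, Real.sin_neg]
    push_cast
    ring
  have h2 : ∫ r in (0 : ℝ)..R, w r • oddRot θ u r =
      ((∑ i, (κ i * (-2 * Complex.I * c i)) • b i : W) : L2K d) := by
    simp only [h1]
    rw [intervalIntegral.integral_finsetSum, Submodule.coe_sum]
    · refine Finset.sum_congr rfl fun i _ => ?_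
      rw [intervalIntegral.integral_smul_const, real_smul_eq, smul_smul]
      rfl
    · intro i _
      refine Continuous.intervalIntegrable ?_ _ _
      have : Continuous fun r => w r * Real.sin (μ i * (2 * Real.arctan r)) := by fun_prop
      exact this.smul continuous_const
  have h3 : ‖(∑ i, (κ i * (-2 * Complex.I * c i)) • b i : W)‖ ^ 2 =
      ∑ i, ‖(κ i * (-2 * Complex.I * c i) : ℂ)‖ ^ 2 := by
    have h := b.sum_sq_norm_inner_right (∑ i, (κ i * (-2 * Complex.I * c i)) • b i)
    rw [← h]
    refine Finset.sum_congr rfl fun i _ => ?_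
    rw [b.orthonormal.inner_right_fintype]
  have h4 : ‖u‖ ^ 2 = ∑ i, ‖c i‖ ^ 2 := (b.sum_sq_norm_inner_right ⟨u, hu⟩).symm
  rw [h2]
  change ‖(∑ i, (κ i * (-2 * Complex.I * c i)) • b i : W)‖ ≤ _
  refine (sq_le_sq₀ (norm_nonneg _) (by positivity)).1 ?_
  rw [h3, mul_pow, h4, Finset.mul_sum]
  refine Finset.sum_le_sum fun i _ => ?_
  rw [← mul_pow]
  refine pow_le_pow_left₀ (norm_nonneg _) ?_ 2
  have h5 : ‖(κ i * (-2 * Complex.I * c i) : ℂ)‖ = 2 * |κ i| * ‖c i‖ := by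
    simp only [norm_mul, norm_neg, Complex.norm_I, Complex.norm_real, Real.norm_eq_abs,
      Complex.norm_two]
    ring
  rw [h5]
  gcongr
  exact hb (μ i)

end Spectral

/-! ### Radial integrals -/

section Radial

theorem integral_eq_integral_sphere {E F : Type*} [NormedAddCommGroup E] [NormedSpace ℝ E]
    [MeasurableSpace E] [BorelSpace E] [FiniteDimensional ℝ E] [Nontrivial E] (μ : Measure E)
    [μ.IsAddHaarMeasure] [NormedAddCommGroup F] [NormedSpace ℝ F] {f : E → F}
    (hf : Integrable f μ) :
    ∫ x, f x ∂μ = ∫ θ : Metric.sphere (0 : E) 1, (∫ r in Ioi (0 : ℝ),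
      r ^ (Module.finrank ℝ E - 1) • f (r • (θ : E))) ∂μ.toSphere := by
  let g : Metric.sphere (0 : E) 1 × Ioi (0 : ℝ) → F := fun p => f ((p.2 : ℝ) • (p.1 : E))
  have hg : ∀ x : ({(0)}ᶜ : Set E), g (homeomorphUnitSphereProd E x) = f x := by
    intro x
    have hx : ‖(x : E)‖ ≠ 0 := norm_ne_zero_iff.2 x.2
    simp [g, smul_smul, mul_inv_cancel₀ hx]
  have hmp := μ.measurePreserving_homeomorphUnitSphereProd
  have hme : MeasurableEmbedding (homeomorphUnitSphereProd E) :=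
    Homeomorph.measurableEmbedding _
  have h1 : ∫ x, f x ∂μ = ∫ x : ({(0)}ᶜ : Set E), f x ∂(μ.comap (↑)) := by
    rw [integral_subtype_comap (measurableSet_singleton _).compl, restrict_compl_singleton]
  have h2 : ∫ x : ({(0)}ᶜ : Set E), f x ∂(μ.comap (↑)) =
      ∫ p, g p ∂μ.toSphere.prod (.volumeIoiPow (Module.finrank ℝ E - 1)) := by
    rw [← hmp.integral_comp hme g]
    simp only [hg]
  have hgi : Integrable g (μ.toSphere.prod (.volumeIoiPow (Module.finrank ℝ E - 1))) := by
    rw [← hmp.integrable_comp_emb hme]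
    have : g ∘ homeomorphUnitSphereProd E = f ∘ Subtype.val := funext hg
    rw [this]
    exact (integrableOn_iff_comap_subtypeVal (measurableSet_singleton _).compl).1 hf.integrableOn
  rw [h1, h2, integral_prod _ hgi]
  congr 1
  ext1 θ
  simp only [g, Measure.volumeIoiPow, ENNReal.ofReal]
  rw [integral_withDensity_eq_integral_smul,
    integral_subtype_comap measurableSet_Ioi fun a : ℝ =>
      Real.toNNReal (a ^ (Module.finrank ℝ E - 1)) • f (a • (θ : E)),
    setIntegral_congr_fun measurableSet_Ioi fun x hx => ?_]
  · rw [NNReal.smul_def, Real.coe_toNNReal _ (pow_nonneg (mem_Ioi.1 hx).le _)]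
  · exact (measurable_subtype_coe.pow_const _).real_toNNReal

theorem norm_integral_le_of_radial {E F : Type*} [NormedAddCommGroup E] [NormedSpace ℝ E]
    [MeasurableSpace E] [BorelSpace E] [FiniteDimensional ℝ E] [Nontrivial E] (μ : Measure E)
    [μ.IsAddHaarMeasure] [NormedAddCommGroup F] [NormedSpace ℝ F] {f : E → F}
    (hf : Integrable f μ) {B : ℝ}
    (hB : ∀ θ : E, ‖θ‖ = 1 → ‖∫ r in Ioi (0 : ℝ),
      r ^ (Module.finrank ℝ E - 1) • f (r • θ)‖ ≤ B) :
    ‖∫ x, f x ∂μ‖ ≤ B * μ.toSphere.real univ := by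
  rw [integral_eq_integral_sphere μ hf]
  exact norm_integral_le_of_norm_le_const
    (Filter.Eventually.of_forall fun θ => hB θ (mem_sphere_zero_iff_norm.1 θ.2))

variable {d : ℕ} {s η : ℝ}

/-- The density is at most `r^(-1-η)`. Up to `r = 1/q` the quadratic factor gives `q^η / (2-η)`,
beyond it the factor `1` gives `q^η / η`. -/
theorem integral_radial_le (hd : 1 ≤ d) (hη : (d + η) / 2 ≤ s) (h0 : 0 < η) (h1 : η ≤ 1) {q : ℝ}
    (hq : 0 < q) :
    ‖∫ r in Ioi (0 : ℝ), r ^ (d - 1) • ((1 + r ^ 2) ^ (-s) * min 1 ((q * r) ^ 2))‖ ≤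
      2 / η * q ^ η := by
  set f : ℝ → ℝ := fun r => r ^ (d - 1) • ((1 + r ^ 2) ^ (-s) * min 1 ((q * r) ^ 2)) with hf
  have hfc : Continuous f := by
    have := continuous_one_add_sq_rpow (-s)
    fun_prop
  have hnn : ∀ r ∈ Ioi (0 : ℝ), 0 ≤ f r := fun r hr => by
    have := mem_Ioi.1 hr
    have h2 : 0 ≤ min 1 ((q * r) ^ 2) := le_min zero_le_one (sq_nonneg _)
    simp only [hf, smul_eq_mul]
    positivity
  have hker : ∀ r : ℝ, 0 < r → r ^ (d - 1) * (1 + r ^ 2) ^ (-s) ≤ r ^ (-1 - η) := by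
    intro r hr
    have h := pow_mul_one_add_sq_rpow_le hη h0.le hr
    have h2 : r ^ (-1 - η) = r⁻¹ * r ^ (-η) := by
      rw [sub_eq_add_neg, Real.rpow_add hr, Real.rpow_neg_one]
    have h3 : r ^ (d - 1) = r⁻¹ * r ^ d := by
      rw [← Nat.sub_add_cancel hd, pow_succ, Nat.add_sub_cancel]
      field_simp
    rw [h2, h3, mul_assoc]
    gcongr
  have hq0 : 0 < q⁻¹ := inv_pos.2 hq
  have hb1 : ∀ r ∈ Ioc (0 : ℝ) q⁻¹, f r ≤ q ^ 2 * r ^ (1 - η) := by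
    intro r hr
    have hr0 := hr.1
    have h2 : r ^ (1 - η) = r ^ (-1 - η) * r ^ 2 := by
      rw [← Real.rpow_natCast r 2, ← Real.rpow_add hr0]
      congr 1
      push_cast
      ring
    simp only [hf, smul_eq_mul]
    rw [h2, ← mul_assoc]
    calc _ ≤ r ^ (-1 - η) * (q * r) ^ 2 :=
          mul_le_mul (hker r hr0) (min_le_right _ _) (le_min zero_le_one (sq_nonneg _))
            (by positivity)
      _ = _ := by ring
  have hb2 : ∀ r ∈ Ioi q⁻¹, f r ≤ r ^ (-1 - η) := by
    intro r hr
    have hr0 : 0 < r := hq0.trans hr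
    simp only [hf, smul_eq_mul]
    rw [← mul_assoc]
    calc _ ≤ r ^ (-1 - η) * 1 :=
          mul_le_mul (hker r hr0) (min_le_left _ _) (le_min zero_le_one (sq_nonneg _))
            (by positivity)
      _ = _ := mul_one _
  have hi2 : IntegrableOn (fun r : ℝ => r ^ (-1 - η)) (Ioi q⁻¹) :=
    integrableOn_Ioi_rpow_of_lt (by linarith) hq0
  have hfi2 : IntegrableOn f (Ioi q⁻¹) := by
    refine hi2.mono' hfc.aestronglyMeasurable ?_
    refine (ae_restrict_iff' measurableSet_Ioi).2 (Filter.Eventually.of_forall fun r hr => ?_)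
    rw [Real.norm_eq_abs, abs_of_nonneg (hnn r (hq0.trans hr))]
    exact hb2 r hr
  have hfi1 : IntegrableOn f (Ioc 0 q⁻¹) :=
    (hfc.integrableOn_Icc).mono_set Ioc_subset_Icc_self
  have hi1 : IntervalIntegrable (fun r : ℝ => q ^ 2 * r ^ (1 - η)) volume 0 q⁻¹ :=
    (intervalIntegral.intervalIntegrable_rpow' (by linarith)).const_mul _
  have hI1 : ∫ r in Ioc (0 : ℝ) q⁻¹, f r ≤ q ^ η := by
    have h2 : ∫ r in Ioc (0 : ℝ) q⁻¹, f r ≤ ∫ r in Ioc (0 : ℝ) q⁻¹, q ^ 2 * r ^ (1 - η) :=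
      setIntegral_mono_on hfi1 ((intervalIntegrable_iff_integrableOn_Ioc_of_le hq0.le).1 hi1)
        measurableSet_Ioc hb1
    refine h2.trans ?_
    rw [← intervalIntegral.integral_of_le hq0.le, intervalIntegral.integral_const_mul,
      integral_rpow (Or.inl (by linarith)), Real.zero_rpow (by linarith), sub_zero,
      Real.inv_rpow hq.le, ← Real.rpow_neg hq.le, ← mul_div_assoc, ← Real.rpow_natCast q 2,
      ← Real.rpow_add hq]
    have h3 : ((2 : ℕ) : ℝ) + -(1 - η + 1) = η := by
      push_cast
      ring
    rw [h3]
    exact div_le_self (by positivity) (by linarith)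
  have hI2 : ∫ r in Ioi q⁻¹, f r ≤ 1 / η * q ^ η := by
    have h2 : ∫ r in Ioi q⁻¹, f r ≤ ∫ r in Ioi q⁻¹, r ^ (-1 - η) :=
      setIntegral_mono_on hfi2 hi2 measurableSet_Ioi hb2
    refine h2.trans ?_
    rw [integral_Ioi_rpow_of_lt (by linarith) hq0, Real.inv_rpow hq.le, ← Real.rpow_neg hq.le,
      show -(-1 - η + 1) = η by ring, show -1 - η + 1 = -η by ring, neg_div_neg_eq]
    exact le_of_eq (by ring)
  have hsplit : ∫ r in Ioi (0 : ℝ), f r =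
      (∫ r in Ioc (0 : ℝ) q⁻¹, f r) + ∫ r in Ioi q⁻¹, f r := by
    rw [← Ioc_union_Ioi_eq_Ioi hq0.le]
    exact setIntegral_union (Ioc_disjoint_Ioi le_rfl) measurableSet_Ioi hfi1 hfi2
  have hη1 : 1 ≤ 1 / η := by rw [le_div_iff₀ h0]; linarith
  rw [Real.norm_eq_abs, abs_of_nonneg (setIntegral_nonneg measurableSet_Ioi hnn), hsplit]
  calc _ ≤ q ^ η + 1 / η * q ^ η := add_le_add hI1 hI2
    _ ≤ 1 / η * q ^ η + 1 / η * q ^ η := by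
        gcongr
        exact le_mul_of_one_le_left (by positivity) hη1
    _ = _ := by ring

theorem nontrivial_euclidean (hd : 1 ≤ d) : Nontrivial (EuclideanSpace ℝ (Fin d)) := by
  have : Nonempty (Fin d) := ⟨⟨0, hd⟩⟩
  infer_instance

/-- The area of the unit sphere of `ℝ^d`. -/
def sphereArea (d : ℕ) : ℝ :=
  (volume : Measure (EuclideanSpace ℝ (Fin d))).toSphere.real univ

theorem integrable_one_add_norm_sq_mul_min (hs : (d : ℝ) / 2 < s) (q : ℝ) :
    Integrable fun y : EuclideanSpace ℝ (Fin d) =>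
      (1 + ‖y‖ ^ 2) ^ (-s) * min 1 ((q * ‖y‖) ^ 2) := by
  refine (integrable_one_add_norm_sq hs).mul_bdd (c := 1) ?_ (Filter.Eventually.of_forall fun y => ?_)
  · exact Continuous.aestronglyMeasurable (by fun_prop)
  · rw [Real.norm_eq_abs, abs_of_nonneg (le_min zero_le_one (sq_nonneg _))]
    exact min_le_left _ _

theorem integral_one_add_norm_sq_mul_min_le (hd : 1 ≤ d) (hη : (d + η) / 2 ≤ s) (h0 : 0 < η)
    (h1 : η ≤ 1) {q : ℝ} (hq : 0 < q) :
    ∫ y : EuclideanSpace ℝ (Fin d), (1 + ‖y‖ ^ 2) ^ (-s) * min 1 ((q * ‖y‖) ^ 2) ≤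
      2 / η * q ^ η * sphereArea d := by
  have := nontrivial_euclidean hd
  refine (le_abs_self _).trans ?_
  refine norm_integral_le_of_radial volume
    (integrable_one_add_norm_sq_mul_min (by linarith) q) fun θ hθ => ?_
  rw [finrank_euclideanSpace_fin]
  refine le_trans (le_of_eq ?_) (integral_radial_le hd hη h0 h1 hq)
  congr 1
  refine setIntegral_congr_fun measurableSet_Ioi fun r hr => ?_
  simp only [norm_smul, hθ, mul_one, Real.norm_eq_abs, abs_of_pos (mem_Ioi.1 hr)]

end Radial

/-! ### Linearization at the origin of the big cell -/

section Linearization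

variable {d : ℕ} {τ : IrredRep (K d)}

theorem kap_smul_inv {θ : EuclideanSpace ℝ (Fin d)} (hθ : ‖θ‖ = 1) (r : ℝ) :
    (kap (r • θ))⁻¹ = expK ((-(2 * Real.arctan r)) • rot θ) := by
  rw [kap_smul hθ, expK_neg]

theorem kap_neg_smul_inv {θ : EuclideanSpace ℝ (Fin d)} (hθ : ‖θ‖ = 1) (r : ℝ) :
    (kap (-(r • θ)))⁻¹ = expK ((2 * Real.arctan r) • rot θ) := by
  rw [← neg_smul, kap_smul_inv hθ, Real.arctan_neg, mul_neg, neg_neg]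

theorem exists_unit_smul (hd : 1 ≤ d) (z : EuclideanSpace ℝ (Fin d)) :
    ∃ θ : EuclideanSpace ℝ (Fin d), ‖θ‖ = 1 ∧ z = ‖z‖ • θ := by
  have := nontrivial_euclidean hd
  rcases eq_or_ne z 0 with rfl | hz
  · obtain ⟨θ, hθ⟩ := exists_norm_eq (EuclideanSpace ℝ (Fin d)) zero_le_one
    exact ⟨θ, hθ, by simp⟩
  · have h : ‖z‖ ≠ 0 := norm_ne_zero_iff.2 hz
    exact ⟨‖z‖⁻¹ • z, by simp [norm_smul, h], by rw [smul_smul, mul_inv_cancel₀ h, one_smul]⟩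

theorem abs_one_add_sq_rpow_sub_one_le {p : ℝ} (hp : 0 ≤ p) (r : ℝ) :
    |(1 + r ^ 2) ^ (-p) - 1| ≤ p * r ^ 2 := by
  have h0 : (0 : ℝ) < 1 + r ^ 2 := by positivity
  have h1 : (1 + r ^ 2) ^ (-p) ≤ 1 :=
    Real.rpow_le_one_of_one_le_of_nonpos (by nlinarith [sq_nonneg r]) (by linarith)
  have h2 : 1 - p * r ^ 2 ≤ (1 + r ^ 2) ^ (-p) := by
    rw [Real.rpow_def_of_pos h0]
    have h3 := Real.add_one_le_exp (Real.log (1 + r ^ 2) * -p)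
    have h4 := Real.log_le_sub_one_of_pos h0
    nlinarith
  rw [abs_le]
  constructor
  · linarith
  · nlinarith [sq_nonneg r, mul_nonneg hp (sq_nonneg r)]

theorem dLeft_smul_real (c : ℝ) (X : LieK d) {v : L2K d} (hv : v ∈ LinearMap.range (coef τ)) :
    dLeft (c • X) v = c • dLeft X v := by
  rw [dLeft_smul c X hv, real_smul_eq]

/-- Three errors of second order when `‖z‖ ≤ 1/L`: the weight costs `d r²`, Taylor's formula for the
rotation `4 L² r²`, and replacing `2 arctan r` by `2r` costs `L r²`; their sum is at most `(d+5) L²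
r²`. For larger `z` both terms are bounded trivially. The hypothesis on `L` is used for `v` and for
`dλ(rot θ) v`. -/
theorem norm_smul_lam_kap_sub_le (hd : 1 ≤ d) {L : ℝ} (hL1 : 1 ≤ L)
    (hL : ∀ w ∈ LinearMap.range (coef τ), ∀ x, ‖dLeft (rot x) w‖ ≤ L * ‖x‖ * ‖w‖)
    {v : L2K d} (hv : v ∈ LinearMap.range (coef τ)) {p : ℝ} (hp0 : 0 ≤ p) (hpd : p ≤ d)
    (z : EuclideanSpace ℝ (Fin d)) :
    ‖(1 + ‖z‖ ^ 2) ^ (-p) • lam (kap z)⁻¹ v - v +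
      (if ‖z‖ ≤ L⁻¹ then (2 : ℝ) • dLeft (rot z) v else 0)‖ ≤
      (d + 5) * min 1 ((L * ‖z‖) ^ 2) * ‖v‖ := by
  have hL0 : 0 < L := by linarith
  obtain ⟨θ, hθ, hz⟩ := exists_unit_smul hd z
  set r := ‖z‖ with hr
  have hr0 : 0 ≤ r := norm_nonneg z
  have hlam : (kap z)⁻¹ = expK ((-(2 * Real.arctan r)) • rot θ) := by
    rw [hz, kap_smul_inv hθ]
  split_ifs with h
  · have h1 : L * r ≤ 1 := by
      have := mul_le_mul_of_nonneg_left h hL0.le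
      rwa [mul_inv_cancel₀ hL0.ne'] at this
    have hmin : min 1 ((L * r) ^ 2) = (L * r) ^ 2 :=
      min_eq_right (pow_le_one₀ (by positivity) h1)
    have hD : dLeft (rot z) v = r • dLeft (rot θ) v := by
      conv_lhs => rw [hz]
      rw [map_smul, dLeft_smul_real r _ hv]
    have e1 : ‖((1 + r ^ 2) ^ (-p) - 1) • lam (kap z)⁻¹ v‖ ≤ d * r ^ 2 * ‖v‖ := by
      rw [norm_smul, LinearIsometry.norm_map, Real.norm_eq_abs]
      gcongr
      exact (abs_one_add_sq_rpow_sub_one_le hp0 r).trans (by gcongr)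
    have e2 : ‖lam (kap z)⁻¹ v - v - (-(2 * Real.arctan r)) • dLeft (rot θ) v‖ ≤
        4 * L ^ 2 * r ^ 2 * ‖v‖ := by
      have h2 := norm_lam_sub_sub_le (rot θ) hv (-(2 * Real.arctan r))
      rw [← hlam, ← real_smul_eq] at h2
      refine h2.trans ?_
      have h3 : ‖dLeft (rot θ) (dLeft (rot θ) v)‖ ≤ L * (L * ‖v‖) := by
        have h4 := hL _ (dLeft_mem_range (rot θ) hv) θ
        have h5 := hL v hv θ
        rw [hθ, mul_one] at h4 h5
        exact h4.trans (by gcongr)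
      have h6 : |-(2 * Real.arctan r)| ≤ 2 * r := by
        rw [abs_neg, abs_mul, abs_two, abs_of_nonneg (Real.arctan_nonneg.2 hr0)]
        gcongr
        exact arctan_le_self hr0
      calc _ ≤ L * (L * ‖v‖) * (2 * r) ^ 2 := by gcongr
        _ = _ := by ring
    have e3 : ‖(2 * r - 2 * Real.arctan r) • dLeft (rot θ) v‖ ≤ r ^ 2 * (L * ‖v‖) := by
      have h5 := hL v hv θ
      rw [hθ, mul_one] at h5
      rw [norm_smul, Real.norm_eq_abs, abs_sub_comm]
      gcongr
      exact abs_two_mul_arctan_sub_le hr0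
    have hsum : (1 + r ^ 2) ^ (-p) • lam (kap z)⁻¹ v - v + (2 : ℝ) • dLeft (rot z) v =
        ((1 + r ^ 2) ^ (-p) - 1) • lam (kap z)⁻¹ v +
          (lam (kap z)⁻¹ v - v - (-(2 * Real.arctan r)) • dLeft (rot θ) v) +
          (2 * r - 2 * Real.arctan r) • dLeft (rot θ) v := by
      rw [hD]
      module
    rw [hsum, hmin]
    refine (norm_add₃_le).trans ((add_le_add (add_le_add e1 e2) e3).trans ?_)
    have h7 : L ≤ L ^ 2 := by nlinarith
    have h8 : (1 : ℝ) ≤ L ^ 2 := by nlinarith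
    have h9 : (d : ℝ) ≤ d * L ^ 2 := le_mul_of_one_le_right d.cast_nonneg h8
    calc _ = (d + 4 * L ^ 2 + L) * (r ^ 2 * ‖v‖) := by ring
      _ ≤ (d * L ^ 2 + 4 * L ^ 2 + L ^ 2) * (r ^ 2 * ‖v‖) := by gcongr
      _ = _ := by ring
  · have h1 : 1 ≤ L * r := by
      have := mul_le_mul_of_nonneg_left (not_le.1 h).le hL0.le
      rwa [mul_inv_cancel₀ hL0.ne'] at this
    rw [min_eq_left (one_le_pow₀ h1), add_zero, mul_one]
    have h2 : (1 + r ^ 2) ^ (-p) ≤ 1 :=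
      Real.rpow_le_one_of_one_le_of_nonpos (by nlinarith) (by linarith)
    have h3 : ‖(1 + r ^ 2) ^ (-p) • lam (kap z)⁻¹ v‖ ≤ 1 * ‖v‖ := by
      rw [norm_smul, LinearIsometry.norm_map, Real.norm_eq_abs, abs_of_nonneg (by positivity)]
      gcongr
    calc _ ≤ 1 * ‖v‖ + ‖v‖ := (norm_sub_le _ _).trans (by gcongr)
      _ = 2 * ‖v‖ := by ring
      _ ≤ _ := by
          gcongr
          have : (0 : ℝ) ≤ d := d.cast_nonneg
          linarith

theorem continuous_lam_kap_inv (u : L2K d) :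
    Continuous fun y : EuclideanSpace ℝ (Fin d) => lam (kap y)⁻¹ u :=
  (continuous_lam_apply u).comp continuous_kap.inv

theorem continuous_dLeft_rot {v : L2K d} (hv : v ∈ LinearMap.range (coef τ)) :
    Continuous fun y : EuclideanSpace ℝ (Fin d) => dLeft (rot y) v := by
  have h : (fun y : EuclideanSpace ℝ (Fin d) => dLeft (rot y) v) =
      fun y => ∑ i, ((y i : ℝ) : ℂ) • dLeft (elemRot (i.succ, (0 : Fin (d + 1)))) v := by
    ext1 y
    rw [rot_eq_sum, dLeft_sum _ _ _ hv]
  rw [h]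
  refine continuous_finsetSum _ fun i _ => ?_
  have h2 : Continuous fun y : EuclideanSpace ℝ (Fin d) => ((y i : ℝ) : ℂ) :=
    Complex.continuous_ofReal.comp (by fun_prop)
  exact h2.smul continuous_const

variable {V : Submodule ℂ (L2K d)} {τ₁ τ₂ : IrredRep (K d)}

/-- The density of the linear part of the error term. -/
def linearDensity (V : Submodule ℂ (L2K d)) (τ₁ τ₂ : IrredRep (K d)) (s : ℝ) (u v : L2K d)
    (y : EuclideanSpace ℝ (Fin d)) : ℂ :=
  (((1 + ‖y‖ ^ 2) ^ (-s) : ℝ) : ℂ) *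
    inner ℂ (dLeft (rot y) v) (TOp V τ₁ τ₂ (lam (kap y)⁻¹ u))

theorem continuous_linearDensity (s : ℝ) (u : L2K d) {v : L2K d}
    (hv : v ∈ LinearMap.range (coef τ)) : Continuous (linearDensity V τ₁ τ₂ s u v) := by
  have h1 : Continuous fun y : EuclideanSpace ℝ (Fin d) => (1 + ‖y‖ ^ 2) ^ (-s) :=
    (continuous_one_add_sq_rpow (-s)).comp continuous_norm
  exact (Complex.continuous_ofReal.comp h1).mul
    ((continuous_dLeft_rot hv).inner ((TOp V τ₁ τ₂).continuous.comp (continuous_lam_kap_inv u)))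

/-- `rot y` is odd in `y`, so adding the values at `±rθ` leaves only the odd part of the rotated
`u`. The factor `r` from `rot (rθ)` raises `r^(d-1)` to `r^d`. -/
theorem linearDensity_add_neg (hd : 1 ≤ d) (s : ℝ) (u : L2K d) {v : L2K d}
    (hv : v ∈ LinearMap.range (coef τ)) {θ : EuclideanSpace ℝ (Fin d)} (hθ : ‖θ‖ = 1) (r : ℝ) :
    r ^ (d - 1) • (linearDensity V τ₁ τ₂ s u v (r • θ) +
      linearDensity V τ₁ τ₂ s u v (-(r • θ))) =
      inner ℂ (dLeft (rot θ) v)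
        (TOp V τ₁ τ₂ ((r ^ d * (1 + r ^ 2) ^ (-s)) • oddRot θ u r)) := by
  have hn : ‖r • θ‖ ^ 2 = r ^ 2 := by rw [norm_smul, hθ, mul_one, Real.norm_eq_abs, sq_abs]
  have h1 : rot (-(r • θ)) = (-r) • rot θ := by rw [← neg_smul, map_smul]
  have h2 : (r : ℝ) ^ d = r ^ (d - 1) * r := by rw [← pow_succ, Nat.sub_add_cancel hd]
  simp only [linearDensity, norm_neg, hn]
  rw [h1, map_smul, dLeft_smul _ _ hv, dLeft_smul _ _ hv, kap_smul_inv hθ, kap_neg_smul_inv hθ,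
    oddRot, real_smul_eq, map_smul, map_sub, inner_smul_left, inner_smul_left, inner_smul_right,
    inner_sub_right, Complex.real_smul, h2]
  simp only [Complex.conj_ofReal]
  push_cast
  ring

/-- Since the ball is symmetric, twice the integral is that of the symmetrized density. In polar
coordinates, `T` and the fixed vector `dλ(rot θ) v` come out of the radial integral, which is an
oscillatory integral of `u` inside its `K`-type. -/
theorem norm_integral_linearDensity_le (hd : 1 ≤ d) (hV : ∀ k : K d, ∀ v ∈ V, lam k v ∈ V)
    {s η : ℝ} (hη : (d + η) / 2 ≤ s) (h0 : 0 < η) (h1 : η ≤ 1) (hs : 0 ≤ s) (hs' : s ≤ d)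
    {L : ℝ} (hL0 : 0 ≤ L)
    (hL : ∀ w ∈ LinearMap.range (coef τ₂), ∀ x, ‖dLeft (rot x) w‖ ≤ L * ‖x‖ * ‖w‖)
    {u v : L2K d} (hu : u ∈ kType V τ₁) (hv : v ∈ kType V τ₂) {R : ℝ} (hR : 0 < R) :
    ‖∫ y in Metric.closedBall (0 : EuclideanSpace ℝ (Fin d)) R, linearDensity V τ₁ τ₂ s u v y‖ ≤
      L * ‖v‖ * (normT s V τ₁ τ₂ * ((3 * d + 3) / η * max 1 (R ^ (1 - η)) * ‖u‖)) *
        sphereArea d := by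
  have := nontrivial_euclidean hd
  have hv' := kType_le_range hv
  set D := linearDensity V τ₁ τ₂ s u v with hDdef
  set B := Metric.closedBall (0 : EuclideanSpace ℝ (Fin d)) R with hB
  set C := (3 * d + 3) / η * max 1 (R ^ (1 - η)) with hC
  have hC0 : 0 ≤ C := by positivity
  have hDc : Continuous D := continuous_linearDensity s u hv'
  have hBm : MeasurableSet B := measurableSet_closedBall
  have hi : Integrable (B.indicator D) :=
    (integrable_indicator_iff hBm).2 (hDc.continuousOn.integrableOn_compact (isCompact_closedBall 0 R))
  have hi' : Integrable fun y => B.indicator D (-y) := hi.comp_neg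
  have h2 : ∫ y, (B.indicator D y + B.indicator D (-y)) = 2 * ∫ y in B, D y := by
    rw [integral_add hi hi', integral_neg_eq_self, integral_indicator hBm, two_mul]
  have hrad : ∀ θ : EuclideanSpace ℝ (Fin d), ‖θ‖ = 1 → ‖∫ r in Ioi (0 : ℝ),
      r ^ (Module.finrank ℝ (EuclideanSpace ℝ (Fin d)) - 1) •
        (B.indicator D (r • θ) + B.indicator D (-(r • θ)))‖ ≤
      2 * (L * ‖v‖ * (normT s V τ₁ τ₂ * (C * ‖u‖))) := by
    intro θ hθ
    rw [finrank_euclideanSpace_fin]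
    set w : ℝ → ℝ := fun r => r ^ d * (1 + r ^ 2) ^ (-s) with hw
    have hwc : Continuous w := by
      have := continuous_one_add_sq_rpow (-s)
      fun_prop
    have hpt : ∀ r ∈ Ioi (0 : ℝ), r ^ (d - 1) •
        (B.indicator D (r • θ) + B.indicator D (-(r • θ))) = (Iic R).indicator
          (fun r => inner ℂ (dLeft (rot θ) v) (TOp V τ₁ τ₂ (w r • oddRot θ u r))) r := by
      intro r hr
      have hn : ‖r • θ‖ = r := by
        rw [norm_smul, hθ, mul_one, Real.norm_eq_abs, abs_of_pos (mem_Ioi.1 hr)]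
      by_cases hrR : r ≤ R
      · have m1 : r • θ ∈ B := by rw [hB, mem_closedBall_zero_iff, hn]; exact hrR
        have m2 : -(r • θ) ∈ B := by rw [hB, mem_closedBall_zero_iff, norm_neg, hn]; exact hrR
        rw [indicator_of_mem m1, indicator_of_mem m2, indicator_of_mem (mem_Iic.2 hrR)]
        exact linearDensity_add_neg hd s u hv' hθ r
      · have m1 : r • θ ∉ B := by rw [hB, mem_closedBall_zero_iff, hn]; exact hrR
        have m2 : -(r • θ) ∉ B := by rw [hB, mem_closedBall_zero_iff, norm_neg, hn]; exact hrR
        rw [indicator_of_notMem m1, indicator_of_notMem m2,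
          indicator_of_notMem (fun h => hrR (mem_Iic.1 h)), add_zero, smul_zero]
    rw [setIntegral_congr_fun measurableSet_Ioi hpt, setIntegral_indicator measurableSet_Iic,
      Ioi_inter_Iic]
    have hgc : Continuous fun r => w r • oddRot θ u r := hwc.smul (continuous_oddRot θ u)
    have hgi : IntegrableOn (fun r => w r • oddRot θ u r) (Ioc 0 R) :=
      hgc.integrableOn_Icc.mono_set Ioc_subset_Icc_self
    have h3 := ((innerSL ℂ (dLeft (rot θ) v)).comp (TOp V τ₁ τ₂)).integral_comp_comm hgi
    have h4 : ∫ r in Ioc 0 R, inner ℂ (dLeft (rot θ) v) (TOp V τ₁ τ₂ (w r • oddRot θ u r)) =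
        inner ℂ (dLeft (rot θ) v) (TOp V τ₁ τ₂ (∫ r in Ioc 0 R, w r • oddRot θ u r)) := h3
    have hmem : ∫ r in Ioc 0 R, w r • oddRot θ u r ∈ kType V τ₁ := by
      refine integral_mem_of_closed _ hgi fun r => ?_
      rw [real_smul_eq]
      exact Submodule.smul_mem _ _
        (Submodule.sub_mem _ (lam_mem_kType hV _ hu) (lam_mem_kType hV _ hu))
    have hG : ‖∫ r in Ioc 0 R, w r • oddRot θ u r‖ ≤ 2 * C * ‖u‖ := by
      rw [← intervalIntegral.integral_of_le hR.le]
      exact norm_integral_oddRot_le (W := kType V τ₁) (fun k v hv => lam_mem_kType hV k hv)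
        kType_le_range hθ hwc hC0 (fun n => abs_oscillatory_le hd hη h0 h1 hs hs' n hR) hu
    have hD1 : ‖dLeft (rot θ) v‖ ≤ L * ‖v‖ := by
      have := hL v hv' θ
      rwa [hθ, mul_one] at this
    rw [h4]
    calc _ ≤ ‖dLeft (rot θ) v‖ * ‖TOp V τ₁ τ₂ (∫ r in Ioc 0 R, w r • oddRot θ u r)‖ :=
          norm_inner_le_norm _ _
      _ ≤ (L * ‖v‖) * (normT s V τ₁ τ₂ * (2 * C * ‖u‖)) := by
          have hN := normT_nonneg s V τ₁ τ₂
          gcongr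
          exact (norm_TOp_le hV s τ₁ τ₂ hmem).trans (by gcongr)
      _ = _ := by ring
  have h5 := norm_integral_le_of_radial volume (hi.add hi') hrad
  have h6 : ‖∫ y, (B.indicator D y + B.indicator D (-y))‖ = 2 * ‖∫ y in B, D y‖ := by
    rw [h2, norm_mul, Complex.norm_two]
  have h7 : 2 * ‖∫ y in B, D y‖ ≤
      2 * (L * ‖v‖ * (normT s V τ₁ τ₂ * (C * ‖u‖))) * sphereArea d := h6 ▸ h5
  linarith

end Linearization

/-! ### The error estimate -/

section Main

variable {d : ℕ} {V : Submodule ℂ (L2K d)} {τ₁ τ₂ : IrredRep (K d)}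

theorem integrable_inner_lam_kap {s : ℝ} (hs : (d : ℝ) / 2 < s) (u v : L2K d) :
    Integrable fun y : EuclideanSpace ℝ (Fin d) => (((1 + ‖y‖ ^ 2) ^ (-s) : ℝ) : ℂ) *
      inner ℂ v (TOp V τ₁ τ₂ (lam (kap y)⁻¹ u)) := by
  have h := ((innerSL ℂ v).comp (TOp V τ₁ τ₂)).integrable_comp (integrable_rpow_smul_lam hs u)
  refine h.congr (Filter.Eventually.of_forall fun y => ?_)
  change inner ℂ v (TOp V τ₁ τ₂ ((1 + ‖y‖ ^ 2) ^ (-s) • lam (kap y)⁻¹ u)) = _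
  rw [real_smul_eq, map_smul, inner_smul_right]

theorem norm_pairing_le (u v : L2K d) (x y : EuclideanSpace ℝ (Fin d)) :
    ‖pairing V τ₁ τ₂ u v x y‖ ≤ ‖v‖ * (‖TOp V τ₁ τ₂‖ * ‖u‖) := by
  refine (norm_inner_le_norm _ _).trans ?_
  rw [LinearIsometry.norm_map]
  gcongr
  refine ((TOp V τ₁ τ₂).le_opNorm _).trans ?_
  rw [LinearIsometry.norm_map]

theorem integrable_pairing {s : ℝ} (hs : (d : ℝ) / 2 < s) (hs' : s ≤ d) (ε : ℝ) (u v : L2K d) :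
    Integrable fun y : EuclideanSpace ℝ (Fin d) => (((1 + ‖y‖ ^ 2) ^ (-s) *
      (1 + ‖ε • y‖ ^ 2) ^ (s - d) : ℝ) : ℂ) * pairing V τ₁ τ₂ u v y (ε • y) := by
  have hc : Continuous fun y : EuclideanSpace ℝ (Fin d) =>
      (((1 + ‖ε • y‖ ^ 2) ^ (s - d) : ℝ) : ℂ) * pairing V τ₁ τ₂ u v y (ε • y) := by
    have h1 : Continuous fun y : EuclideanSpace ℝ (Fin d) => (1 + ‖ε • y‖ ^ 2) ^ (s - d) :=
      (continuous_one_add_sq_rpow (s - d)).comp (by fun_prop)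
    have h2 : Continuous fun y : EuclideanSpace ℝ (Fin d) => lam (kap (ε • y))⁻¹ v :=
      (continuous_lam_kap_inv v).comp (continuous_const_smul ε)
    exact (Complex.continuous_ofReal.comp h1).mul
      (h2.inner ((TOp V τ₁ τ₂).continuous.comp (continuous_lam_kap_inv u)))
  have h := (integrable_one_add_norm_sq hs).ofReal (𝕜 := ℂ)
  have h3 := h.mul_bdd (c := 1 * (‖v‖ * (‖TOp V τ₁ τ₂‖ * ‖u‖))) hc.aestronglyMeasurable
    (Filter.Eventually.of_forall fun y => ?_)
  · refine h3.congr (Filter.Eventually.of_forall fun y => ?_)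
    simp only [Complex.ofReal_mul, mul_assoc]
    rfl
  · rw [norm_mul, Complex.norm_real, Real.norm_eq_abs, abs_of_nonneg (by positivity)]
    gcongr
    · exact Real.rpow_le_one_of_one_le_of_nonpos (by nlinarith [sq_nonneg ‖ε • y‖]) (by linarith)
    · exact norm_pairing_le u v _ _

/-- The linearization of `ψ` at `z = εy` is applied under the integral sign. Adding back the linear
part leaves only the quadratic remainder, to which absolute values may be applied. -/
theorem norm_integral_error_le (hd : 1 ≤ d) (hV : ∀ k : K d, ∀ v ∈ V, lam k v ∈ V)
    {s η : ℝ} (hη : (d + η) / 2 ≤ s) (h0 : 0 < η) (h1 : η ≤ 1) (hs' : s ≤ d)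
    {L : ℝ} (hL1 : 1 ≤ L)
    (hL : ∀ w ∈ LinearMap.range (coef τ₂), ∀ x, ‖dLeft (rot x) w‖ ≤ L * ‖x‖ * ‖w‖)
    {u v : L2K d} (hu : u ∈ kType V τ₁) (hv : v ∈ kType V τ₂) {ε : ℝ} (hε : 0 < ε) :
    ‖(∫ y : EuclideanSpace ℝ (Fin d), (((1 + ‖y‖ ^ 2) ^ (-s) *
        (1 + ‖ε • y‖ ^ 2) ^ (s - d) : ℝ) : ℂ) * pairing V τ₁ τ₂ u v y (ε • y)) -
      (∫ y : EuclideanSpace ℝ (Fin d), (((1 + ‖y‖ ^ 2) ^ (-s) : ℝ) : ℂ) *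
        inner ℂ v (TOp V τ₁ τ₂ (lam (kap y)⁻¹ u))) +
      2 * ε * ∫ y in Metric.closedBall (0 : EuclideanSpace ℝ (Fin d)) (L * ε)⁻¹,
        linearDensity V τ₁ τ₂ s u v y‖ ≤
      (d + 5) * ‖v‖ * (normT s V τ₁ τ₂ * ‖u‖) * (2 / η * (L * ε) ^ η * sphereArea d) := by
  have hs : (d : ℝ) / 2 < s := by linarith
  have hL0 : 0 < L := by linarith
  have hv' := kType_le_range hv
  have hN := normT_nonneg s V τ₁ τ₂
  set B := Metric.closedBall (0 : EuclideanSpace ℝ (Fin d)) (L * ε)⁻¹ with hB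
  have hBm : MeasurableSet B := measurableSet_closedBall
  have hi1 := integrable_pairing (V := V) (τ₁ := τ₁) (τ₂ := τ₂) hs hs' ε u v
  have hi2 := integrable_inner_lam_kap (V := V) (τ₁ := τ₁) (τ₂ := τ₂) hs u v
  have hi3 : Integrable (B.indicator (linearDensity V τ₁ τ₂ s u v)) :=
    (integrable_indicator_iff hBm).2
      ((continuous_linearDensity s u hv').continuousOn.integrableOn_compact
        (isCompact_closedBall 0 _))
  rw [← integral_indicator hBm, ← integral_sub hi1 hi2, ← integral_const_mul]
  refine (congrArg norm (integral_add (hi1.sub hi2) (hi3.const_mul (2 * (ε : ℂ))))).symm.le.trans ?_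
  have hbound : ∀ y : EuclideanSpace ℝ (Fin d),
      ‖(((1 + ‖y‖ ^ 2) ^ (-s) * (1 + ‖ε • y‖ ^ 2) ^ (s - d) : ℝ) : ℂ) *
        pairing V τ₁ τ₂ u v y (ε • y) - (((1 + ‖y‖ ^ 2) ^ (-s) : ℝ) : ℂ) *
        inner ℂ v (TOp V τ₁ τ₂ (lam (kap y)⁻¹ u)) +
        2 * ε * B.indicator (linearDensity V τ₁ τ₂ s u v) y‖ ≤
      (d + 5) * ‖v‖ * (normT s V τ₁ τ₂ * ‖u‖) *
        ((1 + ‖y‖ ^ 2) ^ (-s) * min 1 ((L * ε * ‖y‖) ^ 2)) := by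
    intro y
    have hlin := norm_smul_lam_kap_sub_le hd hL1 hL hv' (p := d - s) (by linarith) (by linarith)
      (ε • y)
    rw [neg_sub] at hlin
    -- The cutoff radius of the linearization becomes the radius `(Lε)⁻¹` of the ball.
    have hiff : ‖ε • y‖ ≤ L⁻¹ ↔ y ∈ B := by
      rw [hB, mem_closedBall_zero_iff, norm_smul, Real.norm_eq_abs, abs_of_pos hε, mul_inv,
        ← div_eq_mul_inv, le_div_iff₀ hε, mul_comm]
    have hind : (((1 + ‖y‖ ^ 2) ^ (-s) : ℝ) : ℂ) *
        inner ℂ (if ‖ε • y‖ ≤ L⁻¹ then (2 : ℝ) • dLeft (rot (ε • y)) v else 0)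
          (TOp V τ₁ τ₂ (lam (kap y)⁻¹ u)) =
        2 * ε * B.indicator (linearDensity V τ₁ τ₂ s u v) y := by
      by_cases hy : y ∈ B
      · rw [if_pos (hiff.2 hy), indicator_of_mem hy, map_smul, dLeft_smul _ _ hv', real_smul_eq,
          inner_smul_left, inner_smul_left, linearDensity]
        simp only [Complex.conj_ofReal]
        push_cast
        ring
      · rw [if_neg (fun h => hy (hiff.1 h)), indicator_of_notMem hy, inner_zero_left, mul_zero,
          mul_zero]
    have heq : (((1 + ‖y‖ ^ 2) ^ (-s) * (1 + ‖ε • y‖ ^ 2) ^ (s - d) : ℝ) : ℂ) *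
        pairing V τ₁ τ₂ u v y (ε • y) - (((1 + ‖y‖ ^ 2) ^ (-s) : ℝ) : ℂ) *
        inner ℂ v (TOp V τ₁ τ₂ (lam (kap y)⁻¹ u)) +
        2 * ε * B.indicator (linearDensity V τ₁ τ₂ s u v) y =
        (((1 + ‖y‖ ^ 2) ^ (-s) : ℝ) : ℂ) *
          inner ℂ ((1 + ‖ε • y‖ ^ 2) ^ (s - d) • lam (kap (ε • y))⁻¹ v - v +
            (if ‖ε • y‖ ≤ L⁻¹ then (2 : ℝ) • dLeft (rot (ε • y)) v else 0))
            (TOp V τ₁ τ₂ (lam (kap y)⁻¹ u)) := by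
      rw [← hind, inner_add_left, inner_sub_left, real_smul_eq ((1 + ‖ε • y‖ ^ 2) ^ (s - d)),
        inner_smul_left, Complex.conj_ofReal, pairing]
      push_cast
      ring
    rw [heq, norm_mul, Complex.norm_real, Real.norm_eq_abs, abs_of_nonneg (by positivity)]
    have hT : ‖TOp V τ₁ τ₂ (lam (kap y)⁻¹ u)‖ ≤ normT s V τ₁ τ₂ * ‖u‖ := by
      have := norm_TOp_le hV s τ₁ τ₂ (lam_mem_kType hV (kap y)⁻¹ hu)
      rwa [LinearIsometry.norm_map] at this
    have hnorm : L * ‖ε • y‖ = L * ε * ‖y‖ := by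
      rw [norm_smul, Real.norm_eq_abs, abs_of_pos hε, mul_assoc]
    rw [hnorm] at hlin
    have hm0 : 0 ≤ min 1 ((L * ε * ‖y‖) ^ 2) := le_min zero_le_one (sq_nonneg _)
    calc _ ≤ (1 + ‖y‖ ^ 2) ^ (-s) * ((d + 5) * min 1 ((L * ε * ‖y‖) ^ 2) * ‖v‖ *
          (normT s V τ₁ τ₂ * ‖u‖)) := by
          gcongr
          refine (norm_inner_le_norm _ _).trans ?_
          exact mul_le_mul hlin hT (norm_nonneg _) (by positivity)
      _ = _ := by ring
  refine (norm_integral_le_of_norm_le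
    ((integrable_one_add_norm_sq_mul_min hs (L * ε)).const_mul _)
    (Filter.Eventually.of_forall hbound)).trans ?_
  rw [integral_const_mul]
  gcongr
  exact integral_one_add_norm_sq_mul_min_le hd hη h0 h1 (by positivity)

theorem eta_pos {s : ℝ} (hs : (d : ℝ) / 2 < s) : 0 < eta d s :=
  lt_min (by linarith) one_pos

theorem sphereArea_nonneg (d : ℕ) : 0 ≤ sphereArea d := measureReal_nonneg

/-- The remainder and the linear term are combined at `ε = e^{-t}`. They contribute `2(d+5)` and
`2(3d+3)` to the constant `8d + 16`. -/
theorem norm_matrixCoefficient_sub_le (hd : 1 ≤ d) (hV : ∀ k : K d, ∀ v ∈ V, lam k v ∈ V)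
    {s : ℝ} (hs : (d : ℝ) / 2 < s) (hs' : s < d)
    {L : ℝ} (hL1 : 1 ≤ L)
    (hL : ∀ w ∈ LinearMap.range (coef τ₂), ∀ x, ‖dLeft (rot x) w‖ ≤ L * ‖x‖ * ‖w‖)
    {u v : L2K d} (hu : u ∈ kType V τ₁) (hv : v ∈ kType V τ₂) {t : ℝ} (ht : 0 ≤ t) :
    ‖innerK (U s (a d t) u) v -
        (Real.exp ((s - d) * t) : ℂ) * innerK (T s V τ₂ (Cplus s u)) v‖ ≤
      (8 * d + 16) * cellConst d * sphereArea d / eta d s *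
        Real.exp ((s - d - eta d s) * t) * normT s V τ₁ τ₂ * ‖u‖ * (L * ‖v‖) := by
  have h0 := eta_pos hs
  have h1 : eta d s ≤ 1 := min_le_right _ _
  have hη : (d + eta d s) / 2 ≤ s := by
    have : eta d s ≤ 2 * s - d := min_le_left _ _
    linarith
  set η := eta d s with hηdef
  have hsp : 0 ≤ s := by
    have : (0 : ℝ) ≤ d := d.cast_nonneg
    linarith
  have hN := normT_nonneg s V τ₁ τ₂
  have hc := cellConst_pos hd
  have hσ := sphereArea_nonneg d
  have hL0 : 0 < L := by linarith
  set ε := Real.exp (-t) with hεdef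
  have hε : 0 < ε := Real.exp_pos _
  have hε1 : ε ≤ 1 := Real.exp_le_one_iff.2 (by linarith)
  have hεη : ε ^ η = Real.exp (-(η * t)) := by
    rw [hεdef, ← Real.exp_mul]
    congr 1
    ring
  rw [innerK_U_a hd hV hsp ht hu hv, innerK_T_Cplus hV hs hu]
  have hE := norm_integral_error_le hd hV hη h0 h1 hs'.le hL1 hL hu hv hε
  have hR : 0 < (L * ε)⁻¹ := by positivity
  have hD := norm_integral_linearDensity_le hd hV hη h0 h1 hsp hs'.le hL0.le hL hu hv hR
  set I₁ := ∫ y : EuclideanSpace ℝ (Fin d), (((1 + ‖y‖ ^ 2) ^ (-s) *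
        (1 + ‖ε • y‖ ^ 2) ^ (s - d) : ℝ) : ℂ) * pairing V τ₁ τ₂ u v y (ε • y)
  set I₂ := ∫ y : EuclideanSpace ℝ (Fin d), (((1 + ‖y‖ ^ 2) ^ (-s) : ℝ) : ℂ) *
        inner ℂ v (TOp V τ₁ τ₂ (lam (kap y)⁻¹ u))
  set I₃ := ∫ y in Metric.closedBall (0 : EuclideanSpace ℝ (Fin d)) (L * ε)⁻¹,
        linearDensity V τ₁ τ₂ s u v y
  -- Because `L ≥ 1` and `η ≤ 1`, only the first power of `L` is lost; so one derivative of `v`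
  -- suffices although Taylor's formula was used to second order.
  have hq : (L * ε) ^ η ≤ L * ε ^ η := by
    rw [Real.mul_rpow hL0.le hε.le]
    gcongr
    exact (Real.rpow_le_rpow_of_exponent_le hL1 h1).trans (Real.rpow_one L).le
  -- The factor `ε` of the linear term meets its growth `R^(1-η)`; here `L ≥ 1` only helps, and `t ≥
  -- 0` gives `ε ≤ ε^η`.
  have hm : ε * max 1 ((L * ε)⁻¹ ^ (1 - η)) ≤ ε ^ η := by
    rw [mul_max_of_nonneg _ _ hε.le]
    refine max_le ?_ ?_
    · rw [mul_one]
      calc ε = ε ^ (1 : ℝ) := (Real.rpow_one ε).symm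
        _ ≤ _ := Real.rpow_le_rpow_of_exponent_ge hε hε1 h1
    · have h3 : (L * ε)⁻¹ ^ (1 - η) ≤ ε⁻¹ ^ (1 - η) := by
        refine Real.rpow_le_rpow hR.le ?_ (by linarith)
        exact inv_anti₀ hε (le_mul_of_one_le_left hε.le hL1)
      calc ε * (L * ε)⁻¹ ^ (1 - η) ≤ ε ^ (1 : ℝ) * ε⁻¹ ^ (1 - η) := by
            rw [Real.rpow_one]
            gcongr
        _ = ε ^ η := by
            rw [Real.inv_rpow hε.le, ← Real.rpow_neg hε.le, ← Real.rpow_add hε]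
            congr 1
            ring
  have hdiff : ‖I₁ - I₂‖ ≤ (8 * d + 16) * sphereArea d / η * ε ^ η *
      normT s V τ₁ τ₂ * ‖u‖ * (L * ‖v‖) := by
    have h4 : I₁ - I₂ = (I₁ - I₂ + 2 * ε * I₃) - 2 * ε * I₃ := by ring
    have h5 : ‖2 * (ε : ℂ) * I₃‖ = 2 * ε * ‖I₃‖ := by
      rw [norm_mul, norm_mul, Complex.norm_two, Complex.norm_real, Real.norm_eq_abs,
        abs_of_pos hε]
    rw [h4]
    calc _ ≤ ‖I₁ - I₂ + 2 * ε * I₃‖ + 2 * ε * ‖I₃‖ := h5 ▸ norm_sub_le _ _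
      _ ≤ (d + 5) * ‖v‖ * (normT s V τ₁ τ₂ * ‖u‖) * (2 / η * (L * ε) ^ η * sphereArea d) +
          2 * ε * (L * ‖v‖ * (normT s V τ₁ τ₂ * ((3 * d + 3) / η *
            max 1 ((L * ε)⁻¹ ^ (1 - η)) * ‖u‖)) * sphereArea d) := by gcongr
      _ = (d + 5) * ‖v‖ * (normT s V τ₁ τ₂ * ‖u‖) * (2 / η * (L * ε) ^ η * sphereArea d) +
          2 * (L * ‖v‖ * (normT s V τ₁ τ₂ * ((3 * d + 3) / η *
            (ε * max 1 ((L * ε)⁻¹ ^ (1 - η))) * ‖u‖)) * sphereArea d) := by ring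
      _ ≤ (d + 5) * ‖v‖ * (normT s V τ₁ τ₂ * ‖u‖) * (2 / η * (L * ε ^ η) * sphereArea d) +
          2 * (L * ‖v‖ * (normT s V τ₁ τ₂ * ((3 * d + 3) / η *
            ε ^ η * ‖u‖)) * sphereArea d) := by gcongr
      _ = _ := by ring
  have h6 : (Real.exp ((s - d) * t) : ℂ) * (cellConst d * I₁) -
      (Real.exp ((s - d) * t) : ℂ) * (cellConst d * I₂) =
      ((Real.exp ((s - d) * t) * cellConst d : ℝ) : ℂ) * (I₁ - I₂) := by
    push_cast
    ring
  have h7 : Real.exp ((s - d - η) * t) = Real.exp ((s - d) * t) * ε ^ η := by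
    rw [hεη, ← Real.exp_add]
    congr 1
    ring
  rw [h6, norm_mul, Complex.norm_real, Real.norm_eq_abs, abs_of_nonneg (by positivity), h7]
  calc _ ≤ Real.exp ((s - d) * t) * cellConst d * ((8 * d + 16) * sphereArea d / η * ε ^ η *
      normT s V τ₁ τ₂ * ‖u‖ * (L * ‖v‖)) := by gcongr
    _ = _ := by ring

theorem casimirConst_nonneg {v : L2K d} {τ : IrredRep (K d)} (hv : v ∈ LinearMap.range (coef τ))
    (h0 : v ≠ 0) : 0 ≤ casimirConst τ := by
  have h := sum_norm_dLeft_sq hv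
  have h1 : 0 ≤ ∑ p : Fin (d + 1) × Fin (d + 1), ‖dLeft (elemRot p) v‖ ^ 2 :=
    Finset.sum_nonneg fun p _ => sq_nonneg _
  rw [h] at h1
  exact nonneg_of_mul_nonneg_left h1 (by positivity)

theorem norm_dLeft_rot_le {τ : IrredRep (K d)} (hc : 0 ≤ casimirConst τ) {w : L2K d}
    (hw : w ∈ LinearMap.range (coef τ)) (x : EuclideanSpace ℝ (Fin d)) :
    ‖dLeft (rot x) w‖ ≤ √(1 + casimirConst τ) * ‖x‖ * ‖w‖ := by
  refine (sq_le_sq₀ (norm_nonneg _) (by positivity)).1 ?_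
  rw [mul_pow, mul_pow, Real.sq_sqrt (by positivity)]
  refine (norm_dLeft_rot_sq_le x hw).trans ?_
  gcongr
  linarith

theorem bddAbove_image_div_eta (A : ℝ) {J : Set ℝ} (hJ : IsCompact J)
    (hJs : J ⊆ Ioo ((d : ℝ) / 2) d) : BddAbove ((fun s => A / eta d s) '' J) := by
  refine (hJ.image_of_continuousOn ?_).bddAbove
  have h : Continuous (eta d) := by
    unfold eta
    fun_prop
  exact continuousOn_const.div h.continuousOn fun s hs => (eta_pos (hJs hs).1).ne'

end Main

end HypRep

end

theorem mainTheorem7 (d : ℕ) (hd : 1 ≤ d) {ι : Type*} [Fintype ι]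
    (X : Module.Basis ι ℝ (HypRep.LieK d)) :
    ∃ C : ℝ → ℝ,
      (∀ J : Set ℝ, IsCompact J → J ⊆ Set.Ioo ((d : ℝ) / 2) d → BddAbove (C '' J)) ∧
      ∀ (s : ℝ) (υ : HypRep.IrredRep (HypRep.M d)) (V : Submodule ℂ (HypRep.L2K d)),
        HypRep.IsComplementarySeries υ s V →
        ∀ (τ₁ τ₂ : HypRep.IrredRep (HypRep.K d)),
          ∀ u ∈ HypRep.kType V τ₁, ∀ v ∈ HypRep.kType V τ₂, ∀ t : ℝ, 0 ≤ t →
            ‖HypRep.innerK (HypRep.U s (HypRep.a d t) u) v -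
                (Real.exp ((s - d) * t) : ℂ) *
                  HypRep.innerK (HypRep.T s V τ₂ (HypRep.Cplus s u)) v‖ ≤
              C s * Real.exp ((s - d - HypRep.eta d s) * t) * HypRep.normT s V τ₁ τ₂ * ‖u‖ *
                HypRep.sobolev X v := by
  obtain ⟨A, hA0, hA⟩ := HypRep.exists_casimirConst_le X
  refine ⟨fun s => (8 * d + 16) * HypRep.cellConst d * HypRep.sphereArea d * A / HypRep.eta d s,
    fun J hJ hJs => HypRep.bddAbove_image_div_eta _ hJ hJs, ?_⟩
  intro s υ V hVs τ₁ τ₂ u hu v hv t ht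
  have hV : ∀ k : HypRep.K d, ∀ v ∈ V, HypRep.lam k v ∈ V := fun k v hv => by
    rw [← HypRep.U_embK s k v]
    exact hVs.invariant _ (HypRep.embK_mem k) v hv
  have hη := HypRep.eta_pos hVs.lt_s
  have hN := HypRep.normT_nonneg s V τ₁ τ₂
  have hc := HypRep.cellConst_pos hd
  have hσ := HypRep.sphereArea_nonneg d
  have hS : 0 ≤ HypRep.sobolev X v := Real.sqrt_nonneg _
  -- The chosen Casimir constant is known to be nonnegative only if the isotypic part has a nonzero
  -- vector.
  rcases eq_or_ne v 0 with rfl | hv0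
  · simp only [HypRep.innerK_eq, inner_zero_left, mul_zero, sub_zero, norm_zero]
    positivity
  have hv' := HypRep.kType_le_range hv
  have hcas := HypRep.casimirConst_nonneg hv' hv0
  have hL1 : 1 ≤ √(1 + HypRep.casimirConst τ₂) := Real.one_le_sqrt.2 (by linarith)
  -- With `L = √(1 + c_τ₂)` the factor `L ‖v‖` of the estimate is replaced by the Sobolev norm, so
  -- the dependence on `τ₂` disappears from the constant.
  have hLv : √(1 + HypRep.casimirConst τ₂) * ‖v‖ ≤ A * HypRep.sobolev X v := by
    refine (sq_le_sq₀ (by positivity) (by positivity)).1 ?_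
    rw [mul_pow, Real.sq_sqrt (by positivity)]
    exact hA τ₂ v hv'
  refine (HypRep.norm_matrixCoefficient_sub_le hd hV hVs.lt_s hVs.s_lt hL1
    (fun w hw x => HypRep.norm_dLeft_rot_le hcas hw x) hu hv ht).trans ?_
  calc _ ≤ (8 * d + 16) * HypRep.cellConst d * HypRep.sphereArea d / HypRep.eta d s *
        Real.exp ((s - d - HypRep.eta d s) * t) * HypRep.normT s V τ₁ τ₂ * ‖u‖ *
          (A * HypRep.sobolev X v) := by gcongr
    _ = _ := by ring
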